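/- Let $m>0$ (the mass of one particle interacting with $N$ spinless fermions of mass $1$). Let $\hat f(q)=(2\pi)^{-3k/2}\int_{\mathbb{R}^{3k}} e^{-iq\cdot x}f(x)\,dx$ denote the unitary Fourier transform on $L^2(\mathbb{R}^{3k})$, and let the subscript "as" denote functions of $k$ variables in $\mathbb{R}^3$ that are antisymmetric under permutations of these variables. For $\mu>0$, $N\ge 2$ and $q_i\in\mathbb{R}^3$ put $$G(q_1,\dots,q_N)=\Big(\sum_{i=1}^N q_i^2+\tfrac{2}{m+1}\sum_{1\le i<j\le N}q_i\cdot q_j+\mu\Big)^{-1},$$ $$L(q_1,\dots,q_{N-1})=2\pi^2\Big(\tfrac{m(m+2)}{(m+1)^2}\sum_{i=1}^{N-1}q_i^2+\tfrac{2m}{(m+1)^2}\sum_{1\le i<j\le N-1}q_i\cdot q_j+\mu\Big)^{1/2},$$ and, for $\xi\in H^{1/2}_{\rm as}(\mathbb{R}^{3(N-1)})$, with $\vec q=(q_1,\dots,q_{N-2})$, $$T_{\rm diag}(\xi)=\int_{\mathbb{R}^{3(N-1)}}|\hat\xi(s,\vec q)|^2L(s,\vec q)\,ds\,d\vec q,\qquad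 T_{\rm off}(\xi)=(N-1)\int_{\mathbb{R}^{3N}}\overline{\hat\xi(s,\vec q)}\,\hat\xi(t,\vec q)\,G(s,t,\vec q)\,ds\,dt\,d\vec q .$$ Let $G\xi$ be the function with Fourier transform $\widehat{G\xi}(q_1,\dots,q_N)=G(q_1,\dots,q_N)\sum_{i=1}^N(-1)^{i+1}\hat\xi(q_1,\dots,q_{i-1},q_{i+1},\dots,q_N)$. For $\alpha\in\mathbb{R}$ the quadratic form $F_\alpha$ has the domain $$D(F_\alpha)=\{u\in L^2_{\rm as}(\mathbb{R}^{3N}) : u=w+G\xi,\ w\in H^1_{\rm as}(\mathbb{R}^{3N}),\ \xi\in H^{1/2}_{\rm as}(\mathbb{R}^{3(N-1)})\}$$ and, for $u=w+G\xi\in D(F_\alpha)$ (this decomposition is unique), the value $$F_\alpha(u)=\int_{\mathbb{R}^{3N}}\frac{|\hat w(q)|^2}{G(q)}\,dq-\mu\|u\|^2+N\big(\alpha\|\xi\|^2+T_{\rm diag}(\xi)+T_{\rm off}(\xi)\big),$$ where $\|\cdot\|$ is the $L^2$ norm. (Neither $D(F_\alpha)$ nor $F_\alpha(u)$ depends on $\mu>0$.)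 Finally, with $A=(2+m)^{-1}$ and $\ell_m(s,K,Q)=\big(\tfrac{m}{(m+1)^2}(s+K)^2+\tfrac{m}{m+1}(s^2+Q^2)\big)^{1/2}$, let $$\Lambda(m)=\sup_{s,K\in\mathbb{R}^3,\,Q>0}\frac{s^2+Q^2}{\pi^2(1+m)}\,\ell_m(s,K,Q)^{-1/2}\int_{\mathbb{R}^3}\frac{\ell_m(t,K,Q)^{-1/2}}{t^2}\,\frac{|(s+AK)\cdot(t+AK)|}{\big[(s+AK)^2+(t+AK)^2+\frac{m}{1+m}(Q^2+AK^2)\big]^2-\big[\frac{2}{1+m}(s+AK)\cdot(t+AK)\big]^2}\,dt .$$ Then $\Lambda(m)<\infty$, and for all $N\ge2$, $\mu>0$ and $\xi\in H^{1/2}_{\rm as}(\mathbb{R}^{3(N-1)})$ the integrals defining $T_{\rm diag}(\xi)$ and $T_{\rm off}(\xi)$ converge absolutely and $$T_{\rm off}(\xi)\ge-\Lambda(m)\,T_{\rm diag}(\xi).$$ If $\Lambda(m)<1$, then for all $N\ge 2$ and $\alpha\in\mathbb{R}$ the form $F_\alpha$ is closed, that is, whenever $u_n\in D(F_\alpha)$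 is a Cauchy sequence in $L^2$ with $F_\alpha(u_n-u_k)\to0$ as $n,k\to\infty$, there is $u\in D(F_\alpha)$ with $\|u_n-u\|\to0$ and $F_\alpha(u_n-u)\to0$. Moreover, for all $u\in D(F_\alpha)$, $$F_\alpha(u)\ge 0\ \text{ if }\alpha\ge0,\qquad F_\alpha(u)\ge-\Big(\frac{\alpha}{2\pi^2(1-\Lambda(m))}\Big)^2\|u\|^2\ \text{ if }\alpha<0 .$$ -/

import Mathlib

open MeasureTheory Filter Topology
open scoped ENNReal FourierTransform SchwartzMap

noncomputable section

namespace PointInteraction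

/-- Euclidean `ℝ³`. -/
abbrev R3 : Type := EuclideanSpace ℝ (Fin 3)

/-- Position space `ℝ^{3k}` of `k` particles, with its Euclidean norm and Lebesgue measure. -/
abbrev Conf (k : ℕ) : Type := PiLp 2 (fun _ : Fin k => R3)

/-- The complex Hilbert space `L²(ℝ^{3k})`. -/
abbrev L2 (k : ℕ) : Type := Lp ℂ 2 (volume : Measure (Conf k))

/-- Antisymmetry under permutations of the `k` particles. -/
def IsAntisymm {k : ℕ} (f : L2 k) : Prop :=
  ∀ σ : Equiv.Perm (Fin k), ∀ᵐ x : Conf k,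
    f (WithLp.toLp 2 fun i => x (σ i)) = ((Equiv.Perm.sign σ : ℤ) : ℂ) * f x

/-- `H^r_as(ℝ^{3k})`, as a subset of `L²(ℝ^{3k})`. -/
def sobolevAs (r : ℝ) (k : ℕ) : Set (L2 k) :=
  {f | IsAntisymm f ∧ TemperedDistribution.MemSobolev r 2 (f : 𝓢'(Conf k, ℂ))}

/-- The unitary Fourier transform `(2π)^{-3k/2} ∫ e^{-i q·x} f(x) dx`, as a function of the `k`
momenta. Mathlib's `𝓕` uses the character `e^{-2πi p·x}`, hence the rescaling `q = 2π p`. -/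
def hat {k : ℕ} (f : L2 k) (q : Fin k → R3) : ℂ :=
  (((2 * Real.pi) ^ (-(3 * (k : ℝ) / 2)) : ℝ) : ℂ) *
    (𝓕 f : L2 k) ((2 * Real.pi)⁻¹ • (WithLp.toLp 2 q : Conf k))

/-- `∑ qᵢ² + 2/(m+1) ∑_{i<j} qᵢ·qⱼ + μ`, the Fourier symbol of the shifted kinetic energy. -/
def symbol (m μ : ℝ) {k : ℕ} (q : Fin k → R3) : ℝ :=
  ∑ i, ‖q i‖ ^ 2 + 2 / (m + 1) * ∑ i, ∑ j ∈ Finset.Ioi i, inner ℝ (q i) (q j) + μ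

/-- The function `G`. -/
def G (m μ : ℝ) {k : ℕ} (q : Fin k → R3) : ℝ := (symbol m μ q)⁻¹

/-- The function `L`. -/
def L (m μ : ℝ) {k : ℕ} (q : Fin k → R3) : ℝ :=
  2 * Real.pi ^ 2 * Real.sqrt (m * (m + 2) / (m + 1) ^ 2 * ∑ i, ‖q i‖ ^ 2
    + 2 * m / (m + 1) ^ 2 * ∑ i, ∑ j ∈ Finset.Ioi i, inner ℝ (q i) (q j) + μ)

/-- The Fourier transform of `Gξ`; the index `j` starts at `0`, which gives the sign `(-1)^j`. -/
def potentialHat (m μ : ℝ) {k : ℕ} (ξ : L2 k) (q : Fin (k + 1) → R3) : ℂ :=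
  (G m μ q : ℂ) * ∑ j : Fin (k + 1), (-1) ^ (j : ℕ) * hat ξ (j.removeNth q)

def diagIntegrand (m μ : ℝ) {k : ℕ} (ξ : L2 k) (q : Fin k → R3) : ℝ :=
  ‖hat ξ q‖ ^ 2 * L m μ q

/-- `T_diag(ξ)`. -/
def Tdiag (m μ : ℝ) {k : ℕ} (ξ : L2 k) : ℝ := ∫ q, diagIntegrand m μ ξ q

/-- The integrand of `T_off`, as a function of `((s, t), q)`. -/
def offIntegrand (m μ : ℝ) {n : ℕ} (ξ : L2 (n + 1)) (p : (R3 × R3) × (Fin n → R3)) : ℂ :=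
  star (hat ξ (Fin.cons p.1.1 p.2)) * hat ξ (Fin.cons p.1.2 p.2) *
    (G m μ (Fin.cons p.1.1 (Fin.cons p.1.2 p.2 : Fin (n + 1) → R3) : Fin (n + 2) → R3) : ℂ)

/-- `T_off(ξ)` for `N = n + 2`, so that `N - 1 = n + 1`. The integral is real because its
integrand is Hermitian in `(s, t)`, see `integral_offIntegrand_im`. -/
def Toff (m μ : ℝ) {n : ℕ} (ξ : L2 (n + 1)) : ℝ :=
  ((n : ℝ) + 1) * (∫ p, offIntegrand m μ ξ p).re

/-- `u = w + Gξ` with `w ∈ H¹_as(ℝ^{3(n+2)})` and `ξ ∈ H^{1/2}_as(ℝ^{3(n+1)})`. -/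
def IsDecomp (m μ : ℝ) {n : ℕ} (u w : L2 (n + 2)) (ξ : L2 (n + 1)) : Prop :=
  w ∈ sobolevAs 1 (n + 2) ∧ ξ ∈ sobolevAs (1 / 2) (n + 1) ∧
    hat (u - w) =ᵐ[volume] potentialHat m μ ξ

/-- The form domain `D(F_α)` for `N = n + 2`. -/
def formDomain (m μ : ℝ) (n : ℕ) : Set (L2 (n + 2)) :=
  {u | IsAntisymm u ∧ ∃ w ξ, IsDecomp m μ u w ξ}

/-- The expression for `F_α(u)` in terms of `u = w + Gξ`, for `N = n + 2`. -/
def formValue (m μ α : ℝ) {n : ℕ} (u w : L2 (n + 2)) (ξ : L2 (n + 1)) : ℝ :=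
  (∫ q, ‖hat w q‖ ^ 2 * symbol m μ q) - μ * ‖u‖ ^ 2
    + ((n : ℝ) + 2) * (α * ‖ξ‖ ^ 2 + Tdiag m μ ξ + Toff m μ ξ)

open Classical in
/-- The quadratic form `F_α` on its domain. The decomposition `u = w + Gξ` is unique for `m, μ > 0`,
so the choice of `(w, ξ)` is immaterial. Outside the domain the value is irrelevant. -/
def form (m μ α : ℝ) {n : ℕ} (u : L2 (n + 2)) : ℝ :=
  if h : ∃ p : L2 (n + 2) × L2 (n + 1), IsDecomp m μ u p.1 p.2 then
    formValue m μ α u h.choose.1 h.choose.2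
  else 0

/-- Closedness of a quadratic form `F` with domain `D`. -/
def IsClosedForm {H : Type*} [NormedAddCommGroup H] (D : Set H) (F : H → ℝ) : Prop :=
  ∀ u : ℕ → H, (∀ i, u i ∈ D) → CauchySeq u →
    Tendsto (fun p : ℕ × ℕ => F (u p.1 - u p.2)) atTop (𝓝 0) →
    ∃ v ∈ D, Tendsto u atTop (𝓝 v) ∧ Tendsto (fun i => F (u i - v)) atTop (𝓝 0)

/-- The function `ℓ_m(s, K, Q)`. -/
def ell (m : ℝ) (s K : R3) (Q : ℝ) : ℝ :=
  Real.sqrt (m / (m + 1) ^ 2 * ‖s + K‖ ^ 2 + m / (m + 1) * (‖s‖ ^ 2 + Q ^ 2))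

/-- The integrand (in `t`) in the definition of `Λ(m)`, where `A = 1/(2+m)`. It is non-negative
for `m, Q > 0`. -/
def lambdaIntegrand (m : ℝ) (s K : R3) (Q : ℝ) (t : R3) : ℝ :=
  let A : ℝ := (2 + m)⁻¹
  1 / ‖t‖ ^ 2 * ell m t K Q ^ (-(1 / 2) : ℝ) *
    (|inner ℝ (s + A • K) (t + A • K)| /
      ((‖s + A • K‖ ^ 2 + ‖t + A • K‖ ^ 2 + m / (1 + m) * (Q ^ 2 + A * ‖K‖ ^ 2)) ^ 2
        - (2 / (1 + m) * inner ℝ (s + A • K) (t + A • K)) ^ 2))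

/-- `Λ(m)`, a supremum of integrals of non-negative functions, with values in `[0, ∞]`. -/
def Lam (m : ℝ) : ℝ≥0∞ :=
  ⨆ (s : R3) (K : R3) (Q : ℝ) (_ : 0 < Q),
    ENNReal.ofReal ((‖s‖ ^ 2 + Q ^ 2) / (Real.pi ^ 2 * (1 + m)) * ell m s K Q ^ (-(1 / 2) : ℝ)) *
      ∫⁻ t : R3, ENNReal.ofReal (lambdaIntegrand m s K Q t)

theorem symbol_swap (m μ : ℝ) {n : ℕ} (s t : R3) (q : Fin n → R3) :
    symbol m μ (Fin.cons s (Fin.cons t q : Fin (n + 1) → R3) : Fin (n + 2) → R3)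
      = symbol m μ (Fin.cons t (Fin.cons s q : Fin (n + 1) → R3) : Fin (n + 2) → R3) := by
  simp only [symbol, Fin.sum_univ_succ, Fin.cons_zero, Fin.cons_succ, Fin.Ioi_zero_eq_map,
    Fin.Ioi_succ, Finset.sum_map, Fin.coe_succEmb, real_inner_comm t s]
  ring

theorem integral_offIntegrand_im (m μ : ℝ) {n : ℕ} (ξ : L2 (n + 1)) :
    (∫ p, offIntegrand m μ ξ p).im = 0 := by
  have hmp : MeasurePreserving
      (MeasurableEquiv.prodCongr (MeasurableEquiv.prodComm (α := R3) (β := R3))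
        (MeasurableEquiv.refl (Fin n → R3))) volume volume :=
    (Measure.measurePreserving_swap (μ := (volume : Measure R3)) (ν := (volume : Measure R3))).prod
      (MeasurePreserving.id (volume : Measure (Fin n → R3)))
  have h := hmp.integral_comp' (offIntegrand m μ ξ)
  have h2 : (∫ p, offIntegrand m μ ξ p) = star (∫ p, offIntegrand m μ ξ p) := by
    conv_lhs => rw [← h]
    rw [Complex.star_def, ← integral_conj]
    congr 1
    ext1 p
    change offIntegrand m μ ξ ((p.1.2, p.1.1), p.2) = _
    simp only [offIntegrand, G, symbol_swap m μ p.1.2 p.1.1 p.2, map_mul, Complex.star_def,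
      Complex.conj_conj, Complex.conj_ofReal]
    ring
  exact Complex.conj_eq_iff_im.mp h2.symm

end PointInteraction

end

open PointInteraction

noncomputable section

namespace PointInteraction

/-! ### Lebesgue measure on configuration space -/

/-! The argument takes place in momentum space, where H¹ and H^{1/2} are L² spaces with weights
comparable to `symbol` and `L`.

The bound on T_off comes from splitting its kernel. Fix the remaining momenta q and let K be their
sum. Shifting s and t by AK, A = 1/(2+m), removes the terms linear in s and t, and the symbol
becomes E + O, where E (`evenSymbol`) is even and O (`oddSymbol`) is odd under reversal of one
shifted momentum, and |O| ≤ E/(1+m). Hence G = E/(E² - O²) - O/(E² - O²). The first kernel is a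
superposition of non-negative rank one kernels (`lintegral_feature`), so its contribution to T_off
is non-negative and can be dropped. The second is estimated in absolute value by a Schur test with
weight |s|² ℓ_m^{1/2} (`schur_test`), and Λ(m) is exactly the resulting constant. The parameter μ is
absorbed into Q (`effQ`), so the constant does not depend on it. Nor does the factor N - 1 enter:
the Schur test leaves the fraction |s|²/(|s|² + Q²) of the density of T_diag, and by antisymmetry
the fractions of the N - 1 particles add up to at most one (`mul_lintegral_first_weight_le`).
Finiteness of Λ(m) is a scaling argument (`exists_schur_bound`).

For the form itself, the freedom in μ is essential. Completing the square in one momentum shows that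
integrating G_μ - G_μ' over it gives L_μ' - L_μ (`integral_G_sub_G`), so the change of T_diag +
T_off with μ compensates the change of the regular part w (`IsDecomp.exists_change`). The
decomposition is unique because Gξ lies in H¹ only for ξ = 0: G is not integrable in a single
momentum (`IsDecomp.eq_zero`).

Consequently, for every μ, F_α(u) + μ‖u‖² is at least the w-energy plus N(α‖ξ‖² + (1 - Λ)T_diag(ξ)),
and T_diag(ξ) ≥ 2π²√μ ‖ξ‖². The least μ for which the T_diag term compensates a negative α gives the
lower bound. A larger μ leaves part of T_diag over, so form-Cauchy sequences have w and ξ Cauchy in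
complete weighted spaces, which yields closedness. -/

theorem volume_preserving_toLp_conf (k : ℕ) :
    MeasurePreserving (fun q : Fin k → R3 => (WithLp.toLp 2 q : Conf k)) := by
  have hcont : Continuous (fun q : Fin k → R3 => (WithLp.toLp 2 q : Conf k)) :=
    PiLp.continuous_toLp 2 _
  refine ⟨hcont.measurable, ?_⟩
  let e : (Fin k → R3) ≃L[ℝ] Conf k := (PiLp.continuousLinearEquiv 2 ℝ (fun _ : Fin k => R3)).symm
  have he : (fun q : Fin k → R3 => (WithLp.toLp 2 q : Conf k)) = e := rfl
  let B : ∀ i : Fin k, OrthonormalBasis (Fin 3) ℝ R3 := fun _ => EuclideanSpace.basisFun (Fin 3) ℝ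
  let b := Pi.orthonormalBasis B
  have hH : (Measure.map e (volume : Measure (Fin k → R3))).IsAddHaarMeasure :=
    e.isAddHaarMeasure_map _
  -- By uniqueness of Haar measure it suffices that the unit cube of the orthonormal basis has
  -- measure one, and this cube is a product of unit cubes of ℝ³.
  rw [he, ← b.addHaar_eq_volume, eq_comm, Module.Basis.addHaar_eq_iff]
  have hpar : (b.toBasis.parallelepiped : Set (Conf k)) =
      {x | ∀ j : (Σ _ : Fin k, Fin 3), x j.1 j.2 ∈ Set.Icc (0:ℝ) 1} := by
    rw [Module.Basis.coe_parallelepiped, parallelepiped_basis_eq]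
    ext x
    simp only [Set.mem_ofPred_eq]
    rfl
  have hpar3 : (parallelepiped (EuclideanSpace.basisFun (Fin 3) ℝ) : Set R3) =
      {x | ∀ j : Fin 3, x j ∈ Set.Icc (0:ℝ) 1} := by
    rw [← OrthonormalBasis.coe_toBasis, parallelepiped_basis_eq]
    ext x
    simp
  rw [hpar, Measure.map_apply e.continuous.measurable]
  · have : (e ⁻¹' {x | ∀ j : (Σ _ : Fin k, Fin 3), x j.1 j.2 ∈ Set.Icc (0:ℝ) 1}) =
        Set.univ.pi (fun _ : Fin k =>
          (parallelepiped (EuclideanSpace.basisFun (Fin 3) ℝ) : Set R3)) := by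
      rw [hpar3]
      ext q
      simp only [Set.mem_preimage, Set.mem_ofPred_eq, Set.mem_pi, Set.mem_univ, true_implies]
      exact ⟨fun h i j => h ⟨i, j⟩, fun h j => h j.1 j.2⟩
    rw [this, volume_pi_pi]
    simp [OrthonormalBasis.volume_parallelepiped]
  · rw [← hpar]
    exact b.toBasis.parallelepiped.isCompact.measurableSet

/-- The rescaling from physical momenta to the frequency variable of `𝓕`. -/
def freq {k : ℕ} (q : Fin k → R3) : Conf k := (2 * Real.pi)⁻¹ • (WithLp.toLp 2 q : Conf k)

theorem measurable_freq {k : ℕ} : Measurable (freq : (Fin k → R3) → Conf k) :=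
  ((PiLp.continuous_toLp 2 (fun _ : Fin k => R3)).const_smul (2 * Real.pi)⁻¹).measurable

theorem finrank_conf (k : ℕ) : Module.finrank ℝ (Conf k) = 3 * k := by
  rw [LinearEquiv.finrank_eq (WithLp.linearEquiv 2 ℝ (Fin k → R3)), Module.finrank_pi_fintype]
  simp [mul_comm]

theorem map_freq (k : ℕ) :
    Measure.map freq (volume : Measure (Fin k → R3)) =
      ENNReal.ofReal ((2 * Real.pi) ^ (3 * k)) • (volume : Measure (Conf k)) := by
  have h1 : (freq : (Fin k → R3) → Conf k) =
      (fun x : Conf k => (2 * Real.pi)⁻¹ • x) ∘ fun q => WithLp.toLp 2 q := rfl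
  have hpi : 0 < 2 * Real.pi := by positivity
  rw [h1, ← Measure.map_map (measurable_const_smul _) (volume_preserving_toLp_conf k).measurable,
    (volume_preserving_toLp_conf k).map_eq, Measure.map_addHaar_smul _ (by positivity),
    finrank_conf, inv_pow, inv_inv, abs_of_pos (by positivity)]

theorem quasiMeasurePreserving_freq (k : ℕ) :
    Measure.QuasiMeasurePreserving (freq : (Fin k → R3) → Conf k) volume volume := by
  refine ⟨measurable_freq, ?_⟩
  rw [map_freq]
  exact Measure.smul_absolutelyContinuous

theorem ae_freq_iff {k : ℕ} {p : Conf k → Prop} (hp : MeasurableSet {x | p x}) :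
    (∀ᵐ q : Fin k → R3, p (freq q)) ↔ ∀ᵐ x : Conf k, p x := by
  rw [← ae_map_iff measurable_freq.aemeasurable hp, map_freq,
    Measure.ae_ennreal_smul_measure_iff]
  simp only [ne_eq, ENNReal.ofReal_eq_zero, not_le]
  positivity

theorem lintegral_comp_freq {k : ℕ} {F : Conf k → ℝ≥0∞} (hF : Measurable F) :
    ∫⁻ q : Fin k → R3, F (freq q) =
      ENNReal.ofReal ((2 * Real.pi) ^ (3 * k)) * ∫⁻ x, F x := by
  rw [← lintegral_map hF measurable_freq, map_freq, lintegral_smul_measure, smul_eq_mul]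

theorem norm_freq_sq {k : ℕ} (q : Fin k → R3) :
    ‖freq q‖ ^ 2 = ((2 * Real.pi) ^ 2)⁻¹ * ∑ i, ‖q i‖ ^ 2 := by
  rw [freq, norm_smul, mul_pow, PiLp.norm_sq_eq_of_L2]
  simp only [norm_inv, norm_mul, Real.norm_eq_abs, abs_of_pos Real.pi_pos, Nat.abs_ofNat, inv_pow]

/-! ### The unitary Fourier transform -/

theorem hat_def {k : ℕ} (f : L2 k) (q : Fin k → R3) :
    hat f q = (((2 * Real.pi) ^ (-(3 * (k : ℝ) / 2)) : ℝ) : ℂ) * (𝓕 f : L2 k) (freq q) := rfl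

theorem measurable_hat {k : ℕ} (f : L2 k) : Measurable (hat f) :=
  measurable_const.mul ((Lp.stronglyMeasurable (𝓕 f : L2 k)).measurable.comp measurable_freq)

theorem hat_add {k : ℕ} (f g : L2 k) : hat (f + g) =ᵐ[volume] fun q => hat f q + hat g q := by
  have h : ∀ᵐ x : Conf k, (𝓕 (f + g) : L2 k) x = (𝓕 f : L2 k) x + (𝓕 g : L2 k) x := by
    rw [FourierTransform.fourier_add]
    exact Lp.coeFn_add _ _
  filter_upwards [(quasiMeasurePreserving_freq k).ae h] with q hq
  rw [hat_def, hat_def, hat_def, hq, mul_add]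

theorem hat_sub {k : ℕ} (f g : L2 k) : hat (f - g) =ᵐ[volume] fun q => hat f q - hat g q := by
  filter_upwards [hat_add (f - g) g] with q hq
  rw [sub_add_cancel] at hq
  rw [hq, add_sub_cancel_right]

theorem hat_neg {k : ℕ} (f : L2 k) : hat (-f) =ᵐ[volume] fun q => - hat f q := by
  have h0 := hat_sub (0 : L2 k) 0
  filter_upwards [hat_sub 0 f, h0] with q hq h0
  rw [zero_sub] at hq
  rw [sub_zero, sub_self] at h0
  rw [hq, h0, zero_sub]

theorem enorm_hat_sq {k : ℕ} (f : L2 k) (q : Fin k → R3) :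
    ‖hat f q‖ₑ ^ 2 =
      (ENNReal.ofReal ((2 * Real.pi) ^ (3 * k)))⁻¹ * ‖(𝓕 f : L2 k) (freq q)‖ₑ ^ 2 := by
  have hpi : 0 < 2 * Real.pi := by positivity
  rw [hat_def, enorm_mul, mul_pow]
  congr 1
  rw [← ofReal_norm, Complex.norm_real, Real.norm_of_nonneg (by positivity),
    ← ENNReal.ofReal_pow (by positivity), ← ENNReal.ofReal_inv_of_pos (by positivity)]
  congr 1
  rw [← Real.rpow_natCast, ← Real.rpow_mul hpi.le, ← Real.rpow_natCast, ← Real.rpow_neg hpi.le]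
  congr 1
  push_cast
  ring

/-- The factor (2π)^{-3k} in |`hat f`|² cancels the Jacobian of q = 2πp. Weight one gives
Plancherel; powers of 1 + |x|² give the Sobolev norms. -/
theorem lintegral_enorm_hat_sq_mul {k : ℕ} (f : L2 k) {w : Conf k → ℝ≥0∞} (hw : Measurable w) :
    ∫⁻ q, ‖hat f q‖ₑ ^ 2 * w (freq q) = ∫⁻ x, ‖(𝓕 f : L2 k) x‖ₑ ^ 2 * w x := by
  have hpi : 0 < (2 * Real.pi) ^ (3 * k) := by positivity
  have hm : Measurable fun x => ‖(𝓕 f : L2 k) x‖ₑ ^ 2 * w x :=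
    ((Lp.stronglyMeasurable (𝓕 f : L2 k)).measurable.enorm.pow_const 2).mul hw
  simp_rw [enorm_hat_sq, mul_assoc]
  rw [lintegral_const_mul' _ _ (by simpa using hpi), lintegral_comp_freq hm, ← mul_assoc,
    ENNReal.inv_mul_cancel (by simpa using hpi) ENNReal.ofReal_ne_top, one_mul]

theorem enorm_sq_eq_lintegral {k : ℕ} (f : L2 k) : ‖f‖ₑ ^ 2 = ∫⁻ x, ‖f x‖ₑ ^ 2 := by
  rw [Lp.enorm_def, eLpNorm_eq_lintegral_rpow_enorm_toReal (by norm_num) (by norm_num)]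
  simp only [ENNReal.toReal_ofNat, ENNReal.rpow_ofNat, one_div]
  rw [← ENNReal.rpow_natCast, ← ENNReal.rpow_mul]
  norm_num

/-- Plancherel's identity. -/
theorem lintegral_enorm_hat_sq {k : ℕ} (f : L2 k) : ∫⁻ q, ‖hat f q‖ₑ ^ 2 = ‖f‖ₑ ^ 2 := by
  have h := lintegral_enorm_hat_sq_mul f (w := fun _ => 1) measurable_const
  simp only [mul_one] at h
  rw [h, ← enorm_sq_eq_lintegral, ← ofReal_norm, ← ofReal_norm, Lp.norm_fourier_eq]

theorem integrable_norm_hat_sq {k : ℕ} (f : L2 k) : Integrable fun q => ‖hat f q‖ ^ 2 := by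
  refine ⟨((measurable_hat f).norm.pow_const 2).aestronglyMeasurable, ?_⟩
  rw [hasFiniteIntegral_iff_enorm]
  simp only [enorm_pow, enorm_norm, lintegral_enorm_hat_sq]
  exact ENNReal.pow_lt_top enorm_lt_top

theorem integral_norm_hat_sq {k : ℕ} (f : L2 k) : ∫ q, ‖hat f q‖ ^ 2 = ‖f‖ ^ 2 := by
  rw [integral_eq_lintegral_of_nonneg_ae (.of_forall fun _ => by positivity)
    ((measurable_hat f).norm.pow_const 2).aestronglyMeasurable]
  simp only [ENNReal.ofReal_pow (norm_nonneg _), ofReal_norm, lintegral_enorm_hat_sq]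
  simp

theorem eq_of_hat_ae_eq {k : ℕ} {f g : L2 k} (h : hat f =ᵐ[volume] hat g) : f = g := by
  have h1 : ∫ q, ‖hat (f - g) q‖ ^ 2 = 0 := by
    refine integral_eq_zero_of_ae ?_
    filter_upwards [hat_sub f g, h] with q h1 h2
    simp [h1, h2]
  rw [integral_norm_hat_sq] at h1
  exact sub_eq_zero.1 (norm_eq_zero.1 (by simpa using h1))

/-- Every square integrable function of the momenta is a Fourier transform. -/
theorem exists_hat_ae_eq {k : ℕ} {h : (Fin k → R3) → ℂ} (hm : Measurable h)
    (hh : ∫⁻ q, ‖h q‖ₑ ^ 2 < ⊤) : ∃ f : L2 k, hat f =ᵐ[volume] h := by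
  have hpi : 0 < 2 * Real.pi := by positivity
  set c : ℝ := (2 * Real.pi) ^ (-(3 * (k : ℝ) / 2)) with hc
  have hc0 : 0 < c := by positivity
  let g : Conf k → ℂ := fun x => (c : ℂ)⁻¹ * h (fun i => (2 * Real.pi) • x i)
  have hgm : Measurable g := by
    refine measurable_const.mul (hm.comp (measurable_pi_lambda _ fun i => ?_))
    exact ((continuous_const_smul _).comp (PiLp.continuous_apply 2 _ i)).measurable
  have hgf : ∀ q, g (freq q) = (c : ℂ)⁻¹ * h q := by
    intro q
    simp only [g]
    congr 2
    ext1 i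
    simp only [freq, PiLp.smul_apply, smul_smul]
    rw [mul_inv_cancel₀ hpi.ne', one_smul]
  have hg2 : ∫⁻ x, ‖g x‖ₑ ^ 2 < ⊤ := by
    have h1 := lintegral_comp_freq (F := fun x => ‖g x‖ₑ ^ 2) (hgm.enorm.pow_const 2)
    simp only [hgf, enorm_mul, mul_pow] at h1
    rw [lintegral_const_mul _ (hm.enorm.pow_const 2)] at h1
    by_contra hcon
    rw [not_lt, top_le_iff] at hcon
    rw [hcon, ENNReal.mul_top (ENNReal.ofReal_pos.2 (by positivity)).ne'] at h1
    exact (ENNReal.mul_lt_top (ENNReal.pow_lt_top enorm_lt_top) hh).ne h1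
  have hgL : MemLp g 2 volume := by
    refine ⟨hgm.aestronglyMeasurable, ?_⟩
    rw [eLpNorm_lt_top_iff_lintegral_rpow_enorm_lt_top (by norm_num) (by norm_num)]
    simpa using hg2
  refine ⟨𝓕⁻ (hgL.toLp g), ?_⟩
  filter_upwards [(quasiMeasurePreserving_freq k).ae hgL.coeFn_toLp] with q hq
  rw [hat_def, FourierTransform.fourier_fourierInv_eq, hq, hgf, ← mul_assoc, mul_inv_cancel₀, one_mul]
  exact Complex.ofReal_ne_zero.2 (ne_of_gt hc0)

/-- Convergence in `L²` implies a.e. convergence of the Fourier transforms along a subsequence. -/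
theorem exists_subseq_tendsto_hat {k : ℕ} {f : ℕ → L2 k} {g : L2 k}
    (h : Tendsto f atTop (𝓝 g)) :
    ∃ ns : ℕ → ℕ, StrictMono ns ∧
      ∀ᵐ q, Tendsto (fun i => hat (f (ns i)) q) atTop (𝓝 (hat g q)) := by
  have h1 : Tendsto (fun i => (𝓕 (f i) : L2 k)) atTop (𝓝 (𝓕 g)) :=
    ((Lp.fourierTransformₗᵢ (Conf k) ℂ).continuous.tendsto g).comp h
  obtain ⟨ns, hns, hlim⟩ := (tendstoInMeasure_of_tendsto_Lp h1).exists_seq_tendsto_ae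
  refine ⟨ns, hns, ?_⟩
  filter_upwards [(quasiMeasurePreserving_freq k).ae hlim] with q hq
  exact hq.const_mul _

/-! ### Sobolev spaces and antisymmetry on the Fourier side -/

section Sobolev

variable {E : Type*} [NormedAddCommGroup E] [InnerProductSpace ℝ E] [FiniteDimensional ℝ E]
  [MeasurableSpace E] [BorelSpace E]

theorem toTemperedDistribution_injective :
    Function.Injective (fun f : Lp ℂ 2 (volume : Measure E) => (f : 𝓢'(E, ℂ))) := by
  have h := Lp.ker_toTemperedDistributionCLM_eq_bot (E := E) (F := ℂ) (μ := volume) (p := 2)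
  exact LinearMap.ker_eq_bot.1 h

/-- The multipliers `g` and `gi` are inverse to each other on tempered distributions, and `gi` is
bounded. An L² function f' representing g·𝓕f therefore satisfies gi·f' = 𝓕f in L²; conversely, a
finite weighted integral makes g·𝓕f itself such a representative. -/
theorem memSobolev_two_iff_lintegral {r : ℝ} (hr : 0 ≤ r) (f : Lp ℂ 2 (volume : Measure E)) :
    TemperedDistribution.MemSobolev r 2 (f : 𝓢'(E, ℂ)) ↔
      ∫⁻ x, ‖(𝓕 f : Lp ℂ 2 (volume : Measure E)) x‖ₑ ^ 2 * ENNReal.ofReal ((1 + ‖x‖ ^ 2) ^ r)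
        < ⊤ := by
  let g : E → ℂ := fun x => (((1 + ‖x‖ ^ 2) ^ (r / 2) : ℝ) : ℂ)
  let gi : E → ℂ := fun x => (((1 + ‖x‖ ^ 2) ^ (-r / 2) : ℝ) : ℂ)
  have hg : g.HasTemperateGrowth := by fun_prop
  have hgi : gi.HasTemperateGrowth := by fun_prop
  have hpos : ∀ x : E, 0 < 1 + ‖x‖ ^ 2 := fun x => by positivity
  have hmul : ∀ x, g x * gi x = 1 := by
    intro x
    simp only [g, gi]
    rw [← Complex.ofReal_mul, ← Real.rpow_add (hpos x)]
    simp [neg_div]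
  have hgiL : MemLp gi ⊤ (volume : Measure E) := by
    refine memLp_top_of_bound hgi.1.continuous.aestronglyMeasurable 1 (.of_forall fun x => ?_)
    simp only [gi, Complex.norm_real]
    rw [Real.norm_of_nonneg (by positivity)]
    exact Real.rpow_le_one_of_one_le_of_nonpos (by simp) (by linarith)
  have hnorm : ∀ x, ‖g x‖ₑ ^ 2 = ENNReal.ofReal ((1 + ‖x‖ ^ 2) ^ r) := by
    intro x
    simp only [g]
    rw [← ofReal_norm, Complex.norm_real, Real.norm_of_nonneg (by positivity),
      ← ENNReal.ofReal_pow (by positivity), ← Real.rpow_natCast, ← Real.rpow_mul (hpos x).le]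
    congr 2
    push_cast
    ring
  have hfin : ∀ f' : Lp ℂ 2 (volume : Measure E), ∫⁻ x, ‖f' x‖ₑ ^ 2 < ⊤ := by
    intro f'
    have := (Lp.memLp f').2
    rw [eLpNorm_lt_top_iff_lintegral_rpow_enorm_lt_top (by norm_num) (by norm_num)] at this
    simpa using this
  have hgg : g * gi = fun _ => 1 := funext hmul
  have hcancel : ∀ d : 𝓢'(E, ℂ), TemperedDistribution.smulLeftCLM ℂ g
      (TemperedDistribution.smulLeftCLM ℂ gi d) = d := by
    intro d
    rw [TemperedDistribution.smulLeftCLM_smulLeftCLM_apply hgi hg, mul_comm, hgg]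
    simp
  have hcancel' : ∀ d : 𝓢'(E, ℂ), TemperedDistribution.smulLeftCLM ℂ gi
      (TemperedDistribution.smulLeftCLM ℂ g d) = d := by
    intro d
    rw [TemperedDistribution.smulLeftCLM_smulLeftCLM_apply hg hgi, hgg]
    simp
  rw [TemperedDistribution.memSobolev_iff_exists_smulLeftCLM_fourier,
    Lp.fourier_toTemperedDistribution_eq]
  constructor
  · rintro ⟨f', hf'⟩
    have h1 : ((hgiL.toLp gi) • f' : Lp ℂ 2 (volume : Measure E)) = 𝓕 f := by
      apply toTemperedDistribution_injective
      simp only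
      rw [Lp.toTemperedDistribution_smul_eq hgi hgiL, ← hf']
      exact hcancel' _
    refine (lintegral_congr_ae ?_).trans_lt (hfin f')
    filter_upwards [Lp.coeFn_lpSMul (r := 2) (hgiL.toLp gi) f', hgiL.coeFn_toLp] with x h2 h3
    rw [← h1, h2, Pi.smul_apply', h3, ← hnorm, ← mul_pow, ← enorm_mul, smul_eq_mul]
    congr 2
    rw [mul_right_comm, mul_comm (gi x), hmul, one_mul]
  · intro h
    have hL : MemLp (fun x => g x * (𝓕 f : Lp ℂ 2 (volume : Measure E)) x) 2 volume := by
      refine ⟨hg.1.continuous.aestronglyMeasurable.mul (Lp.aestronglyMeasurable _), ?_⟩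
      rw [eLpNorm_lt_top_iff_lintegral_rpow_enorm_lt_top (by norm_num) (by norm_num)]
      simp only [ENNReal.toReal_ofNat, ENNReal.rpow_ofNat, enorm_mul, mul_pow, hnorm]
      simpa only [mul_comm] using h
    refine ⟨hL.toLp _, ?_⟩
    have h1 : ((hgiL.toLp gi) • (hL.toLp _) : Lp ℂ 2 (volume : Measure E)) = 𝓕 f := by
      apply Lp.ext
      filter_upwards [Lp.coeFn_lpSMul (r := 2) (hgiL.toLp gi) (hL.toLp _), hgiL.coeFn_toLp,
        hL.coeFn_toLp] with x h2 h3 h4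
      rw [h2, Pi.smul_apply', h3, h4, smul_eq_mul, ← mul_assoc, mul_comm (gi x), hmul, one_mul]
    conv_lhs => rw [← h1]
    rw [Lp.toTemperedDistribution_smul_eq hgi hgiL]
    exact hcancel _

/-- The `L²` Fourier transform commutes with linear isometries. -/
theorem fourier_compMeasurePreserving (A : E ≃ₗᵢ[ℝ] E) (f : Lp ℂ 2 (volume : Measure E)) :
    𝓕 (Lp.compMeasurePreserving A A.measurePreserving f) =
      Lp.compMeasurePreserving A A.measurePreserving (𝓕 f : Lp ℂ 2 (volume : Measure E)) := by
  apply DenseRange.induction_on (p := fun f : Lp ℂ 2 (volume : Measure E) =>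
    𝓕 (Lp.compMeasurePreserving A A.measurePreserving f) =
      Lp.compMeasurePreserving A A.measurePreserving (𝓕 f : Lp ℂ 2 (volume : Measure E)))
    (SchwartzMap.denseRange_toLpCLM (p := 2) ENNReal.ofNat_ne_top) f
  · have hc := (Lp.isometry_compMeasurePreserving (E := ℂ) (p := 2) A.measurePreserving).continuous
    have hF := (Lp.fourierTransformₗᵢ E ℂ).continuous
    exact isClosed_eq (hF.comp hc) (hc.comp hF)
  · intro φ
    let e : E ≃L[ℝ] E := A.toContinuousLinearEquiv
    have key : ∀ ψ : 𝓢(E, ℂ), Lp.compMeasurePreserving A A.measurePreserving (ψ.toLp 2 volume) =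
        (SchwartzMap.compCLMOfContinuousLinearEquiv ℂ e ψ).toLp 2 volume := by
      intro ψ
      apply Lp.ext
      filter_upwards [Lp.coeFn_compMeasurePreserving (ψ.toLp 2 volume) A.measurePreserving,
        A.measurePreserving.quasiMeasurePreserving.ae (ψ.coeFn_toLp 2 volume),
        (SchwartzMap.compCLMOfContinuousLinearEquiv ℂ e ψ).coeFn_toLp 2 volume] with x h1 h2 h3
      rw [h1, h3, Function.comp_apply, h2]
      rfl
    simp only [SchwartzMap.toLpCLM_apply]
    rw [key, SchwartzMap.toLp_fourier_eq, SchwartzMap.toLp_fourier_eq, key]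
    congr 1
    ext x
    rw [SchwartzMap.fourier_coe]
    exact Real.fourier_comp_linearIsometry A φ x

end Sobolev

/-- Rescaling the momenta by 2π changes 1 + |·|² by a factor between 1 and (2π)², which does not
affect finiteness. -/
theorem memSobolev_iff_lintegral_hat {k : ℕ} {r : ℝ} (hr : 0 ≤ r) (f : L2 k) :
    TemperedDistribution.MemSobolev r 2 (f : 𝓢'(Conf k, ℂ)) ↔
      ∫⁻ q, ‖hat f q‖ₑ ^ 2 * ENNReal.ofReal ((1 + ∑ i, ‖q i‖ ^ 2) ^ r) < ⊤ := by
  have hw : Measurable fun x : Conf k => ENNReal.ofReal ((1 + ‖x‖ ^ 2) ^ r) := by fun_prop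
  rw [memSobolev_two_iff_lintegral hr, ← lintegral_enorm_hat_sq_mul f hw]
  have h1 : 1 ≤ (2 * Real.pi) ^ 2 := by nlinarith [Real.pi_gt_three]
  have h0 : 0 < (2 * Real.pi) ^ 2 := by positivity
  constructor
  · intro h
    refine lt_of_le_of_lt ?_
      (ENNReal.mul_lt_top (a := ENNReal.ofReal (((2 * Real.pi) ^ 2) ^ r)) ENNReal.ofReal_lt_top h)
    rw [← lintegral_const_mul' _ _ ENNReal.ofReal_ne_top]
    refine lintegral_mono fun q => ?_
    simp only
    rw [mul_left_comm]
    gcongr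
    rw [← ENNReal.ofReal_mul (by positivity), ← Real.mul_rpow (by positivity) (by positivity)]
    refine ENNReal.ofReal_le_ofReal (Real.rpow_le_rpow (by positivity) ?_ hr)
    rw [norm_freq_sq, mul_add, ← mul_assoc, mul_inv_cancel₀ h0.ne', one_mul, mul_one]
    gcongr
  · refine lt_of_le_of_lt (lintegral_mono fun q => ?_)
    gcongr
    rw [norm_freq_sq]
    exact mul_le_of_le_one_left (by positivity) (inv_le_one_of_one_le₀ h1)

/-- The isometry permuting the particles. -/
def permIso {k : ℕ} (σ : Equiv.Perm (Fin k)) : Conf k ≃ₗᵢ[ℝ] Conf k :=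
  LinearIsometryEquiv.piLpCongrLeft 2 ℝ R3 σ.symm

theorem permIso_apply {k : ℕ} (σ : Equiv.Perm (Fin k)) (x : Conf k) :
    permIso σ x = WithLp.toLp 2 fun i => x (σ i) := rfl

theorem freq_comp_perm {k : ℕ} (σ : Equiv.Perm (Fin k)) (q : Fin k → R3) :
    freq (q ∘ σ) = permIso σ (freq q) := rfl

theorem isAntisymm_iff_compMeasurePreserving {k : ℕ} (f : L2 k) :
    IsAntisymm f ↔ ∀ σ : Equiv.Perm (Fin k),
      Lp.compMeasurePreserving (permIso σ) (permIso σ).measurePreserving f =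
        ((Equiv.Perm.sign σ : ℤ) : ℂ) • f := by
  refine forall_congr' fun σ => ⟨fun h => ?_, fun h => ?_⟩
  · apply Lp.ext
    filter_upwards [Lp.coeFn_compMeasurePreserving f (permIso σ).measurePreserving, h,
      Lp.coeFn_smul ((Equiv.Perm.sign σ : ℤ) : ℂ) f] with x h1 h2 h3
    rw [h1, h3, Function.comp_apply, permIso_apply, h2]
    rfl
  · filter_upwards [Lp.coeFn_compMeasurePreserving f (permIso σ).measurePreserving,
      Lp.coeFn_smul ((Equiv.Perm.sign σ : ℤ) : ℂ) f] with x h1 h3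
    rw [h, h3, Function.comp_apply, permIso_apply] at h1
    rw [← h1]
    rfl

theorem isAntisymm_fourier_iff {k : ℕ} (f : L2 k) : IsAntisymm (𝓕 f : L2 k) ↔ IsAntisymm f := by
  rw [isAntisymm_iff_compMeasurePreserving, isAntisymm_iff_compMeasurePreserving]
  refine forall_congr' fun σ => ?_
  rw [← fourier_compMeasurePreserving, ← FourierTransform.fourier_smul]
  exact (Lp.fourierTransformₗᵢ (Conf k) ℂ).injective.eq_iff

/-- Permutations of the particles are linear isometries, so they commute with the Fourier transform,
and antisymmetry passes to momentum space. -/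
theorem isAntisymm_iff_hat {k : ℕ} (f : L2 k) :
    IsAntisymm f ↔ ∀ σ : Equiv.Perm (Fin k), ∀ᵐ q : Fin k → R3,
      hat f (q ∘ σ) = ((Equiv.Perm.sign σ : ℤ) : ℂ) * hat f q := by
  have hpi : 0 < 2 * Real.pi := by positivity
  rw [← isAntisymm_fourier_iff]
  refine forall_congr' fun σ => ?_
  have hm := (Lp.stronglyMeasurable (𝓕 f : L2 k)).measurable
  rw [← ae_freq_iff]
  · refine eventually_congr (.of_forall fun q => ?_)
    rw [hat_def, hat_def, mul_left_comm, freq_comp_perm, permIso_apply,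
      mul_right_inj' (Complex.ofReal_ne_zero.2 (by positivity))]
  · exact measurableSet_eq_fun (hm.comp (permIso σ).continuous.measurable) (hm.const_mul _)

theorem IsAntisymm.sub {k : ℕ} {f g : L2 k} (hf : IsAntisymm f) (hg : IsAntisymm g) :
    IsAntisymm (f - g) := by
  rw [isAntisymm_iff_compMeasurePreserving] at *
  intro σ
  rw [map_sub, hf, hg, smul_sub]

theorem isClosed_isAntisymm (k : ℕ) : IsClosed {f : L2 k | IsAntisymm f} := by
  simp only [isAntisymm_iff_compMeasurePreserving, Set.ofPred_forall]
  refine isClosed_iInter fun σ => isClosed_eq ?_ (continuous_const_smul _)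
  exact (Lp.isometry_compMeasurePreserving (E := ℂ) (p := 2) (permIso σ).measurePreserving).continuous

/-! ### Radial integrals in `ℝ³` -/

/-- Together with the Jacobian r² the radial density is at most r^{-1/2} near the origin and at most
r^{-5/2} at infinity. -/
theorem integrable_norm_rpow_div_one_add_sq :
    Integrable fun t : R3 => ‖t‖ ^ (-(5 / 2) : ℝ) / (1 + ‖t‖ ^ 2) := by
  rw [integrable_fun_norm_addHaar volume (f := fun y : ℝ => y ^ (-(5 / 2) : ℝ) / (1 + y ^ 2))]
  have hm : Measurable fun y : ℝ =>
      y ^ (Module.finrank ℝ R3 - 1) • (y ^ (-(5 / 2) : ℝ) / (1 + y ^ 2)) := by fun_prop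
  have hbound : ∀ y : ℝ, 0 < y →
      ‖y ^ (Module.finrank ℝ R3 - 1) • (y ^ (-(5 / 2) : ℝ) / (1 + y ^ 2))‖ ≤
        min (y ^ (-(1 / 2) : ℝ)) (y ^ (-(5 / 2) : ℝ)) := by
    intro y hy
    have h2 : y ^ 2 * y ^ (-(5 / 2) : ℝ) = y ^ (-(1 / 2) : ℝ) := by
      rw [← Real.rpow_natCast, ← Real.rpow_add hy]
      norm_num
    simp only [finrank_euclideanSpace, Fintype.card_fin, Nat.add_one_sub_one, smul_eq_mul]
    rw [Real.norm_of_nonneg (by positivity), le_min_iff, ← mul_div_assoc]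
    constructor
    · rw [h2]
      exact div_le_self (by positivity) (by nlinarith)
    · rw [mul_comm, mul_div_assoc]
      exact mul_le_of_le_one_right (by positivity) ((div_le_one (by positivity)).2 (by linarith))
  rw [← Set.Ioc_union_Ioi_eq_Ioi zero_le_one]
  refine IntegrableOn.union ?_ ?_
  · have h := (intervalIntegral.intervalIntegrable_rpow' (a := 0) (b := 1)
      (r := (-(1 / 2) : ℝ)) (by norm_num)).1
    refine Integrable.mono' h hm.aestronglyMeasurable ?_
    filter_upwards [ae_restrict_mem measurableSet_Ioc] with y hy
    exact (hbound y hy.1).trans (min_le_left _ _)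
  · have h := integrableOn_Ioi_rpow_of_lt (a := (-(5 / 2) : ℝ)) (by norm_num) zero_lt_one
    refine Integrable.mono' h hm.aestronglyMeasurable ?_
    filter_upwards [ae_restrict_mem measurableSet_Ioi] with y hy
    exact (hbound y (zero_lt_one.trans hy)).trans (min_le_right _ _)

/-- Substitute t = e·t': the volume contributes e³, the numerator e^{-5/2} and the denominator
e^{-2}. -/
theorem exists_lintegral_norm_rpow_div_le :
    ∃ C : ℝ, 0 < C ∧ ∀ e : ℝ, 0 < e →
      ∫⁻ t : R3, ENNReal.ofReal (‖t‖ ^ (-(5 / 2) : ℝ) / (e ^ 2 + ‖t‖ ^ 2)) ≤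
        ENNReal.ofReal (C * e ^ (-(3 / 2) : ℝ)) := by
  let F : R3 → ℝ≥0∞ := fun t => ENNReal.ofReal (‖t‖ ^ (-(5 / 2) : ℝ) / (1 + ‖t‖ ^ 2))
  have hF : Measurable F := by fun_prop
  set C := ∫ t : R3, ‖t‖ ^ (-(5 / 2) : ℝ) / (1 + ‖t‖ ^ 2) with hC
  have hC0 : 0 ≤ C := integral_nonneg fun t => by positivity
  refine ⟨C + 1, by positivity, fun e he => ?_⟩
  have hFC : ∫⁻ t, F t = ENNReal.ofReal C :=
    (ofReal_integral_eq_lintegral_ofReal integrable_norm_rpow_div_one_add_sq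
      (.of_forall fun t => by positivity)).symm
  have hscale : ∫⁻ t : R3, F (e⁻¹ • t) = ENNReal.ofReal (e ^ 3) * ENNReal.ofReal C := by
    rw [← hFC, ← lintegral_map hF (measurable_const_smul e⁻¹),
      Measure.map_addHaar_smul _ (inv_ne_zero he.ne'), lintegral_smul_measure, smul_eq_mul]
    simp [abs_of_pos he]
  have hpt : ∀ t : R3, ENNReal.ofReal (‖t‖ ^ (-(5 / 2) : ℝ) / (e ^ 2 + ‖t‖ ^ 2)) =
      ENNReal.ofReal (e ^ (-(9 / 2) : ℝ)) * F (e⁻¹ • t) := by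
    intro t
    simp only [F]
    rw [← ENNReal.ofReal_mul (by positivity)]
    congr 1
    rw [norm_smul, norm_inv, Real.norm_of_nonneg he.le, Real.mul_rpow (by positivity) (by positivity),
      Real.inv_rpow he.le, ← Real.rpow_neg he.le]
    have h1 : e ^ (-(9 / 2) : ℝ) * e ^ (- -(5 / 2) : ℝ) = (e ^ 2)⁻¹ := by
      rw [← Real.rpow_add he, ← Real.rpow_natCast, ← Real.rpow_neg he.le]
      norm_num
    calc _ = (e ^ 2)⁻¹ * (‖t‖ ^ (-(5 / 2) : ℝ) / (1 + (e⁻¹ * ‖t‖) ^ 2)) := by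
          field_simp
      _ = _ := by rw [← h1]; ring
  simp_rw [hpt]
  rw [lintegral_const_mul' _ _ ENNReal.ofReal_ne_top, hscale, ← mul_assoc,
    ← ENNReal.ofReal_mul (by positivity), ← ENNReal.ofReal_mul (by positivity)]
  refine ENNReal.ofReal_le_ofReal ?_
  have h1 : e ^ (-(9 / 2) : ℝ) * e ^ 3 = e ^ (-(3 / 2) : ℝ) := by
    rw [← Real.rpow_natCast, ← Real.rpow_add he]
    norm_num
  rw [h1, mul_comm]
  gcongr
  linarith

theorem volume_real_ball_R3 : (volume : Measure R3).real (Metric.ball 0 1) = 4 * Real.pi / 3 := by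
  rw [Measure.real, EuclideanSpace.volume_ball_fin_three]
  simp only [ENNReal.ofReal_one, one_pow, one_mul]
  rw [ENNReal.toReal_ofReal (by positivity)]
  ring

/-- The radial density has the primitive b·arctan(r/b) - a·arctan(r/a), which tends to (π/2)(b - a);
the area 4π of the sphere then gives the factor 2π² that appears in `L`. Only the difference
converges. -/
theorem integral_inv_sub_inv_of_le {a b : ℝ} (ha : 0 < a) (hab : a ≤ b) :
    Integrable (fun x : R3 => (‖x‖ ^ 2 + a ^ 2)⁻¹ - (‖x‖ ^ 2 + b ^ 2)⁻¹) ∧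
      ∫ x : R3, ((‖x‖ ^ 2 + a ^ 2)⁻¹ - (‖x‖ ^ 2 + b ^ 2)⁻¹) = 2 * Real.pi ^ 2 * (b - a) := by
  have hb : 0 < b := ha.trans_le hab
  let F : ℝ → ℝ := fun r => b * Real.arctan (r / b) - a * Real.arctan (r / a)
  let F' : ℝ → ℝ := fun r => r ^ 2 * ((r ^ 2 + a ^ 2)⁻¹ - (r ^ 2 + b ^ 2)⁻¹)
  have hd : ∀ r : ℝ, HasDerivAt F (F' r) r := by
    intro r
    have h1 : ∀ c : ℝ, 0 < c → HasDerivAt (fun r => c * Real.arctan (r / c))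
        (c * (1 / (1 + (r / c) ^ 2) * (1 / c))) r := fun c hc =>
      (((hasDerivAt_id r).div_const c).arctan).const_mul c
    convert! (h1 b hb).sub (h1 a ha) using 1
    simp only [F']
    field_simp
    ring
  have hpos : ∀ r ∈ Set.Ioi (0 : ℝ), 0 ≤ F' r := by
    intro r _
    refine mul_nonneg (by positivity) (sub_nonneg.2 ?_)
    gcongr
  have hlim : Tendsto F atTop (𝓝 (b * (Real.pi / 2) - a * (Real.pi / 2))) := by
    have h1 : ∀ c : ℝ, 0 < c → Tendsto (fun r => c * Real.arctan (r / c)) atTop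
        (𝓝 (c * (Real.pi / 2))) := fun c hc =>
      ((Real.tendsto_arctan_atTop.mono_right nhdsWithin_le_nhds).comp
        (tendsto_id.atTop_div_const hc)).const_mul c
    exact (h1 b hb).sub (h1 a ha)
  have hI := integrableOn_Ioi_deriv_of_nonneg' (a := 0) (fun r _ => hd r) hpos hlim
  have hv := integral_Ioi_of_hasDerivAt_of_nonneg' (a := 0) (fun r _ => hd r) hpos hlim
  constructor
  · rw [integrable_fun_norm_addHaar volume
      (f := fun y : ℝ => (y ^ 2 + a ^ 2)⁻¹ - (y ^ 2 + b ^ 2)⁻¹)]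
    simpa [F'] using hI
  · rw [integral_fun_norm_addHaar volume
      (fun y : ℝ => (y ^ 2 + a ^ 2)⁻¹ - (y ^ 2 + b ^ 2)⁻¹)]
    simp only [finrank_euclideanSpace, Fintype.card_fin, Nat.add_one_sub_one, smul_eq_mul,
      nsmul_eq_mul, volume_real_ball_R3]
    simp only [F'] at hv
    rw [hv]
    simp only [F, zero_div, Real.arctan_zero]
    push_cast
    ring

theorem integral_inv_sub_inv {a b : ℝ} (ha : 0 < a) (hb : 0 < b) (d : R3) :
    Integrable (fun x : R3 => (‖x + d‖ ^ 2 + a ^ 2)⁻¹ - (‖x + d‖ ^ 2 + b ^ 2)⁻¹) ∧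
      ∫ x : R3, ((‖x + d‖ ^ 2 + a ^ 2)⁻¹ - (‖x + d‖ ^ 2 + b ^ 2)⁻¹) =
        2 * Real.pi ^ 2 * (b - a) := by
  have h0 : Integrable (fun x : R3 => (‖x‖ ^ 2 + a ^ 2)⁻¹ - (‖x‖ ^ 2 + b ^ 2)⁻¹) ∧
      ∫ x : R3, ((‖x‖ ^ 2 + a ^ 2)⁻¹ - (‖x‖ ^ 2 + b ^ 2)⁻¹) = 2 * Real.pi ^ 2 * (b - a) := by
    rcases le_total a b with h | h
    · exact integral_inv_sub_inv_of_le ha h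
    · obtain ⟨h1, h2⟩ := integral_inv_sub_inv_of_le hb h
      refine ⟨h1.neg.congr (.of_forall fun x => by simp), ?_⟩
      have h3 := integral_neg (μ := (volume : Measure R3))
        fun x : R3 => (‖x‖ ^ 2 + b ^ 2)⁻¹ - (‖x‖ ^ 2 + a ^ 2)⁻¹
      simp only [neg_sub] at h3
      rw [h3, h2]
      ring
  refine ⟨h0.1.comp_add_right d, ?_⟩
  rw [← h0.2]
  exact integral_add_right_eq_self
    (fun x : R3 => (‖x‖ ^ 2 + a ^ 2)⁻¹ - (‖x‖ ^ 2 + b ^ 2)⁻¹) d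

/-- The radial density r²/(r² + D) is at least 1/2 beyond √D. This ultraviolet divergence is what
makes the charge ξ of a decomposition unique. -/
theorem not_integrable_inv_norm_sq_add {D : ℝ} (hD : 0 < D) :
    ¬ Integrable fun x : R3 => (‖x‖ ^ 2 + D)⁻¹ := by
  rw [integrable_fun_norm_addHaar volume (f := fun y : ℝ => (y ^ 2 + D)⁻¹)]
  intro h
  have h1 : IntegrableOn (fun _ : ℝ => (1 / 2 : ℝ)) (Set.Ioi (Real.sqrt D)) := by
    refine Integrable.mono' (h.mono_set (Set.Ioi_subset_Ioi (Real.sqrt_nonneg D)))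
      aestronglyMeasurable_const ?_
    filter_upwards [ae_restrict_mem measurableSet_Ioi] with y hy
    have hy' : D < y ^ 2 := (Real.sqrt_lt_sqrt_iff hD.le).1 (by
      rwa [Real.sqrt_sq ((Real.sqrt_nonneg D).trans (le_of_lt hy))])
    simp only [finrank_euclideanSpace, Fintype.card_fin, Nat.add_one_sub_one, smul_eq_mul]
    rw [Real.norm_of_nonneg (by norm_num), ← div_eq_mul_inv, le_div_iff₀ (by positivity)]
    linarith
  rw [integrableOn_const_iff] at h1
  simp at h1

theorem lintegral_inv_norm_add_sq_add {D : ℝ} (hD : 0 < D) (d : R3) :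
    ∫⁻ x : R3, ENNReal.ofReal (‖x + d‖ ^ 2 + D)⁻¹ = ⊤ := by
  rw [lintegral_add_right_eq_self (fun x : R3 => ENNReal.ofReal (‖x‖ ^ 2 + D)⁻¹) d]
  by_contra h
  refine not_integrable_inv_norm_sq_add hD ⟨by fun_prop, ?_⟩
  rw [hasFiniteIntegral_iff_ofReal (.of_forall fun x => by positivity)]
  exact lt_top_iff_ne_top.2 h

/-! ### Algebra of the symbols -/

theorem norm_sum_sq {k : ℕ} (q : Fin k → R3) :
    ‖∑ i, q i‖ ^ 2 = ∑ i, ‖q i‖ ^ 2 + 2 * ∑ i, ∑ j ∈ Finset.Ioi i, inner ℝ (q i) (q j) := by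
  induction k with
  | zero => simp
  | succ k ih =>
    rw [Fin.sum_univ_succ, norm_add_sq_real, ih (fun i => q i.succ), inner_sum]
    simp only [Fin.sum_univ_succ, Fin.Ioi_zero_eq_map, Fin.Ioi_succ, Finset.sum_map,
      Fin.coe_succEmb]
    ring

theorem symbol_eq {m : ℝ} (hm : 0 < m) (μ : ℝ) {k : ℕ} (q : Fin k → R3) :
    symbol m μ q = m / (m + 1) * ∑ i, ‖q i‖ ^ 2 + 1 / (m + 1) * ‖∑ i, q i‖ ^ 2 + μ := by
  rw [symbol, norm_sum_sq]
  field_simp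
  ring

theorem L_eq {m : ℝ} (hm : 0 < m) (μ : ℝ) {k : ℕ} (q : Fin k → R3) :
    L m μ q = 2 * Real.pi ^ 2 * Real.sqrt
      (m / (m + 1) * ∑ i, ‖q i‖ ^ 2 + m / (m + 1) ^ 2 * ‖∑ i, q i‖ ^ 2 + μ) := by
  rw [L, norm_sum_sq]
  congr 2
  field_simp
  ring

theorem symbol_pos {m μ : ℝ} (hm : 0 < m) (hμ : 0 < μ) {k : ℕ} (q : Fin k → R3) :
    0 < symbol m μ q := by
  rw [symbol_eq hm]
  positivity

theorem le_symbol {m : ℝ} (hm : 0 < m) (μ : ℝ) {k : ℕ} (q : Fin k → R3) :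
    μ ≤ symbol m μ q := by
  rw [symbol_eq hm]
  have : 0 ≤ m / (m + 1) * ∑ i, ‖q i‖ ^ 2 + 1 / (m + 1) * ‖∑ i, q i‖ ^ 2 := by positivity
  linarith

theorem L_pos {m μ : ℝ} (hm : 0 < m) (hμ : 0 < μ) {k : ℕ} (q : Fin k → R3) :
    0 < L m μ q := by
  rw [L_eq hm]
  positivity

theorem sqrt_le_L {m : ℝ} (hm : 0 < m) (μ : ℝ) {k : ℕ} (q : Fin k → R3) :
    2 * Real.pi ^ 2 * Real.sqrt μ ≤ L m μ q := by
  rw [L_eq hm]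
  gcongr
  have : 0 ≤ m / (m + 1) * ∑ i, ‖q i‖ ^ 2 + m / (m + 1) ^ 2 * ‖∑ i, q i‖ ^ 2 := by positivity
  linarith

theorem norm_sum_sq_le {k : ℕ} (q : Fin k → R3) : ‖∑ i, q i‖ ^ 2 ≤ k * ∑ i, ‖q i‖ ^ 2 := by
  calc ‖∑ i, q i‖ ^ 2 ≤ (∑ i, ‖q i‖) ^ 2 := by gcongr; exact norm_sum_le _ _
    _ ≤ _ := by simpa using sq_sum_le_card_mul_sum_sq (s := Finset.univ) (f := fun i => ‖q i‖)

theorem symbol_perm {m : ℝ} (hm : 0 < m) (μ : ℝ) {k : ℕ} (σ : Equiv.Perm (Fin k))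
    (q : Fin k → R3) : symbol m μ (q ∘ σ) = symbol m μ q := by
  rw [symbol_eq hm, symbol_eq hm]
  simp only [Function.comp_apply, Equiv.sum_comp σ (fun i => ‖q i‖ ^ 2), Equiv.sum_comp σ q]

theorem L_perm {m : ℝ} (hm : 0 < m) (μ : ℝ) {k : ℕ} (σ : Equiv.Perm (Fin k))
    (q : Fin k → R3) : L m μ (q ∘ σ) = L m μ q := by
  rw [L_eq hm, L_eq hm]
  simp only [Function.comp_apply, Equiv.sum_comp σ (fun i => ‖q i‖ ^ 2), Equiv.sum_comp σ q]

theorem measurable_symbol {m : ℝ} (μ : ℝ) {k : ℕ} :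
    Measurable (symbol m μ : (Fin k → R3) → ℝ) := by
  unfold symbol
  fun_prop

theorem measurable_G {m : ℝ} (μ : ℝ) {k : ℕ} : Measurable (G m μ : (Fin k → R3) → ℝ) :=
  (measurable_symbol μ).inv

theorem measurable_L {m : ℝ} (μ : ℝ) {k : ℕ} : Measurable (L m μ : (Fin k → R3) → ℝ) := by
  unfold L
  fun_prop

/-- Completing the square in one momentum leaves the square of L/(2π²) as remainder. This is how
T_diag arises from integrating G over one momentum. -/
theorem symbol_cons {m μ : ℝ} (hm : 0 < m) (hμ : 0 < μ) {n : ℕ} (x : R3) (q : Fin n → R3) :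
    symbol m μ (Fin.cons x q : Fin (n + 1) → R3) =
      ‖x + (m + 1)⁻¹ • ∑ i, q i‖ ^ 2 + (L m μ q / (2 * Real.pi ^ 2)) ^ 2 := by
  rw [symbol_eq hm, L_eq hm, mul_div_cancel_left₀ _ (by positivity), Real.sq_sqrt (by positivity),
    Fin.sum_univ_succ, Fin.sum_univ_succ]
  simp only [Fin.cons_zero, Fin.cons_succ]
  rw [norm_add_sq_real, norm_add_sq_real, inner_smul_right, norm_smul, mul_pow, norm_inv,
    Real.norm_of_nonneg (by positivity)]
  field_simp
  ring

/-- The effective value of `Q` that absorbs the spectral parameter `μ`. -/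
def effQ (m μ : ℝ) {n : ℕ} (q : Fin n → R3) : ℝ :=
  Real.sqrt (∑ i, ‖q i‖ ^ 2 + μ * (m + 1) / m)

theorem effQ_pos {m μ : ℝ} (hm : 0 < m) (hμ : 0 < μ) {n : ℕ} (q : Fin n → R3) :
    0 < effQ m μ q := Real.sqrt_pos.2 (by positivity)

theorem effQ_sq {m μ : ℝ} (hm : 0 < m) (hμ : 0 < μ) {n : ℕ} (q : Fin n → R3) :
    effQ m μ q ^ 2 = ∑ i, ‖q i‖ ^ 2 + μ * (m + 1) / m := Real.sq_sqrt (by positivity)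

theorem measurable_effQ (m μ : ℝ) {n : ℕ} : Measurable (effQ m μ : (Fin n → R3) → ℝ) := by
  unfold effQ
  fun_prop

/-- In ℓ_m the square of Q has coefficient m/(m+1), so adding μ(m+1)/m to ∑ qᵢ² reproduces exactly
μ. -/
theorem L_cons {m μ : ℝ} (hm : 0 < m) (hμ : 0 < μ) {n : ℕ} (s : R3) (q : Fin n → R3) :
    L m μ (Fin.cons s q : Fin (n + 1) → R3) =
      2 * Real.pi ^ 2 * ell m s (∑ i, q i) (effQ m μ q) := by
  rw [L_eq hm, ell, effQ_sq hm hμ, Fin.sum_univ_succ, Fin.sum_univ_succ]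
  simp only [Fin.cons_zero, Fin.cons_succ]
  congr 2
  field_simp
  ring

/-- The part of the symbol that is even in the shifted momenta. -/
def evenSymbol (m : ℝ) (s t K : R3) (Q : ℝ) : ℝ :=
  ‖s + (2 + m)⁻¹ • K‖ ^ 2 + ‖t + (2 + m)⁻¹ • K‖ ^ 2 + m / (1 + m) * (Q ^ 2 + (2 + m)⁻¹ * ‖K‖ ^ 2)

/-- The part of the symbol that is odd in the shifted momenta. -/
def oddSymbol (m : ℝ) (s t K : R3) : ℝ :=
  2 / (1 + m) * inner ℝ (s + (2 + m)⁻¹ • K) (t + (2 + m)⁻¹ • K)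

/-- The shift A = 1/(2+m) is determined by the cross term (s + t)·K: the shifted squares contribute
2A and the shifted product 2A/(1+m), which must add up to 2/(1+m). -/
theorem symbol_cons_cons {m μ : ℝ} (hm : 0 < m) (hμ : 0 < μ) {n : ℕ} (s t : R3)
    (q : Fin n → R3) :
    symbol m μ (Fin.cons s (Fin.cons t q : Fin (n + 1) → R3) : Fin (n + 2) → R3) =
      evenSymbol m s t (∑ i, q i) (effQ m μ q) + oddSymbol m s t (∑ i, q i) := by
  rw [symbol_eq hm, evenSymbol, oddSymbol, effQ_sq hm hμ]
  simp only [Fin.sum_univ_succ, Fin.cons_zero, Fin.cons_succ]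
  set K := ∑ i, q i
  rw [norm_add_sq_real s, norm_add_sq_real t K, norm_add_sq_real s, norm_add_sq_real t,
    inner_add_left, inner_add_right, inner_add_right, inner_add_right]
  simp only [inner_smul_left, inner_smul_right, norm_smul, mul_pow, norm_inv,
    Real.norm_of_nonneg (by positivity : 0 ≤ 2 + m), map_inv₀, conj_trivial,
    real_inner_self_eq_norm_sq, real_inner_comm t K]
  field_simp
  ring

theorem evenSymbol_swap (m : ℝ) (s t K : R3) (Q : ℝ) :
    evenSymbol m s t K Q = evenSymbol m t s K Q := by
  simp only [evenSymbol, add_comm (‖s + (2 + m)⁻¹ • K‖ ^ 2)]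

theorem oddSymbol_swap (m : ℝ) (s t K : R3) : oddSymbol m s t K = oddSymbol m t s K := by
  rw [oddSymbol, oddSymbol, real_inner_comm]

theorem evenSymbol_pos {m : ℝ} (hm : 0 < m) (s t K : R3) {Q : ℝ} (hQ : 0 < Q) :
    0 < evenSymbol m s t K Q := by
  unfold evenSymbol
  positivity

theorem abs_inner_shift_le {m : ℝ} (hm : 0 < m) (s t K : R3) (Q : ℝ) :
    2 * |inner ℝ (s + (2 + m)⁻¹ • K) (t + (2 + m)⁻¹ • K)| ≤ evenSymbol m s t K Q := by
  have h1 := abs_real_inner_le_norm (s + (2 + m)⁻¹ • K) (t + (2 + m)⁻¹ • K)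
  have h2 : 0 ≤ m / (1 + m) * (Q ^ 2 + (2 + m)⁻¹ * ‖K‖ ^ 2) := by positivity
  unfold evenSymbol
  nlinarith [sq_nonneg (‖s + (2 + m)⁻¹ • K‖ - ‖t + (2 + m)⁻¹ • K‖)]

theorem abs_oddSymbol_le {m : ℝ} (hm : 0 < m) (s t K : R3) (Q : ℝ) :
    |oddSymbol m s t K| ≤ (1 + m)⁻¹ * evenSymbol m s t K Q := by
  have h := abs_inner_shift_le hm s t K Q
  rw [oddSymbol, abs_mul, abs_of_pos (by positivity), div_eq_mul_inv, mul_comm 2, mul_assoc]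
  gcongr

theorem abs_oddSymbol_lt {m : ℝ} (hm : 0 < m) (s t K : R3) {Q : ℝ} (hQ : 0 < Q) :
    |oddSymbol m s t K| < evenSymbol m s t K Q := by
  refine (abs_oddSymbol_le hm s t K Q).trans_lt ?_
  exact mul_lt_of_lt_one_left (evenSymbol_pos hm s t K hQ) (inv_lt_one_of_one_lt₀ (by linarith))

/-- Undoing the shift by AK costs a multiple of |K|², which the |K|² term of the even symbol pays
for. -/
theorem le_evenSymbol {m : ℝ} (hm : 0 < m) (s t K : R3) (Q : ℝ) :
    m * (2 + m)⁻¹ / (1 + m) / 2 * (‖s‖ ^ 2 + ‖K‖ ^ 2 + Q ^ 2 + ‖t‖ ^ 2) ≤ evenSymbol m s t K Q := by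
  set A : ℝ := (2 + m)⁻¹ with hA
  have hA0 : 0 < A := by positivity
  have hA1 : A ≤ 1 / 2 := by
    rw [hA, inv_le_comm₀ (by positivity) (by norm_num)]
    linarith
  have hsub : ∀ s : R3, ‖s‖ ^ 2 ≤ 2 * ‖s + A • K‖ ^ 2 + 2 * A ^ 2 * ‖K‖ ^ 2 := by
    intro s
    have h := parallelogram_law_with_norm ℝ (s + A • K) (A • K)
    rw [add_sub_cancel_right, norm_smul, Real.norm_of_nonneg hA0.le] at h
    nlinarith [sq_nonneg ‖s + A • K + A • K‖]
  have h1 := hsub s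
  have h2 := hsub t
  set κ : ℝ := m * A / (1 + m) with hκ
  have hr : m / (1 + m) ≤ 1 := (div_le_one (by positivity)).2 (by linarith)
  have hr0 : 0 < m / (1 + m) := by positivity
  have hκ' : κ = m / (1 + m) * A := by rw [hκ]; ring
  have hκ1 : κ ≤ 1 / 2 := by rw [hκ']; nlinarith
  have hκ0 : 0 < κ := by positivity
  have hes : evenSymbol m s t K Q = ‖s + A • K‖ ^ 2 + ‖t + A • K‖ ^ 2
      + (m / (1 + m) * Q ^ 2 + κ * ‖K‖ ^ 2) := by
    rw [evenSymbol, hκ']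
    ring
  have hκ2 : κ ≤ m / (1 + m) := by rw [hκ']; nlinarith
  rw [hes]
  have hA2 : A ^ 2 ≤ 1 / 4 := by nlinarith
  have e1 : ‖s‖ ^ 2 + ‖t‖ ^ 2 ≤ 2 * (‖s + A • K‖ ^ 2 + ‖t + A • K‖ ^ 2) + ‖K‖ ^ 2 := by
    nlinarith [sq_nonneg ‖K‖]
  have e2 : κ * (‖s + A • K‖ ^ 2 + ‖t + A • K‖ ^ 2) ≤ ‖s + A • K‖ ^ 2 + ‖t + A • K‖ ^ 2 :=
    mul_le_of_le_one_left (by positivity) (by linarith)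
  have e3 : κ * Q ^ 2 ≤ m / (1 + m) * Q ^ 2 := by gcongr
  have e4 : 0 ≤ m / (1 + m) * Q ^ 2 := by positivity
  have e5 := mul_le_mul_of_nonneg_left e1 hκ0.le
  linarith

theorem ell_pos {m : ℝ} (hm : 0 < m) (s K : R3) {Q : ℝ} (hQ : 0 < Q) : 0 < ell m s K Q :=
  Real.sqrt_pos.2 (by positivity)

theorem le_ell_sq {m : ℝ} (hm : 0 < m) (s K : R3) (Q : ℝ) :
    m / (3 * (m + 1) ^ 2) * (‖s‖ ^ 2 + ‖K‖ ^ 2 + Q ^ 2) ≤ ell m s K Q ^ 2 := by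
  rw [ell, Real.sq_sqrt (by positivity)]
  have h1 : ‖K‖ ^ 2 ≤ 2 * ‖s + K‖ ^ 2 + 2 * ‖s‖ ^ 2 := by
    have h := parallelogram_law_with_norm ℝ (s + K) s
    rw [add_sub_cancel_left] at h
    nlinarith [sq_nonneg ‖s + K + s‖]
  have h2 : m / (m + 1) = m / (m + 1) ^ 2 * (m + 1) := by field_simp
  have h3 : m / (3 * (m + 1) ^ 2) = m / (m + 1) ^ 2 * (1 / 3) := by field_simp
  rw [h2, h3, mul_assoc, mul_assoc, ← mul_add]
  gcongr
  nlinarith [sq_nonneg ‖s + K‖, sq_nonneg ‖s‖, sq_nonneg Q]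

theorem measurable_ell (m : ℝ) {α : Type*} [MeasurableSpace α] {s K : α → R3} {Q : α → ℝ}
    (hs : Measurable s) (hK : Measurable K) (hQ : Measurable Q) :
    Measurable fun x => ell m (s x) (K x) (Q x) := by
  unfold ell
  fun_prop

theorem measurable_evenSymbol (m : ℝ) {α : Type*} [MeasurableSpace α] {s t K : α → R3} {Q : α → ℝ}
    (hs : Measurable s) (ht : Measurable t) (hK : Measurable K) (hQ : Measurable Q) :
    Measurable fun x => evenSymbol m (s x) (t x) (K x) (Q x) := by
  unfold evenSymbol
  fun_prop

theorem measurable_oddSymbol (m : ℝ) {α : Type*} [MeasurableSpace α] {s t K : α → R3}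
    (hs : Measurable s) (ht : Measurable t) (hK : Measurable K) :
    Measurable fun x => oddSymbol m (s x) (t x) (K x) := by
  unfold oddSymbol
  fun_prop

/-! ### Finiteness of `Λ(m)` -/

theorem ell_rpow_le {m : ℝ} (hm : 0 < m) (s K : R3) {Q e : ℝ} (he : 0 < e)
    (h : e ^ 2 ≤ ‖s‖ ^ 2 + ‖K‖ ^ 2 + Q ^ 2) :
    ell m s K Q ^ (-(1 / 2) : ℝ) ≤
      (m / (3 * (m + 1) ^ 2)) ^ (-(1 / 4) : ℝ) * e ^ (-(1 / 2) : ℝ) := by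
  set c := m / (3 * (m + 1) ^ 2) with hc
  have hc0 : 0 < c := by positivity
  have h1 : c * e ^ 2 ≤ ell m s K Q ^ 2 := le_trans (by gcongr) (le_ell_sq hm s K Q)
  have h2 : (c ^ (1 / 2 : ℝ) * e) ≤ ell m s K Q := by
    rw [← Real.sqrt_eq_rpow]
    refine le_of_sq_le_sq ?_ (Real.sqrt_nonneg _)
    rwa [mul_pow, Real.sq_sqrt hc0.le]
  have h3 : 0 < c ^ (1 / 2 : ℝ) * e := by positivity
  refine (Real.rpow_le_rpow_of_nonpos h3 h2 (by norm_num)).trans_eq ?_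
  rw [Real.mul_rpow (by positivity) he.le, ← Real.rpow_mul hc0.le]
  norm_num

/-- With e² = |s|² + |K|² + Q², the prefactor is at most a multiple of e^{3/2}. Since ℓ_m(t)
dominates a multiple of |t| and E one of e² + |t|², scaling bounds the integral by a multiple of
e^{-3/2}. The powers cancel. -/
theorem exists_schur_bound {m : ℝ} (hm : 0 < m) :
    ∃ C : ℝ, 0 ≤ C ∧ ∀ (s K : R3) (Q : ℝ), 0 < Q →
      ENNReal.ofReal ((‖s‖ ^ 2 + Q ^ 2) * ell m s K Q ^ (-(1 / 2) : ℝ)) *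
        ∫⁻ t : R3, ENNReal.ofReal (1 / ‖t‖ ^ 2 * ell m t K Q ^ (-(1 / 2) : ℝ) *
          (evenSymbol m s t K Q)⁻¹) ≤ ENNReal.ofReal C := by
  obtain ⟨C, hC0, hC⟩ := exists_lintegral_norm_rpow_div_le
  set c1 := (m / (3 * (m + 1) ^ 2)) ^ (-(1 / 4) : ℝ) with hc1
  set c2 := m * (2 + m)⁻¹ / (1 + m) / 2 with hc2
  have hc1p : 0 < c1 := by positivity
  have hc2p : 0 < c2 := by positivity
  refine ⟨c1 * (c1 * c2⁻¹ * C), by positivity, fun s K Q hQ => ?_⟩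
  set e := Real.sqrt (‖s‖ ^ 2 + ‖K‖ ^ 2 + Q ^ 2) with he
  have he2 : e ^ 2 = ‖s‖ ^ 2 + ‖K‖ ^ 2 + Q ^ 2 := Real.sq_sqrt (by positivity)
  have he0 : 0 < e := Real.sqrt_pos.2 (by positivity)
  have hInt : ∫⁻ t : R3, ENNReal.ofReal (1 / ‖t‖ ^ 2 * ell m t K Q ^ (-(1 / 2) : ℝ) *
      (evenSymbol m s t K Q)⁻¹) ≤ ENNReal.ofReal (c1 * c2⁻¹) *
        ∫⁻ t : R3, ENNReal.ofReal (‖t‖ ^ (-(5 / 2) : ℝ) / (e ^ 2 + ‖t‖ ^ 2)) := by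
    rw [← lintegral_const_mul' _ _ ENNReal.ofReal_ne_top]
    refine lintegral_mono fun t => ?_
    rw [← ENNReal.ofReal_mul (by positivity)]
    refine ENNReal.ofReal_le_ofReal ?_
    -- At t = 0 both sides are zero by the conventions for division by zero and for negative powers
    -- of zero.
    rcases eq_or_ne t 0 with rfl | ht
    · simp only [norm_zero]
      rw [Real.zero_rpow (by norm_num)]
      simp
    have ht0 : 0 < ‖t‖ := norm_pos_iff.2 ht
    have h1 : ell m t K Q ^ (-(1 / 2) : ℝ) ≤ c1 * ‖t‖ ^ (-(1 / 2) : ℝ) :=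
      ell_rpow_le hm t K ht0 (by nlinarith [sq_nonneg ‖K‖])
    have h2 : (evenSymbol m s t K Q)⁻¹ ≤ (c2 * (e ^ 2 + ‖t‖ ^ 2))⁻¹ := by
      gcongr
      rw [he2]
      exact le_evenSymbol hm s t K Q
    have h3 : 1 / ‖t‖ ^ 2 * ‖t‖ ^ (-(1 / 2) : ℝ) = ‖t‖ ^ (-(5 / 2) : ℝ) := by
      rw [one_div, ← Real.rpow_natCast, ← Real.rpow_neg ht0.le, ← Real.rpow_add ht0]
      norm_num
    calc _ ≤ 1 / ‖t‖ ^ 2 * (c1 * ‖t‖ ^ (-(1 / 2) : ℝ)) * (c2 * (e ^ 2 + ‖t‖ ^ 2))⁻¹ := by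
          have := inv_nonneg.2 (evenSymbol_pos hm s t K hQ).le
          gcongr
      _ = _ := by rw [← h3]; field_simp
  have hpre : (‖s‖ ^ 2 + Q ^ 2) * ell m s K Q ^ (-(1 / 2) : ℝ) ≤ c1 * e ^ (3 / 2 : ℝ) := by
    have h1 := ell_rpow_le hm s K he0 he2.le
    have h2 : ‖s‖ ^ 2 + Q ^ 2 ≤ e ^ 2 := by rw [he2]; nlinarith [sq_nonneg ‖K‖]
    calc _ ≤ e ^ 2 * (c1 * e ^ (-(1 / 2) : ℝ)) := by
          have := Real.rpow_nonneg (ell_pos hm s K hQ).le (-(1 / 2))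
          gcongr
      _ = c1 * (e ^ 2 * e ^ (-(1 / 2) : ℝ)) := by ring
      _ = _ := by
          rw [← Real.rpow_natCast, ← Real.rpow_add he0]
          norm_num
  refine (mul_le_mul' (ENNReal.ofReal_le_ofReal hpre)
    (hInt.trans (mul_le_mul_right (hC e he0) _))).trans ?_
  rw [← ENNReal.ofReal_mul (by positivity), ← ENNReal.ofReal_mul (by positivity)]
  refine ENNReal.ofReal_le_ofReal (le_of_eq ?_)
  have : e ^ (3 / 2 : ℝ) * e ^ (-(3 / 2) : ℝ) = 1 := by
    rw [← Real.rpow_add he0]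
    simp
  linear_combination (c1 * c1 * c2⁻¹ * C) * this

/-- The absolute value of the odd part of `G`. -/
def oddKernel (m : ℝ) (s t K : R3) (Q : ℝ) : ℝ :=
  |oddSymbol m s t K| / (evenSymbol m s t K Q ^ 2 - oddSymbol m s t K ^ 2)

theorem sq_sub_sq_pos {m : ℝ} (hm : 0 < m) (s t K : R3) {Q : ℝ} (hQ : 0 < Q) :
    0 < evenSymbol m s t K Q ^ 2 - oddSymbol m s t K ^ 2 := by
  have h := abs_oddSymbol_lt hm s t K hQ
  have := sq_lt_sq' (by linarith [abs_nonneg (oddSymbol m s t K)]) h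
  rw [sq_abs] at this
  linarith

theorem oddKernel_nonneg {m : ℝ} (hm : 0 < m) (s t K : R3) {Q : ℝ} (hQ : 0 < Q) :
    0 ≤ oddKernel m s t K Q := div_nonneg (abs_nonneg _) (sq_sub_sq_pos hm s t K hQ).le

theorem lambdaIntegrand_eq {m : ℝ} (hm : 0 < m) (s t K : R3) (Q : ℝ) :
    lambdaIntegrand m s K Q t =
      (1 + m) / 2 * (1 / ‖t‖ ^ 2 * ell m t K Q ^ (-(1 / 2) : ℝ) * oddKernel m s t K Q) := by
  have : |oddSymbol m s t K| =
      2 / (1 + m) * |inner ℝ (s + (2 + m)⁻¹ • K) (t + (2 + m)⁻¹ • K)| := by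
    rw [oddSymbol, abs_mul, abs_of_pos (by positivity)]
  rw [oddKernel, this]
  simp only [lambdaIntegrand, evenSymbol, oddSymbol]
  field_simp

theorem oddKernel_le {m : ℝ} (hm : 0 < m) (s t K : R3) {Q : ℝ} (hQ : 0 < Q) :
    oddKernel m s t K Q ≤ (1 - (1 + m)⁻¹ ^ 2)⁻¹ * (evenSymbol m s t K Q)⁻¹ := by
  have ha := evenSymbol_pos hm s t K hQ
  have h1 := abs_oddSymbol_le hm s t K Q
  have hr1 : (1 + m)⁻¹ < 1 := inv_lt_one_of_one_lt₀ (by linarith)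
  have hr0 : 0 < (1 + m)⁻¹ := by positivity
  set r := (1 + m)⁻¹
  have hr2 : 0 < 1 - r ^ 2 := by nlinarith
  have h2 : (1 - r ^ 2) * evenSymbol m s t K Q ^ 2 ≤
      evenSymbol m s t K Q ^ 2 - oddSymbol m s t K ^ 2 := by
    have := pow_le_pow_left₀ (abs_nonneg _) h1 2
    rw [sq_abs] at this
    nlinarith
  rw [oddKernel, ← mul_inv, ← one_div]
  refine (div_le_div_of_nonneg_left (abs_nonneg _) (by positivity) h2).trans ?_
  rw [div_le_div_iff₀ (by positivity) (by positivity)]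
  have h3 : |oddSymbol m s t K| ≤ evenSymbol m s t K Q := (abs_oddSymbol_lt hm s t K hQ).le
  calc |oddSymbol m s t K| * ((1 - r ^ 2) * evenSymbol m s t K Q)
      ≤ evenSymbol m s t K Q * ((1 - r ^ 2) * evenSymbol m s t K Q) := by gcongr
    _ = _ := by ring

/-- Since |O| ≤ E/(1+m), the difference E² - O² is comparable to E². The odd kernel is thus at most
a multiple of 1/E, for which the Schur integral is already bounded. -/
theorem Lam_lt_top {m : ℝ} (hm : 0 < m) : Lam m < ⊤ := by
  obtain ⟨C, hC0, hC⟩ := exists_schur_bound hm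
  have hr1 : (1 + m)⁻¹ < 1 := inv_lt_one_of_one_lt₀ (by linarith)
  have hr0 : 0 < (1 + m)⁻¹ := by positivity
  have hr2 : 0 < 1 - (1 + m)⁻¹ ^ 2 := by nlinarith
  set D := (1 + m) / 2 * (1 - (1 + m)⁻¹ ^ 2)⁻¹ with hD
  set c := (Real.pi ^ 2 * (1 + m))⁻¹ with hc
  refine lt_of_le_of_lt (b := ENNReal.ofReal (c * D * C)) ?_ ENNReal.ofReal_lt_top
  refine iSup_le fun s => iSup_le fun K => iSup_le fun Q => iSup_le fun hQ => ?_
  have h1 : ∫⁻ t : R3, ENNReal.ofReal (lambdaIntegrand m s K Q t) ≤ ENNReal.ofReal D *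
      ∫⁻ t : R3, ENNReal.ofReal (1 / ‖t‖ ^ 2 * ell m t K Q ^ (-(1 / 2) : ℝ) *
          (evenSymbol m s t K Q)⁻¹) := by
    rw [← lintegral_const_mul' _ _ ENNReal.ofReal_ne_top]
    refine lintegral_mono fun t => ?_
    rw [← ENNReal.ofReal_mul (by positivity), lambdaIntegrand_eq hm]
    refine ENNReal.ofReal_le_ofReal ?_
    have h2 := oddKernel_le hm s t K hQ
    have h3 := Real.rpow_nonneg (ell_pos hm t K hQ).le (-(1 / 2))
    calc _ ≤ (1 + m) / 2 * (1 / ‖t‖ ^ 2 * ell m t K Q ^ (-(1 / 2) : ℝ) *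
          ((1 - (1 + m)⁻¹ ^ 2)⁻¹ * (evenSymbol m s t K Q)⁻¹)) := by gcongr
      _ = _ := by rw [hD]; ring
  have h4 : ENNReal.ofReal ((‖s‖ ^ 2 + Q ^ 2) / (Real.pi ^ 2 * (1 + m)) *
      ell m s K Q ^ (-(1 / 2) : ℝ)) =
      ENNReal.ofReal c * ENNReal.ofReal ((‖s‖ ^ 2 + Q ^ 2) * ell m s K Q ^ (-(1 / 2) : ℝ)) := by
    rw [← ENNReal.ofReal_mul (by positivity)]
    congr 1
    rw [hc]
    ring
  rw [h4]
  refine (mul_le_mul_right h1 _).trans ?_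
  have h5 : ENNReal.ofReal (c * D * C) =
      ENNReal.ofReal c * ENNReal.ofReal D * ENNReal.ofReal C := by
    rw [ENNReal.ofReal_mul (by positivity), ENNReal.ofReal_mul (by positivity)]
  rw [h5]
  calc _ = ENNReal.ofReal c * ENNReal.ofReal D * (ENNReal.ofReal ((‖s‖ ^ 2 + Q ^ 2) *
          ell m s K Q ^ (-(1 / 2) : ℝ)) * ∫⁻ t : R3, ENNReal.ofReal (1 / ‖t‖ ^ 2 *
            ell m t K Q ^ (-(1 / 2) : ℝ) * (evenSymbol m s t K Q)⁻¹)) := by ring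
    _ ≤ _ := mul_le_mul_right (hC s K Q hQ) _

/-! ### Splitting off and permuting momenta -/

theorem measurePreserving_cons (n : ℕ) :
    MeasurePreserving (fun p : R3 × (Fin n → R3) => (Fin.cons p.1 p.2 : Fin (n + 1) → R3)) := by
  have h := (volume_preserving_piFinSuccAbove (fun _ : Fin (n + 1) => R3) 0).symm
  convert! h using 1
  ext1 p
  simp [MeasurableEquiv.piFinSuccAbove, Fin.insertNthEquiv]

theorem measurableEmbedding_cons (n : ℕ) :
    MeasurableEmbedding (fun p : R3 × (Fin n → R3) => (Fin.cons p.1 p.2 : Fin (n + 1) → R3)) := by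
  have h := (MeasurableEquiv.piFinSuccAbove (fun _ : Fin (n + 1) => R3) 0).symm.measurableEmbedding
  convert! h using 1
  ext1 p
  simp [MeasurableEquiv.piFinSuccAbove, Fin.insertNthEquiv]

theorem measurable_cons {α : Type*} [MeasurableSpace α] {n : ℕ} {x : α → R3} {q : α → Fin n → R3}
    (hx : Measurable x) (hq : Measurable q) :
    Measurable fun a => (Fin.cons (x a) (q a) : Fin (n + 1) → R3) :=
  (measurePreserving_cons n).measurable.comp (hx.prodMk hq)

theorem lintegral_cons {n : ℕ} {F : (Fin (n + 1) → R3) → ℝ≥0∞} (hF : Measurable F) :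
    ∫⁻ q, F q = ∫⁻ q : Fin n → R3, ∫⁻ x : R3, F (Fin.cons x q) := by
  rw [← (measurePreserving_cons n).lintegral_comp hF]
  exact lintegral_prod_symm _ (hF.comp (measurePreserving_cons n).measurable).aemeasurable

theorem lintegral_pair {n : ℕ} {F : (R3 × R3) × (Fin n → R3) → ℝ≥0∞} (hF : Measurable F) :
    ∫⁻ p, F p = ∫⁻ q : Fin n → R3, ∫⁻ s : R3, ∫⁻ t : R3, F ((s, t), q) := by
  rw [Measure.volume_eq_prod, lintegral_prod_symm _ hF.aemeasurable]
  refine lintegral_congr fun q => ?_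
  rw [Measure.volume_eq_prod, lintegral_prod _ (by fun_prop)]

theorem coe_piCongrLeft_symm {k : ℕ} (σ : Equiv.Perm (Fin k)) :
    (MeasurableEquiv.piCongrLeft (fun _ : Fin k => R3) σ.symm : (Fin k → R3) → Fin k → R3) =
      fun q => q ∘ σ := by
  ext1 q
  ext1 i
  obtain ⟨j, rfl⟩ := σ.symm.surjective i
  rw [MeasurableEquiv.coe_piCongrLeft, Equiv.piCongrLeft_apply_apply]
  simp

theorem measurePreserving_perm {k : ℕ} (σ : Equiv.Perm (Fin k)) :
    MeasurePreserving (fun q : Fin k → R3 => q ∘ σ) :=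
  coe_piCongrLeft_symm σ ▸ volume_measurePreserving_piCongrLeft (fun _ : Fin k => R3) σ.symm

theorem measurableEmbedding_perm {k : ℕ} (σ : Equiv.Perm (Fin k)) :
    MeasurableEmbedding (fun q : Fin k → R3 => q ∘ σ) :=
  coe_piCongrLeft_symm σ ▸
    (MeasurableEquiv.piCongrLeft (fun _ : Fin k => R3) σ.symm).measurableEmbedding

theorem measurePreserving_swap_pair (n : ℕ) :
    MeasurePreserving (fun p : (R3 × R3) × (Fin n → R3) => ((p.1.2, p.1.1), p.2)) :=
  (Measure.measurePreserving_swap (μ := (volume : Measure R3)) (ν := (volume : Measure R3))).prod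
    (MeasurePreserving.id (volume : Measure (Fin n → R3)))

theorem ae_fst_ne_zero (n : ℕ) : ∀ᵐ p : (R3 × R3) × (Fin n → R3), p.1.1 ≠ 0 := by
  have h : ∀ᵐ s : R3, s ≠ 0 := by simp [ae_iff]
  exact (Measure.quasiMeasurePreserving_fst.comp Measure.quasiMeasurePreserving_fst).ae h

/-! ### The weighted Schur test -/

/-- By symmetry of |h| and L every particle contributes the same weighted integral, so the factor n
+ 1 turns into a sum over the particles, and the weights sum to at most one. -/
theorem mul_lintegral_first_weight_le {n : ℕ} {m μ : ℝ} (hm : 0 < m) (hμ : 0 < μ)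
    {h : (Fin (n + 1) → R3) → ℂ} (hh : Measurable h)
    (hsymm : ∀ σ : Equiv.Perm (Fin (n + 1)), ∀ᵐ q, ‖h (q ∘ σ)‖ = ‖h q‖) :
    ENNReal.ofReal ((n : ℝ) + 1) * ∫⁻ q, ENNReal.ofReal
        (‖h q‖ ^ 2 * L m μ q * (‖q 0‖ ^ 2 / (∑ i, ‖q i‖ ^ 2 + μ * (m + 1) / m))) ≤
      ∫⁻ q, ENNReal.ofReal (‖h q‖ ^ 2 * L m μ q) := by
  let F : Fin (n + 1) → (Fin (n + 1) → R3) → ℝ≥0∞ := fun i q => ENNReal.ofReal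
    (‖h q‖ ^ 2 * L m μ q * (‖q i‖ ^ 2 / (∑ i, ‖q i‖ ^ 2 + μ * (m + 1) / m)))
  have hL : Measurable (L m μ : (Fin (n + 1) → R3) → ℝ) := measurable_L μ
  have hF : ∀ i, Measurable (F i) := fun i => by fun_prop
  have heq : ∀ i, ∫⁻ q, F i q = ∫⁻ q, F 0 q := by
    intro i
    rw [← (measurePreserving_perm (Equiv.swap 0 i)).lintegral_comp (hF i)]
    refine lintegral_congr_ae ?_
    filter_upwards [hsymm (Equiv.swap 0 i)] with q hq
    simp only [F, hq, L_perm hm, Function.comp_apply, Equiv.swap_apply_right,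
      Equiv.sum_comp (Equiv.swap 0 i) (fun i => ‖q i‖ ^ 2)]
  have hsum : ENNReal.ofReal ((n : ℝ) + 1) * ∫⁻ q, F 0 q = ∫⁻ q, ∑ i, F i q := by
    rw [lintegral_finsetSum _ (fun i _ => hF i), Finset.sum_congr rfl (fun i _ => heq i)]
    simp only [Finset.sum_const, Finset.card_univ, Fintype.card_fin, nsmul_eq_mul]
    congr 1
    rw [show ((n : ℝ) + 1) = ((n + 1 : ℕ) : ℝ) by push_cast; ring, ENNReal.ofReal_natCast]
  rw [hsum]
  refine lintegral_mono fun q => ?_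
  have hLp := L_pos hm hμ q
  rw [← ENNReal.ofReal_sum_of_nonneg (fun i _ => by positivity), ← Finset.mul_sum,
    ← Finset.sum_div]
  refine ENNReal.ofReal_le_ofReal (mul_le_of_le_one_right (by positivity) ?_)
  refine (div_le_one (by positivity)).2 ?_
  have : 0 < μ * (m + 1) / m := by positivity
  linarith

/-- The value of `ℓ_m` at the momenta `(s, q)`, with the spectral parameter absorbed in `Q`. -/
def ellOf (m μ : ℝ) {n : ℕ} (s : R3) (q : Fin n → R3) : ℝ := ell m s (∑ i, q i) (effQ m μ q)

theorem ellOf_pos {m μ : ℝ} (hm : 0 < m) (hμ : 0 < μ) {n : ℕ} (s : R3) (q : Fin n → R3) :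
    0 < ellOf m μ s q := ell_pos hm _ _ (effQ_pos hm hμ q)

theorem measurable_ellOf (m μ : ℝ) {n : ℕ} {α : Type*} [MeasurableSpace α] {s : α → R3}
    {q : α → Fin n → R3} (hs : Measurable s) (hq : Measurable q) :
    Measurable fun x => ellOf m μ (s x) (q x) := by
  have hQ : Measurable fun x => effQ m μ (q x) := (measurable_effQ m μ).comp hq
  have hK : Measurable fun x => ∑ i, q x i := by fun_prop
  exact measurable_ell m hs hK hQ

/-- A Schur test in (s, t) for fixed q, with weight a(s) = |s|² ℓ_m(s)^{1/2}: the product |h(s)h(t)|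
is split by the inequality of means with ratio a(s)/a(t), the two halves agree by symmetry of k, and
the t-integral is bounded by `hkc`. What remains is the diagonal density times the share |s|²/(|s|²
+ Q²) of one particle, which compensates n + 1. -/
theorem schur_test {n : ℕ} {m μ : ℝ} (hm : 0 < m) (hμ : 0 < μ)
    {k : R3 → R3 → (Fin n → R3) → ℝ}
    (hk : Measurable fun p : (R3 × R3) × (Fin n → R3) => k p.1.1 p.1.2 p.2)
    (hk0 : ∀ s t q, 0 ≤ k s t q) (hks : ∀ s t q, k s t q = k t s q) {c : ℝ} (hc : 0 ≤ c)
    (hkc : ∀ s q, ENNReal.ofReal ((‖s‖ ^ 2 + effQ m μ q ^ 2) *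
        ellOf m μ s q ^ (-(1 / 2) : ℝ)) *
      ∫⁻ t : R3, ENNReal.ofReal (1 / ‖t‖ ^ 2 * ellOf m μ t q ^ (-(1 / 2) : ℝ) * k s t q) ≤ ENNReal.ofReal c)
    {h : (Fin (n + 1) → R3) → ℂ} (hh : Measurable h)
    (hsymm : ∀ σ : Equiv.Perm (Fin (n + 1)), ∀ᵐ q, ‖h (q ∘ σ)‖ = ‖h q‖) :
    ENNReal.ofReal ((n : ℝ) + 1) * ∫⁻ p : (R3 × R3) × (Fin n → R3),
        ENNReal.ofReal (‖h (Fin.cons p.1.1 p.2)‖ * ‖h (Fin.cons p.1.2 p.2)‖ * k p.1.1 p.1.2 p.2) ≤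
      ENNReal.ofReal (c / (2 * Real.pi ^ 2)) * ∫⁻ q, ENNReal.ofReal (‖h q‖ ^ 2 * L m μ q) := by
  have he0 : ∀ s q, 0 < ellOf m μ s q := ellOf_pos (n := n) hm hμ
  let R : (R3 × R3) × (Fin n → R3) → ℝ≥0∞ := fun p => ENNReal.ofReal
    (‖h (Fin.cons p.1.1 p.2)‖ ^ 2 * (‖p.1.1‖ ^ 2 * ellOf m μ p.1.1 p.2 ^ (1 / 2 : ℝ)) *
      (1 / ‖p.1.2‖ ^ 2 * ellOf m μ p.1.2 p.2 ^ (-(1 / 2) : ℝ) * k p.1.1 p.1.2 p.2))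
  have hh1 : Measurable fun p : (R3 × R3) × (Fin n → R3) => h (Fin.cons p.1.1 p.2) :=
    hh.comp (measurable_cons (by fun_prop) (by fun_prop))
  have he1 : Measurable fun p : (R3 × R3) × (Fin n → R3) => ellOf m μ p.1.1 p.2 :=
    measurable_ellOf m μ (by fun_prop) (by fun_prop)
  have he2 : Measurable fun p : (R3 × R3) × (Fin n → R3) => ellOf m μ p.1.2 p.2 :=
    measurable_ellOf m μ (by fun_prop) (by fun_prop)
  have hn1 : Measurable fun p : (R3 × R3) × (Fin n → R3) => ‖p.1.1‖ ^ 2 := by fun_prop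
  have hn2 : Measurable fun p : (R3 × R3) × (Fin n → R3) => 1 / ‖p.1.2‖ ^ 2 := by fun_prop
  have hR : Measurable R :=
    (((hh1.norm.pow_const 2).mul (hn1.mul (he1.pow_const _))).mul
      ((hn2.mul (he2.pow_const _)).mul hk)).ennreal_ofReal
  have hae : ∀ᵐ p : (R3 × R3) × (Fin n → R3), p.1.2 ≠ 0 :=
    (measurePreserving_swap_pair n).quasiMeasurePreserving.ae (ae_fst_ne_zero n)
  have step1 : ∫⁻ p : (R3 × R3) × (Fin n → R3), ENNReal.ofReal
      (‖h (Fin.cons p.1.1 p.2)‖ * ‖h (Fin.cons p.1.2 p.2)‖ * k p.1.1 p.1.2 p.2) ≤ ∫⁻ p, R p := by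
    have h1 : ∫⁻ p : (R3 × R3) × (Fin n → R3), ENNReal.ofReal
        (‖h (Fin.cons p.1.1 p.2)‖ * ‖h (Fin.cons p.1.2 p.2)‖ * k p.1.1 p.1.2 p.2) ≤
        ∫⁻ p : (R3 × R3) × (Fin n → R3),
          (2⁻¹ * R p + 2⁻¹ * R ((p.1.2, p.1.1), p.2)) := by
      refine lintegral_mono_ae ?_
      -- The weights vanish at zero momentum, where the ratios below make no sense; this is a null
      -- set.
      filter_upwards [ae_fst_ne_zero n, hae] with p hp1 hp2
      have e1 := he0 p.1.1 p.2
      have e2 := he0 p.1.2 p.2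
      have n1 : 0 < ‖p.1.1‖ := norm_pos_iff.2 hp1
      have n2 : 0 < ‖p.1.2‖ := norm_pos_iff.2 hp2
      have k0 := hk0 p.1.1 p.1.2 p.2
      have k1 := hk0 p.1.2 p.1.1 p.2
      simp only [R]
      rw [← mul_add, ← ENNReal.ofReal_add (by positivity) (by positivity),
        show (2⁻¹ : ℝ≥0∞) = ENNReal.ofReal 2⁻¹ by
          rw [ENNReal.ofReal_inv_of_pos (by norm_num)]; simp,
        ← ENNReal.ofReal_mul (by norm_num)]
      refine ENNReal.ofReal_le_ofReal ?_
      rw [hks p.1.2 p.1.1 p.2, Real.rpow_neg e1.le, Real.rpow_neg e2.le]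
      set a := ‖p.1.1‖ ^ 2 * ellOf m μ p.1.1 p.2 ^ (1 / 2 : ℝ) with ha
      set b := ‖p.1.2‖ ^ 2 * ellOf m μ p.1.2 p.2 ^ (1 / 2 : ℝ) with hb
      have ha0 : 0 < a := by positivity
      have hb0 : 0 < b := by positivity
      have ha' : 1 / ‖p.1.1‖ ^ 2 * (ellOf m μ p.1.1 p.2 ^ (1 / 2 : ℝ))⁻¹ = a⁻¹ := by rw [ha]; field_simp
      have hb' : 1 / ‖p.1.2‖ ^ 2 * (ellOf m μ p.1.2 p.2 ^ (1 / 2 : ℝ))⁻¹ = b⁻¹ := by rw [hb]; field_simp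
      rw [ha', hb']
      set x := ‖h (Fin.cons p.1.1 p.2)‖
      set y := ‖h (Fin.cons p.1.2 p.2)‖
      have key : x * y ≤ 2⁻¹ * (x ^ 2 * a * b⁻¹ + y ^ 2 * b * a⁻¹) := by
        have : 0 ≤ (x * a - y * b) ^ 2 / (2 * a * b) := by positivity
        have h2 : (x * a - y * b) ^ 2 / (2 * a * b) =
            2⁻¹ * (x ^ 2 * a * b⁻¹ + y ^ 2 * b * a⁻¹) - x * y := by
          field_simp
          ring
        linarith
      calc x * y * k p.1.1 p.1.2 p.2 ≤
          2⁻¹ * (x ^ 2 * a * b⁻¹ + y ^ 2 * b * a⁻¹) * k p.1.1 p.1.2 p.2 := by gcongr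
        _ = _ := by ring
    refine h1.trans (le_of_eq ?_)
    rw [lintegral_add_left (hR.const_mul _), lintegral_const_mul _ hR,
      lintegral_const_mul' _ _ (by simp),
      (measurePreserving_swap_pair n).lintegral_comp hR, ← add_mul, ENNReal.inv_two_add_inv_two,
      one_mul]
  have step2 : ∫⁻ p, R p ≤ ENNReal.ofReal (c / (2 * Real.pi ^ 2)) * ∫⁻ q, ENNReal.ofReal
      (‖h q‖ ^ 2 * L m μ q * (‖q 0‖ ^ 2 / (∑ i, ‖q i‖ ^ 2 + μ * (m + 1) / m))) := by
    have hL : Measurable (L m μ : (Fin (n + 1) → R3) → ℝ) := measurable_L μ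
    have hm2 : Measurable fun q : Fin (n + 1) → R3 => ENNReal.ofReal
        (‖h q‖ ^ 2 * L m μ q * (‖q 0‖ ^ 2 / (∑ i, ‖q i‖ ^ 2 + μ * (m + 1) / m))) := by fun_prop
    rw [lintegral_pair hR, ← lintegral_const_mul _ hm2, lintegral_cons (hm2.const_mul _)]
    refine lintegral_mono fun q => lintegral_mono fun s => ?_
    have es := he0 s q
    have hR1 : ∀ t, R ((s, t), q) = ENNReal.ofReal
        (‖h (Fin.cons s q)‖ ^ 2 * (‖s‖ ^ 2 * ellOf m μ s q ^ (1 / 2 : ℝ))) * ENNReal.ofReal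
          (1 / ‖t‖ ^ 2 * ellOf m μ t q ^ (-(1 / 2) : ℝ) * k s t q) := fun t =>
      ENNReal.ofReal_mul (by positivity)
    simp_rw [hR1]
    rw [lintegral_const_mul' _ _ ENNReal.ofReal_ne_top]
    have hQ := effQ_pos hm hμ q
    -- The last factor is the prefactor in `hkc`; the others are the diagonal density, up to 2π²,
    -- times the share of the first particle.
    have hsplit : ‖h (Fin.cons s q)‖ ^ 2 * (‖s‖ ^ 2 * ellOf m μ s q ^ (1 / 2 : ℝ)) =
        (‖h (Fin.cons s q)‖ ^ 2 * (‖s‖ ^ 2 / (‖s‖ ^ 2 + effQ m μ q ^ 2)) * ellOf m μ s q) *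
          ((‖s‖ ^ 2 + effQ m μ q ^ 2) * ellOf m μ s q ^ (-(1 / 2) : ℝ)) := by
      have h1 : ellOf m μ s q ^ (1 / 2 : ℝ) = ellOf m μ s q * ellOf m μ s q ^ (-(1 / 2) : ℝ) := by
        conv_rhs => rw [← Real.rpow_one_add' es.le (by norm_num)]
        norm_num
      rw [h1]
      field_simp
    rw [hsplit, ENNReal.ofReal_mul (by positivity), mul_assoc]
    refine (mul_le_mul_right (hkc s q) _).trans (le_of_eq ?_)
    rw [← ENNReal.ofReal_mul (by positivity), ← ENNReal.ofReal_mul (by positivity)]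
    congr 1
    rw [L_cons hm hμ, effQ_sq hm hμ, Fin.sum_univ_succ]
    simp only [Fin.cons_zero, Fin.cons_succ, ellOf]
    field_simp
    ring
  calc _ ≤ ENNReal.ofReal ((n : ℝ) + 1) * (ENNReal.ofReal (c / (2 * Real.pi ^ 2)) *
        ∫⁻ q, ENNReal.ofReal
          (‖h q‖ ^ 2 * L m μ q * (‖q 0‖ ^ 2 / (∑ i, ‖q i‖ ^ 2 + μ * (m + 1) / m)))) :=
        mul_le_mul_right (step1.trans step2) _
    _ = ENNReal.ofReal (c / (2 * Real.pi ^ 2)) * (ENNReal.ofReal ((n : ℝ) + 1) *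
        ∫⁻ q, ENNReal.ofReal
          (‖h q‖ ^ 2 * L m μ q * (‖q 0‖ ^ 2 / (∑ i, ‖q i‖ ^ 2 + μ * (m + 1) / m)))) := by
        rw [mul_left_comm]
    _ ≤ _ := mul_le_mul_right (mul_lintegral_first_weight_le hm hμ hh hsymm) _

/-! ### Positivity of the even part of the kernel -/

/-- A kernel that is a superposition of non-negative rank one kernels defines a non-negative
quadratic form. -/
theorem re_integral_nonneg_of_feature {X Y : Type*} [MeasurableSpace X] [MeasurableSpace Y]
    {ρ : Measure X} [SFinite ρ] {ν : Measure Y} [SFinite ν]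
    {f : X → ℂ} (hf : Measurable f) {W : Y → ℝ} (hW : Measurable W) (hW0 : ∀ y, 0 ≤ W y)
    {Φ : Y → X → ℝ} (hΦ : Measurable (Function.uncurry Φ)) (hΦ0 : ∀ y s, 0 ≤ Φ y s)
    {k : X → X → ℝ} (hk0 : ∀ s t, 0 ≤ k s t)
    (hk : ∀ s t, ∫⁻ y, ENNReal.ofReal (W y * Φ y s * Φ y t) ∂ν = ENNReal.ofReal (k s t))
    (hInt : Integrable (fun p : X × X => star (f p.1) * f p.2 * (k p.1 p.2 : ℂ)) (ρ.prod ρ)) :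
    0 ≤ (∫ p : X × X, star (f p.1) * f p.2 * (k p.1 p.2 : ℂ) ∂ρ.prod ρ).re := by
  let H : X × X → Y → ℂ := fun p y =>
    star (f p.1) * f p.2 * ((W y * Φ y p.1 * Φ y p.2 : ℝ) : ℂ)
  have hΦ1 : Measurable fun z : (X × X) × Y => Φ z.2 z.1.1 :=
    hΦ.comp (measurable_snd.prodMk (measurable_fst.comp measurable_fst))
  have hΦ2 : Measurable fun z : (X × X) × Y => Φ z.2 z.1.2 :=
    hΦ.comp (measurable_snd.prodMk (measurable_snd.comp measurable_fst))
  have hHm : Measurable (Function.uncurry H) := by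
    have h1 : Measurable fun z : (X × X) × Y => star (f z.1.1) * f z.1.2 :=
      (continuous_star.measurable.comp (hf.comp (measurable_fst.comp measurable_fst))).mul
        (hf.comp (measurable_snd.comp measurable_fst))
    exact h1.mul (Complex.measurable_ofReal.comp (((hW.comp measurable_snd).mul hΦ1).mul hΦ2))
  have hHe : ∀ p y, ‖H p y‖ₑ =
      ‖star (f p.1) * f p.2‖ₑ * ENNReal.ofReal (W y * Φ y p.1 * Φ y p.2) := by
    intro p y
    have h0 : 0 ≤ W y * Φ y p.1 * Φ y p.2 :=
      mul_nonneg (mul_nonneg (hW0 y) (hΦ0 y _)) (hΦ0 y _)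
    simp only [H]
    rw [enorm_mul, ← ofReal_norm (_ : ℂ), ← ofReal_norm (Complex.ofReal _), Complex.norm_real,
      Real.norm_of_nonneg h0]
  -- Since the features are non-negative, integrating |H| over y gives |f(s)f(t)| k(s, t) exactly,
  -- so `hInt` is all that Fubini needs.
  have hHint : Integrable (Function.uncurry H) ((ρ.prod ρ).prod ν) := by
    refine ⟨hHm.aestronglyMeasurable, ?_⟩
    rw [hasFiniteIntegral_iff_enorm, lintegral_prod _ hHm.enorm.aemeasurable]
    have h1 := hInt.2
    rw [hasFiniteIntegral_iff_enorm] at h1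
    refine lt_of_le_of_lt (le_of_eq (lintegral_congr fun p => ?_)) h1
    simp only [Function.uncurry_apply_pair, hHe]
    rw [lintegral_const_mul' _ _ enorm_ne_top, hk, enorm_mul (star (f p.1) * f p.2)]
    congr 1
    rw [← ofReal_norm, Complex.norm_real, Real.norm_of_nonneg (hk0 _ _)]
  have hkint : ∀ s t, ∫ y, W y * Φ y s * Φ y t ∂ν = k s t := by
    intro s t
    have hm : Measurable fun y => W y * Φ y s * Φ y t :=
      (hW.mul (hΦ.comp (measurable_id.prodMk measurable_const))).mul
        (hΦ.comp (measurable_id.prodMk measurable_const))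
    rw [integral_eq_lintegral_of_nonneg_ae (.of_forall fun y =>
      mul_nonneg (mul_nonneg (hW0 y) (hΦ0 y _)) (hΦ0 y _)) hm.aestronglyMeasurable, hk,
      ENNReal.toReal_ofReal (hk0 s t)]
  have h1 : ∫ p : X × X, star (f p.1) * f p.2 * (k p.1 p.2 : ℂ) ∂ρ.prod ρ =
      ∫ p, ∫ y, H p y ∂ν ∂ρ.prod ρ := by
    congr 1
    ext1 p
    simp only [H]
    rw [integral_const_mul, integral_complex_ofReal, hkint]
  -- For fixed y the kernel has rank one, and the double integral factorizes into W(y) times a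
  -- squared modulus.
  have h2 : ∀ y, ∫ p, H p y ∂ρ.prod ρ =
      ((W y * Complex.normSq (∫ t, f t * (Φ y t : ℂ) ∂ρ) : ℝ) : ℂ) := by
    intro y
    have h3 : ∀ p : X × X, H p y = (W y : ℂ) *
        ((star (f p.1) * (Φ y p.1 : ℂ)) * (f p.2 * (Φ y p.2 : ℂ))) := by
      intro p
      simp only [H]
      push_cast
      ring
    simp_rw [h3]
    rw [integral_const_mul, integral_prod_mul (fun s => star (f s) * (Φ y s : ℂ))
      (fun t => f t * (Φ y t : ℂ))]
    have h4 : ∫ s, star (f s) * (Φ y s : ℂ) ∂ρ =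
        (starRingEnd ℂ) (∫ t, f t * (Φ y t : ℂ) ∂ρ) := by
      rw [← integral_conj]
      simp
    rw [h4, mul_comm ((starRingEnd ℂ) _), Complex.mul_conj]
    push_cast
    ring
  rw [h1, integral_integral_swap hHint]
  simp_rw [h2]
  rw [integral_complex_ofReal]
  simp only [Complex.ofReal_re]
  exact integral_nonneg fun y => mul_nonneg (hW0 y) (Complex.normSq_nonneg _)

/-- The normalization of the Gaussian `e^{-v²}` on `ℝ³`. -/
def gaussMass : ℝ := ∫ v : R3, Real.exp (-1 * ‖v‖ ^ 2)

theorem gaussMass_pos : 0 < gaussMass := by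
  rw [gaussMass, GaussianFourier.integral_rexp_neg_mul_sq_norm one_pos]
  positivity

theorem lintegral_gaussian (w : R3) :
    ∫⁻ v : R3, ENNReal.ofReal (Real.exp (-‖v‖ ^ 2 + inner ℝ w v)) =
      ENNReal.ofReal (gaussMass * Real.exp (‖w‖ ^ 2 / 4)) := by
  have h1 : ∀ v : R3, Real.exp (-‖v‖ ^ 2 + inner ℝ w v) =
      Real.exp (‖w‖ ^ 2 / 4) * Real.exp (-1 * ‖v + (-(2⁻¹ : ℝ) • w)‖ ^ 2) := by
    intro v
    rw [← Real.exp_add, norm_add_sq_real, inner_smul_right, norm_smul, real_inner_comm]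
    congr 1
    rw [norm_neg, Real.norm_of_nonneg (by norm_num)]
    ring
  have hI : Integrable fun v : R3 => Real.exp (-1 * ‖v‖ ^ 2) :=
    Integrable.of_integral_ne_zero gaussMass_pos.ne'
  simp_rw [h1, ENNReal.ofReal_mul (Real.exp_pos _).le]
  rw [lintegral_const_mul' _ _ ENNReal.ofReal_ne_top,
    lintegral_add_right_eq_self (fun v : R3 => ENNReal.ofReal (Real.exp (-1 * ‖v‖ ^ 2))),
    ← ofReal_integral_eq_lintegral_ofReal hI (.of_forall fun v => (Real.exp_pos _).le),
    ← ENNReal.ofReal_mul (Real.exp_pos _).le, mul_comm]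
  rfl

theorem lintegral_gaussian_cosh (w : R3) (a : ℝ) (ha : 0 ≤ a) :
    ∫⁻ v : R3, ENNReal.ofReal (a * (Real.exp (-‖v‖ ^ 2) * Real.cosh (inner ℝ w v))) =
      ENNReal.ofReal (a * (gaussMass * Real.exp (‖w‖ ^ 2 / 4))) := by
  have h1 : ∀ v : R3, ENNReal.ofReal (a * (Real.exp (-‖v‖ ^ 2) * Real.cosh (inner ℝ w v))) =
      ENNReal.ofReal (a / 2) * (ENNReal.ofReal (Real.exp (-‖v‖ ^ 2 + inner ℝ w v)) +
        ENNReal.ofReal (Real.exp (-‖v‖ ^ 2 + inner ℝ (-w) v))) := by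
    intro v
    rw [← ENNReal.ofReal_add (Real.exp_pos _).le (Real.exp_pos _).le,
      ← ENNReal.ofReal_mul (by positivity), inner_neg_left, Real.exp_add, Real.exp_add,
      Real.cosh_eq]
    congr 1
    ring
  have hm : Measurable fun v : R3 =>
      ENNReal.ofReal (Real.exp (-‖v‖ ^ 2 + inner ℝ w v)) := by fun_prop
  simp_rw [h1]
  rw [lintegral_const_mul' _ _ ENNReal.ofReal_ne_top, lintegral_add_left hm,
    lintegral_gaussian, lintegral_gaussian, norm_neg, ← ENNReal.ofReal_add (by
      have := gaussMass_pos; positivity) (by have := gaussMass_pos; positivity),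
    ← ENNReal.ofReal_mul (by positivity)]
  congr 1
  ring

theorem lintegral_exp_neg_Ioi {a : ℝ} (ha : 0 < a) :
    ∫⁻ r in Set.Ioi (0 : ℝ), ENNReal.ofReal (Real.exp (-a * r)) = ENNReal.ofReal a⁻¹ := by
  rw [← ofReal_integral_eq_lintegral_ofReal
    (integrableOn_exp_mul_Ioi (a := -a) (by linarith) 0) (.of_forall fun r => (Real.exp_pos _).le),
    integral_exp_mul_Ioi (a := -a) (by linarith) 0]
  congr 1
  simp [neg_div_neg_eq]

/-- The weight of the feature representation of the even kernel. -/
def featureWeight (c : ℝ) (y : ℝ × R3) : ℝ :=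
  gaussMass⁻¹ * Real.exp (-c * y.1) * Real.exp (-‖y.2‖ ^ 2)

/-- The features of the even kernel. -/
def feature (b : ℝ) (y : ℝ × R3) (s : R3) : ℝ :=
  Real.exp (-y.1 * (1 + b / 2) * ‖s‖ ^ 2) *
    Real.cosh (inner ℝ (Real.sqrt (2 * y.1 * b) • s) y.2)

/-- With a = |s|² + |t|² + c and x = b s·t, the kernel a/(a² - x²) = ½(1/(a-x) + 1/(a+x)) is the
integral of e^{-ar} cosh(rx) over r > 0. To separate s from t in cosh(rx), a Gaussian variable v is
introduced: the product of the two hyperbolic cosines is half the sum of those with s + t and s - t,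
and with coefficient √(2rb) the Gaussian integrals produce e^{rb|s±t|²/2}. The factor 1 + b/2 in
`feature` cancels the diagonal part of these exponents, leaving e^{±rx}. -/
theorem lintegral_feature {b c : ℝ} (hb : 0 ≤ b) {s t : R3}
    (hx : |b * inner ℝ s t| < ‖s‖ ^ 2 + ‖t‖ ^ 2 + c) :
    ∫⁻ y, ENNReal.ofReal (featureWeight c y * feature b y s * feature b y t)
        ∂((volume.restrict (Set.Ioi (0 : ℝ))).prod (volume : Measure R3)) =
      ENNReal.ofReal ((‖s‖ ^ 2 + ‖t‖ ^ 2 + c) /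
        ((‖s‖ ^ 2 + ‖t‖ ^ 2 + c) ^ 2 - (b * inner ℝ s t) ^ 2)) := by
  set a := ‖s‖ ^ 2 + ‖t‖ ^ 2 + c with ha
  set x := b * inner ℝ s t with hxdef
  obtain ⟨hx1, hx2⟩ := abs_lt.1 hx
  have hZ := gaussMass_pos
  have hm : Measurable fun y : ℝ × R3 =>
      ENNReal.ofReal (featureWeight c y * feature b y s * feature b y t) := by
    unfold featureWeight feature
    fun_prop
  rw [lintegral_prod _ hm.aemeasurable]
  have hinner : ∀ r ∈ Set.Ioi (0 : ℝ), ∫⁻ v : R3, ENNReal.ofReal (featureWeight c (r, v) *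
      feature b (r, v) s * feature b (r, v) t) =
      ENNReal.ofReal (1 / 2) * (ENNReal.ofReal (Real.exp (-(a - x) * r)) +
        ENNReal.ofReal (Real.exp (-(a + x) * r))) := by
    intro r hr
    have hr0 : (0 : ℝ) < r := hr
    set β := Real.sqrt (2 * r * b) with hβ
    have hβ2 : β ^ 2 = 2 * r * b := Real.sq_sqrt (by positivity)
    set A := gaussMass⁻¹ * Real.exp (-c * r) * Real.exp (-r * (1 + b / 2) * ‖s‖ ^ 2) *
      Real.exp (-r * (1 + b / 2) * ‖t‖ ^ 2) / 2 with hA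
    have hA0 : 0 ≤ A := by positivity
    have hpt : ∀ v : R3, ENNReal.ofReal (featureWeight c (r, v) *
        feature b (r, v) s * feature b (r, v) t) =
        ENNReal.ofReal (A * (Real.exp (-‖v‖ ^ 2) * Real.cosh (inner ℝ (β • (s + t)) v))) +
        ENNReal.ofReal (A * (Real.exp (-‖v‖ ^ 2) * Real.cosh (inner ℝ (β • (s - t)) v))) := by
      intro v
      have hc1 := Real.cosh_pos (inner ℝ (β • (s + t)) v)
      have hc2 := Real.cosh_pos (inner ℝ (β • (s - t)) v)
      rw [← ENNReal.ofReal_add (by positivity) (by positivity)]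
      congr 1
      simp only [featureWeight, feature, smul_add, smul_sub, inner_add_left, inner_sub_left,
        Real.cosh_add, Real.cosh_sub, hA, ← hβ]
      ring
    have hm1 : Measurable fun v : R3 => ENNReal.ofReal (A * (Real.exp (-‖v‖ ^ 2) *
        Real.cosh (inner ℝ (β • (s + t)) v))) := by fun_prop
    simp_rw [hpt]
    rw [lintegral_add_left hm1, lintegral_gaussian_cosh _ _ hA0, lintegral_gaussian_cosh _ _ hA0,
      mul_add, ← ENNReal.ofReal_mul (by norm_num), ← ENNReal.ofReal_mul (by norm_num)]
    have hexp : ∀ (w : R3) (E : ℝ), -c * r + -r * (1 + b / 2) * ‖s‖ ^ 2 +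
        -r * (1 + b / 2) * ‖t‖ ^ 2 + ‖β • w‖ ^ 2 / 4 = E →
        A * (gaussMass * Real.exp (‖β • w‖ ^ 2 / 4)) = 1 / 2 * Real.exp E := by
      intro w E hE
      rw [← hE, hA, Real.exp_add, Real.exp_add, Real.exp_add]
      field_simp
    congr 2
    · apply hexp
      rw [norm_smul, mul_pow, Real.norm_eq_abs, sq_abs, hβ2, norm_add_sq_real, ha, hxdef]
      ring
    · apply hexp
      rw [norm_smul, mul_pow, Real.norm_eq_abs, sq_abs, hβ2, norm_sub_sq_real, ha, hxdef]
      ring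
  rw [setLIntegral_congr_fun measurableSet_Ioi hinner,
    lintegral_const_mul' _ _ ENNReal.ofReal_ne_top, lintegral_add_left (by fun_prop),
    lintegral_exp_neg_Ioi (by linarith), lintegral_exp_neg_Ioi (by linarith),
    ← ENNReal.ofReal_add (inv_nonneg.2 (by linarith)) (inv_nonneg.2 (by linarith)),
    ← ENNReal.ofReal_mul (by norm_num)]
  congr 1
  have h1 : a - x ≠ 0 := by linarith
  have h2 : a + x ≠ 0 := by linarith
  have h3 : a ^ 2 - x ^ 2 ≠ 0 := by
    rw [sq_sub_sq]
    exact mul_ne_zero h2 h1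
  field_simp
  ring

/-- The even part of `G`. -/
def evenKernel (m : ℝ) (s t K : R3) (Q : ℝ) : ℝ :=
  evenSymbol m s t K Q / (evenSymbol m s t K Q ^ 2 - oddSymbol m s t K ^ 2)

theorem evenKernel_nonneg {m : ℝ} (hm : 0 < m) (s t K : R3) {Q : ℝ} (hQ : 0 < Q) :
    0 ≤ evenKernel m s t K Q :=
  div_nonneg (evenSymbol_pos hm s t K hQ).le (sq_sub_sq_pos hm s t K hQ).le

/-- The even part of `G` defines a non-negative quadratic form. -/
theorem re_integral_evenKernel_nonneg {m : ℝ} (hm : 0 < m) (K : R3) {Q : ℝ} (hQ : 0 < Q)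
    {f : R3 → ℂ} (hf : Measurable f)
    (hInt : Integrable fun p : R3 × R3 =>
      star (f p.1) * f p.2 * (evenKernel m p.1 p.2 K Q : ℂ)) :
    0 ≤ (∫ p : R3 × R3, star (f p.1) * f p.2 * (evenKernel m p.1 p.2 K Q : ℂ)).re := by
  set d : R3 := (2 + m)⁻¹ • K with hd
  refine re_integral_nonneg_of_feature (ρ := volume)
    (ν := (volume.restrict (Set.Ioi (0 : ℝ))).prod (volume : Measure R3)) hf
    (W := featureWeight (m / (1 + m) * (Q ^ 2 + (2 + m)⁻¹ * ‖K‖ ^ 2)))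
    (Φ := fun y s => feature (2 / (1 + m)) y (s + d))
    (by unfold featureWeight; fun_prop) (fun y => ?_) (by unfold feature; fun_prop)
    (fun y s => ?_) (k := fun s t => evenKernel m s t K Q)
    (fun s t => evenKernel_nonneg hm s t K hQ) (fun s t => ?_) hInt
  · have := gaussMass_pos
    unfold featureWeight
    positivity
  · have := Real.cosh_pos (inner ℝ (Real.sqrt (2 * y.1 * (2 / (1 + m))) • (s + d)) y.2)
    unfold feature
    positivity
  · exact lintegral_feature (by positivity) (abs_oddSymbol_lt hm s t K hQ)

/-! ### The form domains as weighted `L²` spaces -/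

theorem integrable_norm_sq_mul_of_le {X : Type*} [MeasurableSpace X] {ρ : Measure X}
    {h : X → ℂ} (hh : Measurable h) {V W : X → ℝ} (hV : Measurable V) (hV0 : ∀ x, 0 ≤ V x)
    {C : ℝ} (hC : 0 ≤ C) (hVW : ∀ x, V x ≤ C * W x)
    (hW : ∫⁻ x, ‖h x‖ₑ ^ 2 * ENNReal.ofReal (W x) ∂ρ < ⊤) :
    Integrable (fun x => ‖h x‖ ^ 2 * V x) ρ := by
  refine ⟨((hh.norm.pow_const 2).mul hV).aestronglyMeasurable, ?_⟩
  rw [hasFiniteIntegral_iff_ofReal (.of_forall fun x => mul_nonneg (by positivity) (hV0 x))]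
  refine lt_of_le_of_lt ?_ (ENNReal.mul_lt_top (a := ENNReal.ofReal C) ENNReal.ofReal_lt_top hW)
  rw [← lintegral_const_mul' _ _ ENNReal.ofReal_ne_top]
  refine lintegral_mono fun x => ?_
  simp only
  rw [ENNReal.ofReal_mul (by positivity), ENNReal.ofReal_pow (norm_nonneg _), ofReal_norm,
    mul_left_comm, ← ENNReal.ofReal_mul hC]
  gcongr
  exact hVW x

theorem lintegral_norm_sq_mul_lt_top {X : Type*} [MeasurableSpace X] {ρ : Measure X}
    {h : X → ℂ} {V W : X → ℝ} (hV0 : ∀ x, 0 ≤ V x)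
    {C : ℝ} (hC : 0 ≤ C) (hWV : ∀ x, W x ≤ C * V x)
    (hV : Integrable (fun x => ‖h x‖ ^ 2 * V x) ρ) :
    ∫⁻ x, ‖h x‖ₑ ^ 2 * ENNReal.ofReal (W x) ∂ρ < ⊤ := by
  have h1 := hV.2
  rw [hasFiniteIntegral_iff_ofReal (.of_forall fun x => mul_nonneg (by positivity) (hV0 x))] at h1
  refine lt_of_le_of_lt ?_ (ENNReal.mul_lt_top (a := ENNReal.ofReal C) ENNReal.ofReal_lt_top h1)
  rw [← lintegral_const_mul' _ _ ENNReal.ofReal_ne_top]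
  refine lintegral_mono fun x => ?_
  simp only
  rw [ENNReal.ofReal_mul (by positivity), ENNReal.ofReal_pow (norm_nonneg _), ofReal_norm,
    mul_left_comm, ← ENNReal.ofReal_mul hC]
  gcongr
  exact hWV x

theorem quadratic_bounds {a b μ S P : ℝ} {k : ℕ} (ha : 0 < a) (hμ : 0 < μ) (hb : 0 ≤ b)
    (hS : 0 ≤ S) (hP0 : 0 ≤ P) (hP : P ≤ k * S) :
    min a μ * (1 + S) ≤ a * S + b * P + μ ∧ a * S + b * P + μ ≤ (a + b * k + μ) * (1 + S) := by
  constructor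
  · have h1 : min a μ * S ≤ a * S := by gcongr; exact min_le_left _ _
    have h2 : min a μ ≤ μ := min_le_right _ _
    have h3 : 0 ≤ b * P := by positivity
    linarith
  · have h1 : b * P ≤ b * (k * S) := by gcongr
    have h2 : 0 ≤ b * k := by positivity
    have h3 : 0 ≤ μ * S := by positivity
    nlinarith

theorem mem_sobolevAs_one_iff {m μ : ℝ} (hm : 0 < m) (hμ : 0 < μ) {k : ℕ} (w : L2 k) :
    w ∈ sobolevAs 1 k ↔ IsAntisymm w ∧ Integrable fun q => ‖hat w q‖ ^ 2 * symbol m μ q := by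
  have hbd : ∀ q : Fin k → R3, min (m / (m + 1)) μ * (1 + ∑ i, ‖q i‖ ^ 2) ≤ symbol m μ q ∧
      symbol m μ q ≤ (m / (m + 1) + 1 / (m + 1) * k + μ) * (1 + ∑ i, ‖q i‖ ^ 2) := fun q => by
    rw [symbol_eq hm]
    exact quadratic_bounds (by positivity) hμ (by positivity) (by positivity) (by positivity)
      (norm_sum_sq_le q)
  have hmin : 0 < min (m / (m + 1)) μ := lt_min (by positivity) hμ
  refine and_congr_right fun _ => ?_
  rw [memSobolev_iff_lintegral_hat zero_le_one]
  simp only [Real.rpow_one]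
  constructor
  · exact integrable_norm_sq_mul_of_le (measurable_hat w) (measurable_symbol μ)
      (fun q => (symbol_pos hm hμ q).le) (by positivity) (fun q => (hbd q).2)
  · refine lintegral_norm_sq_mul_lt_top (fun q => (symbol_pos hm hμ q).le)
      (C := (min (m / (m + 1)) μ)⁻¹) (by positivity) (fun q => ?_)
    rw [inv_mul_eq_div, le_div_iff₀ hmin, mul_comm]
    exact (hbd q).1

theorem mem_sobolevAs_half_iff {m μ : ℝ} (hm : 0 < m) (hμ : 0 < μ) {k : ℕ} (ξ : L2 k) :
    ξ ∈ sobolevAs (1 / 2) k ↔ IsAntisymm ξ ∧ Integrable (diagIntegrand m μ ξ) := by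
  set c := min (m / (m + 1)) μ with hc
  set C := m / (m + 1) + m / (m + 1) ^ 2 * k + μ with hC
  have hmin : 0 < c := lt_min (by positivity) hμ
  have hbd : ∀ q : Fin k → R3,
      2 * Real.pi ^ 2 * Real.sqrt c * (1 + ∑ i, ‖q i‖ ^ 2) ^ (1 / 2 : ℝ) ≤ L m μ q ∧
      L m μ q ≤ 2 * Real.pi ^ 2 * Real.sqrt C * (1 + ∑ i, ‖q i‖ ^ 2) ^ (1 / 2 : ℝ) := fun q => by
    obtain ⟨h1, h2⟩ := quadratic_bounds (a := m / (m + 1)) (b := m / (m + 1) ^ 2) (μ := μ)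
      (S := ∑ i, ‖q i‖ ^ 2) (P := ‖∑ i, q i‖ ^ 2) (k := k) (by positivity) hμ (by positivity)
      (by positivity) (by positivity) (norm_sum_sq_le q)
    rw [L_eq hm, ← Real.sqrt_eq_rpow, mul_assoc _ (Real.sqrt c), mul_assoc _ (Real.sqrt C),
      ← Real.sqrt_mul hmin.le, ← Real.sqrt_mul (by positivity)]
    exact ⟨by gcongr, by gcongr⟩
  refine and_congr_right fun _ => ?_
  rw [memSobolev_iff_lintegral_hat (by norm_num)]
  constructor
  · exact integrable_norm_sq_mul_of_le (measurable_hat ξ) (measurable_L μ)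
      (fun q => (L_pos hm hμ q).le) (by positivity) (fun q => (hbd q).2)
  · refine lintegral_norm_sq_mul_lt_top (V := L m μ) (fun q => (L_pos hm hμ q).le)
      (C := (2 * Real.pi ^ 2 * Real.sqrt c)⁻¹) (by positivity) (fun q => ?_)
    rw [inv_mul_eq_div, le_div_iff₀ (by positivity), mul_comm]
    exact (hbd q).1

theorem diagIntegrand_nonneg {m μ : ℝ} (hm : 0 < m) (hμ : 0 < μ) {k : ℕ} (ξ : L2 k)
    (q : Fin k → R3) : 0 ≤ diagIntegrand m μ ξ q :=
  mul_nonneg (by positivity) (L_pos hm hμ q).le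

theorem IsAntisymm.norm_hat_perm {k : ℕ} {ξ : L2 k} (h : IsAntisymm ξ)
    (σ : Equiv.Perm (Fin k)) : ∀ᵐ q, ‖hat ξ (q ∘ σ)‖ = ‖hat ξ q‖ := by
  filter_upwards [(isAntisymm_iff_hat ξ).1 h σ] with q hq
  rw [hq, norm_mul]
  rcases Int.units_eq_one_or (Equiv.Perm.sign σ) with h | h <;> simp [h]

/-! ### Bounds on the off-diagonal form -/

/-- The constant in the bound of the off-diagonal by the diagonal form. -/
theorem exists_lintegral_pair_le {m : ℝ} (hm : 0 < m) :
    ∃ C : ℝ, 0 ≤ C ∧ ∀ (n : ℕ) (μ : ℝ), 0 < μ → ∀ ξ : L2 (n + 1), IsAntisymm ξ →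
      ENNReal.ofReal ((n : ℝ) + 1) * ∫⁻ p : (R3 × R3) × (Fin n → R3), ENNReal.ofReal
        (‖hat ξ (Fin.cons p.1.1 p.2)‖ * ‖hat ξ (Fin.cons p.1.2 p.2)‖ *
          (evenSymbol m p.1.1 p.1.2 (∑ i, p.2 i) (effQ m μ p.2))⁻¹) ≤
      ENNReal.ofReal C * ∫⁻ q, ENNReal.ofReal (diagIntegrand m μ ξ q) := by
  obtain ⟨C, hC0, hC⟩ := exists_schur_bound hm
  refine ⟨C / (2 * Real.pi ^ 2), by positivity, fun n μ hμ ξ hξ => ?_⟩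
  refine schur_test hm hμ (k := fun s t q => (evenSymbol m s t (∑ i, q i) (effQ m μ q))⁻¹) ?_
    (fun s t q => inv_nonneg.2 (evenSymbol_pos hm _ _ _ (effQ_pos hm hμ q)).le)
    (fun s t q => by rw [evenSymbol_swap]) hC0 (fun s q => hC s _ _ (effQ_pos hm hμ q))
    (measurable_hat ξ) hξ.norm_hat_perm
  have hQ : Measurable fun p : (R3 × R3) × (Fin n → R3) => effQ m μ p.2 :=
    (measurable_effQ m μ).comp measurable_snd
  have hK : Measurable fun p : (R3 × R3) × (Fin n → R3) => ∑ i, p.2 i := by fun_prop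
  exact (measurable_evenSymbol m (by fun_prop) (by fun_prop) hK hQ).inv

/-- The prefactor 1/(π²(1+m)) of Λ(m) and the factor (1+m)/2 in `lambdaIntegrand_eq` combine to
1/(2π²). The Schur constant of the odd kernel is therefore 2π²Λ(m), and `schur_test` divides it by
2π². -/
theorem lintegral_oddKernel_le {m : ℝ} (hm : 0 < m) {n : ℕ} {μ : ℝ} (hμ : 0 < μ)
    {ξ : L2 (n + 1)} (hξ : IsAntisymm ξ) :
    ENNReal.ofReal ((n : ℝ) + 1) * ∫⁻ p : (R3 × R3) × (Fin n → R3), ENNReal.ofReal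
        (‖hat ξ (Fin.cons p.1.1 p.2)‖ * ‖hat ξ (Fin.cons p.1.2 p.2)‖ *
          oddKernel m p.1.1 p.1.2 (∑ i, p.2 i) (effQ m μ p.2)) ≤
      ENNReal.ofReal (Lam m).toReal * ∫⁻ q, ENNReal.ofReal (diagIntegrand m μ ξ q) := by
  have hΛ := Lam_lt_top hm
  have hc : (Lam m).toReal = (2 * Real.pi ^ 2 * (Lam m).toReal) / (2 * Real.pi ^ 2) := by
    field_simp
  rw [hc]
  refine schur_test hm hμ (k := fun s t q => oddKernel m s t (∑ i, q i) (effQ m μ q)) ?_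
    (fun s t q => oddKernel_nonneg hm _ _ _ (effQ_pos hm hμ q))
    (fun s t q => by simp only [oddKernel]; rw [evenSymbol_swap, oddSymbol_swap])
    (by positivity) (fun s q => ?_) (measurable_hat ξ) hξ.norm_hat_perm
  · have hQ : Measurable fun p : (R3 × R3) × (Fin n → R3) => effQ m μ p.2 :=
      (measurable_effQ m μ).comp measurable_snd
    have hK : Measurable fun p : (R3 × R3) × (Fin n → R3) => ∑ i, p.2 i := by fun_prop
    have h1 : Measurable fun p : (R3 × R3) × (Fin n → R3) => p.1.1 := by fun_prop
    have h2 : Measurable fun p : (R3 × R3) × (Fin n → R3) => p.1.2 := by fun_prop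
    have hE := measurable_evenSymbol m h1 h2 hK hQ
    have hO := measurable_oddSymbol m h1 h2 hK
    unfold oddKernel
    exact hO.abs.div ((hE.pow_const 2).sub (hO.pow_const 2))
  · set K := ∑ i, q i
    set Q := effQ m μ q
    have hQ : 0 < Q := effQ_pos hm hμ q
    have hell : ∀ s : R3, ellOf m μ s q = ell m s K Q := fun _ => rfl
    simp only [hell]
    have h1 : ENNReal.ofReal ((‖s‖ ^ 2 + Q ^ 2) / (Real.pi ^ 2 * (1 + m)) *
        ell m s K Q ^ (-(1 / 2) : ℝ)) *
          ∫⁻ t : R3, ENNReal.ofReal (lambdaIntegrand m s K Q t) ≤ Lam m :=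
      le_iSup_of_le s (le_iSup_of_le K (le_iSup_of_le Q (le_iSup_of_le hQ le_rfl)))
    simp only [lambdaIntegrand_eq hm s _ K Q,
      ENNReal.ofReal_mul (p := (1 + m) / 2) (by positivity)] at h1
    rw [lintegral_const_mul' _ _ ENNReal.ofReal_ne_top, ← mul_assoc,
      ← ENNReal.ofReal_mul (by have := ell_pos hm s K hQ; positivity)] at h1
    rw [ENNReal.ofReal_mul (p := 2 * Real.pi ^ 2) (by positivity), ENNReal.ofReal_toReal hΛ.ne]
    refine le_trans (le_of_eq ?_) (mul_le_mul_right h1 _)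
    rw [← mul_assoc, ← ENNReal.ofReal_mul (by positivity)]
    congr 2
    field_simp

/-- Pair integrands with a kernel dominated by the inverse even symbol are integrable. -/
theorem integrable_pair {m : ℝ} (hm : 0 < m) {n : ℕ} {μ : ℝ} (hμ : 0 < μ)
    {ξ : L2 (n + 1)} (hξ : IsAntisymm ξ) (hd : Integrable (diagIntegrand m μ ξ))
    {k : (R3 × R3) × (Fin n → R3) → ℝ} (hk : Measurable k) {D : ℝ} (hD : 0 ≤ D)
    (hkD : ∀ p, |k p| ≤ D * (evenSymbol m p.1.1 p.1.2 (∑ i, p.2 i) (effQ m μ p.2))⁻¹) :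
    Integrable fun p : (R3 × R3) × (Fin n → R3) =>
      star (hat ξ (Fin.cons p.1.1 p.2)) * hat ξ (Fin.cons p.1.2 p.2) * (k p : ℂ) := by
  obtain ⟨C, hC0, hC⟩ := exists_lintegral_pair_le hm
  have h1 : Measurable fun p : (R3 × R3) × (Fin n → R3) => hat ξ (Fin.cons p.1.1 p.2) :=
    (measurable_hat ξ).comp (measurable_cons (by fun_prop) (by fun_prop))
  have h2 : Measurable fun p : (R3 × R3) × (Fin n → R3) => hat ξ (Fin.cons p.1.2 p.2) :=
    (measurable_hat ξ).comp (measurable_cons (by fun_prop) (by fun_prop))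
  refine ⟨(((continuous_star.measurable.comp h1).mul h2).mul
    (Complex.measurable_ofReal.comp hk)).aestronglyMeasurable, ?_⟩
  have hfin := hd.2
  rw [hasFiniteIntegral_iff_ofReal (.of_forall (diagIntegrand_nonneg hm hμ ξ))] at hfin
  have h3 := (hC n μ hμ ξ hξ).trans_lt (ENNReal.mul_lt_top ENNReal.ofReal_lt_top hfin)
  have h4 : ∫⁻ p : (R3 × R3) × (Fin n → R3), ENNReal.ofReal
        (‖hat ξ (Fin.cons p.1.1 p.2)‖ * ‖hat ξ (Fin.cons p.1.2 p.2)‖ *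
          (evenSymbol m p.1.1 p.1.2 (∑ i, p.2 i) (effQ m μ p.2))⁻¹) < ⊤ := by
    refine lt_top_iff_ne_top.2 fun h => ?_
    rw [h, ENNReal.mul_top (ENNReal.ofReal_pos.2 (by positivity)).ne'] at h3
    exact lt_irrefl _ h3
  rw [hasFiniteIntegral_iff_norm]
  refine lt_of_le_of_lt ?_ (ENNReal.mul_lt_top (a := ENNReal.ofReal D) ENNReal.ofReal_lt_top h4)
  rw [← lintegral_const_mul' _ _ ENNReal.ofReal_ne_top]
  refine lintegral_mono fun p => ?_
  rw [← ENNReal.ofReal_mul hD]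
  refine ENNReal.ofReal_le_ofReal ?_
  rw [norm_mul, norm_mul, norm_star, Complex.norm_real, Real.norm_eq_abs, mul_left_comm]
  gcongr
  exact hkD p

theorem G_cons_cons {m μ : ℝ} (hm : 0 < m) (hμ : 0 < μ) {n : ℕ} (s t : R3)
    (q : Fin n → R3) :
    G m μ (Fin.cons s (Fin.cons t q : Fin (n + 1) → R3) : Fin (n + 2) → R3) =
      (evenSymbol m s t (∑ i, q i) (effQ m μ q) + oddSymbol m s t (∑ i, q i))⁻¹ := by
  rw [G, symbol_cons_cons hm hμ]

theorem inv_add_oddSymbol_le {m : ℝ} (hm : 0 < m) (s t K : R3) {Q : ℝ} (hQ : 0 < Q) :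
    |(evenSymbol m s t K Q + oddSymbol m s t K)⁻¹| ≤
      (1 - (1 + m)⁻¹)⁻¹ * (evenSymbol m s t K Q)⁻¹ := by
  have h1 := (abs_le.1 (abs_oddSymbol_le hm s t K Q)).1
  have ha := evenSymbol_pos hm s t K hQ
  have hr : 0 < 1 - (1 + m)⁻¹ := sub_pos.2 (inv_lt_one_of_one_lt₀ (by linarith))
  have h2 : (1 - (1 + m)⁻¹) * evenSymbol m s t K Q ≤
      evenSymbol m s t K Q + oddSymbol m s t K := by linarith
  have h3 : 0 < (1 - (1 + m)⁻¹) * evenSymbol m s t K Q := by positivity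
  rw [abs_of_pos (inv_pos.2 (h3.trans_le h2)), ← mul_inv]
  gcongr

theorem measurable_G_cons_cons (m μ : ℝ) (n : ℕ) :
    Measurable fun p : (R3 × R3) × (Fin n → R3) =>
      G m μ (Fin.cons p.1.1 (Fin.cons p.1.2 p.2 : Fin (n + 1) → R3) : Fin (n + 2) → R3) :=
  (measurable_G μ).comp (measurable_cons (by fun_prop) (measurable_cons (by fun_prop) (by fun_prop)))

theorem integrable_offIntegrand {m : ℝ} (hm : 0 < m) {n : ℕ} {μ : ℝ} (hμ : 0 < μ)
    {ξ : L2 (n + 1)} (hξ : IsAntisymm ξ) (hd : Integrable (diagIntegrand m μ ξ)) :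
    Integrable (offIntegrand m μ ξ) := by
  have hr : 0 < 1 - (1 + m)⁻¹ := sub_pos.2 (inv_lt_one_of_one_lt₀ (by linarith))
  refine integrable_pair hm hμ hξ hd (measurable_G_cons_cons m μ n) (D := (1 - (1 + m)⁻¹)⁻¹)
    (by positivity) fun p => ?_
  rw [G_cons_cons hm hμ]
  exact inv_add_oddSymbol_le hm _ _ _ (effQ_pos hm hμ _)

/-- A crude two-sided bound, using only that G is dominated by a multiple of 1/E. It shows that
T_off tends to zero together with T_diag, as closedness requires. -/
theorem exists_abs_Toff_le {m : ℝ} (hm : 0 < m) :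
    ∃ C : ℝ, 0 ≤ C ∧ ∀ (n : ℕ) (μ : ℝ), 0 < μ → ∀ ξ : L2 (n + 1), IsAntisymm ξ →
      Integrable (diagIntegrand m μ ξ) → |Toff m μ ξ| ≤ C * Tdiag m μ ξ := by
  obtain ⟨C, hC0, hC⟩ := exists_lintegral_pair_le hm
  have hr : 0 < 1 - (1 + m)⁻¹ := sub_pos.2 (inv_lt_one_of_one_lt₀ (by linarith))
  set D := (1 - (1 + m)⁻¹)⁻¹ with hD
  have hD0 : 0 < D := by positivity
  refine ⟨D * C, by positivity, fun n μ hμ ξ hξ hd => ?_⟩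
  have hd0 := diagIntegrand_nonneg hm hμ ξ
  have hT0 : 0 ≤ Tdiag m μ ξ := integral_nonneg hd0
  have h1 : |Toff m μ ξ| ≤ ((n : ℝ) + 1) * ∫ p, ‖offIntegrand m μ ξ p‖ := by
    rw [Toff, abs_mul, abs_of_pos (by positivity)]
    gcongr
    exact (Complex.abs_re_le_norm _).trans (norm_integral_le_integral_norm _)
  refine h1.trans ((ENNReal.ofReal_le_ofReal_iff (by positivity)).1 ?_)
  rw [ENNReal.ofReal_mul (by positivity), ENNReal.ofReal_mul (by positivity),
    ENNReal.ofReal_mul hD0.le,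
    ofReal_integral_eq_lintegral_ofReal (integrable_offIntegrand hm hμ hξ hd).norm
      (.of_forall fun p => norm_nonneg _), Tdiag,
    ofReal_integral_eq_lintegral_ofReal hd (.of_forall hd0)]
  calc _ ≤ ENNReal.ofReal ((n : ℝ) + 1) * (ENNReal.ofReal D *
        ∫⁻ p : (R3 × R3) × (Fin n → R3), ENNReal.ofReal
        (‖hat ξ (Fin.cons p.1.1 p.2)‖ * ‖hat ξ (Fin.cons p.1.2 p.2)‖ *
          (evenSymbol m p.1.1 p.1.2 (∑ i, p.2 i) (effQ m μ p.2))⁻¹)) := by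
        refine mul_le_mul_right ?_ _
        rw [← lintegral_const_mul' _ _ ENNReal.ofReal_ne_top]
        refine lintegral_mono fun p => ?_
        rw [← ENNReal.ofReal_mul hD0.le]
        refine ENNReal.ofReal_le_ofReal ?_
        rw [offIntegrand, norm_mul, norm_mul, norm_star, Complex.norm_real, Real.norm_eq_abs,
          mul_left_comm, G_cons_cons hm hμ]
        gcongr
        exact inv_add_oddSymbol_le hm _ _ _ (effQ_pos hm hμ _)
    _ = ENNReal.ofReal D * (ENNReal.ofReal ((n : ℝ) + 1) *
        ∫⁻ p : (R3 × R3) × (Fin n → R3), ENNReal.ofReal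
        (‖hat ξ (Fin.cons p.1.1 p.2)‖ * ‖hat ξ (Fin.cons p.1.2 p.2)‖ *
          (evenSymbol m p.1.1 p.1.2 (∑ i, p.2 i) (effQ m μ p.2))⁻¹)) := by rw [mul_left_comm]
    _ ≤ ENNReal.ofReal D * (ENNReal.ofReal C * ∫⁻ q, ENNReal.ofReal (diagIntegrand m μ ξ q)) :=
        mul_le_mul_right (hC n μ hμ ξ hξ) _
    _ = _ := by rw [mul_assoc]

/-- From 1/(E + O) = E/(E² - O²) - O/(E² - O²): the even part has a non-negative form and is
discarded, and the odd part is at most Λ(m) T_diag in absolute value. Discarding the even part is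
why only a lower bound has the constant Λ(m). -/
theorem neg_Lam_mul_Tdiag_le_Toff {m : ℝ} (hm : 0 < m) {n : ℕ} {μ : ℝ} (hμ : 0 < μ)
    {ξ : L2 (n + 1)} (hξ : IsAntisymm ξ) (hd : Integrable (diagIntegrand m μ ξ)) :
    -(Lam m).toReal * Tdiag m μ ξ ≤ Toff m μ ξ := by
  have hd0 := diagIntegrand_nonneg hm hμ ξ
  have hT0 : 0 ≤ Tdiag m μ ξ := integral_nonneg hd0
  have hr1 : (1 + m)⁻¹ < 1 := inv_lt_one_of_one_lt₀ (by linarith)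
  have hr0 : 0 < (1 + m)⁻¹ := by positivity
  have hr2 : 0 < 1 - (1 + m)⁻¹ ^ 2 := by nlinarith
  set D := (1 - (1 + m)⁻¹ ^ 2)⁻¹ with hD
  have hD0 : 0 < D := by positivity
  let ev : (R3 × R3) × (Fin n → R3) → ℝ := fun p =>
    evenKernel m p.1.1 p.1.2 (∑ i, p.2 i) (effQ m μ p.2)
  let od : (R3 × R3) × (Fin n → R3) → ℝ := fun p =>
    oddSymbol m p.1.1 p.1.2 (∑ i, p.2 i) /
      (evenSymbol m p.1.1 p.1.2 (∑ i, p.2 i) (effQ m μ p.2) ^ 2 -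
        oddSymbol m p.1.1 p.1.2 (∑ i, p.2 i) ^ 2)
  have hQm : Measurable fun p : (R3 × R3) × (Fin n → R3) => effQ m μ p.2 :=
    (measurable_effQ m μ).comp measurable_snd
  have hK : Measurable fun p : (R3 × R3) × (Fin n → R3) => ∑ i, p.2 i := by fun_prop
  have h1 : Measurable fun p : (R3 × R3) × (Fin n → R3) => p.1.1 := by fun_prop
  have h2 : Measurable fun p : (R3 × R3) × (Fin n → R3) => p.1.2 := by fun_prop
  have hE := measurable_evenSymbol m h1 h2 hK hQm
  have hO := measurable_oddSymbol m h1 h2 hK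
  have hodabs : ∀ p, |od p| = oddKernel m p.1.1 p.1.2 (∑ i, p.2 i) (effQ m μ p.2) := by
    intro p
    simp only [od, oddKernel]
    rw [abs_div, abs_of_pos (sq_sub_sq_pos hm _ _ _ (effQ_pos hm hμ p.2))]
  have hevI := integrable_pair hm hμ hξ hd (k := ev) (hE.div ((hE.pow_const 2).sub
    (hO.pow_const 2))) hD0.le (fun p => by
      have hQ := effQ_pos hm hμ p.2
      have ha := evenSymbol_pos hm p.1.1 p.1.2 (∑ i, p.2 i) hQ
      simp only [ev]
      rw [abs_of_nonneg (evenKernel_nonneg hm _ _ _ hQ), evenKernel, hD, ← mul_inv, ← one_div]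
      have h3 : (1 - (1 + m)⁻¹ ^ 2) * evenSymbol m p.1.1 p.1.2 (∑ i, p.2 i) (effQ m μ p.2) ^ 2 ≤
          evenSymbol m p.1.1 p.1.2 (∑ i, p.2 i) (effQ m μ p.2) ^ 2 -
            oddSymbol m p.1.1 p.1.2 (∑ i, p.2 i) ^ 2 := by
        have := pow_le_pow_left₀ (abs_nonneg _)
          (abs_oddSymbol_le hm p.1.1 p.1.2 (∑ i, p.2 i) (effQ m μ p.2)) 2
        rw [sq_abs] at this
        nlinarith
      refine (div_le_div_of_nonneg_left ha.le (by positivity) h3).trans (le_of_eq ?_)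
      field_simp)
  have hodI := integrable_pair hm hμ hξ hd (k := od) (hO.div ((hE.pow_const 2).sub
    (hO.pow_const 2))) hD0.le (fun p => by
      rw [hodabs]
      exact oddKernel_le hm _ _ _ (effQ_pos hm hμ p.2))
  have hsplit : ∀ p, offIntegrand m μ ξ p =
      star (hat ξ (Fin.cons p.1.1 p.2)) * hat ξ (Fin.cons p.1.2 p.2) * (ev p : ℂ) -
      star (hat ξ (Fin.cons p.1.1 p.2)) * hat ξ (Fin.cons p.1.2 p.2) * (od p : ℂ) := by
    intro p
    rw [offIntegrand, ← mul_sub, ← Complex.ofReal_sub]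
    congr 2
    simp only [ev, od, evenKernel]
    have hQ := effQ_pos hm hμ p.2
    obtain ⟨h3, h4⟩ := abs_lt.1 (abs_oddSymbol_lt hm p.1.1 p.1.2 (∑ i, p.2 i) hQ)
    have h5 := (sq_sub_sq_pos hm p.1.1 p.1.2 (∑ i, p.2 i) hQ).ne'
    have h6 : evenSymbol m p.1.1 p.1.2 (∑ i, p.2 i) (effQ m μ p.2) +
      oddSymbol m p.1.1 p.1.2 (∑ i, p.2 i) ≠ 0 := by linarith
    rw [G_cons_cons hm hμ]
    field_simp
    ring
  have hevpos : 0 ≤ (∫ p : (R3 × R3) × (Fin n → R3), star (hat ξ (Fin.cons p.1.1 p.2)) *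
      hat ξ (Fin.cons p.1.2 p.2) * (ev p : ℂ)).re := by
    -- The even kernel acts on (s, t) with q as a parameter, so positivity is applied on almost
    -- every slice q and then integrated.
    rw [Measure.volume_eq_prod] at hevI ⊢
    rw [integral_prod_symm _ hevI]
    have hre := integral_re hevI.integral_prod_right
    change ∫ q : Fin n → R3, (∫ x : R3 × R3, star (hat ξ (Fin.cons x.1 q)) *
      hat ξ (Fin.cons x.2 q) * (ev (x, q) : ℂ)).re = _ at hre
    refine le_of_le_of_eq (integral_nonneg_of_ae ?_) hre
    filter_upwards [hevI.prod_left_ae] with q hq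
    exact re_integral_evenKernel_nonneg hm (∑ i, q i) (effQ_pos hm hμ q)
      (f := fun s => hat ξ (Fin.cons s q))
      ((measurable_hat ξ).comp (measurable_cons measurable_id measurable_const)) hq
  have hodle : ((n : ℝ) + 1) * |(∫ p : (R3 × R3) × (Fin n → R3),
      star (hat ξ (Fin.cons p.1.1 p.2)) * hat ξ (Fin.cons p.1.2 p.2) * (od p : ℂ)).re| ≤
      (Lam m).toReal * Tdiag m μ ξ := by
    have h3 := (Complex.abs_re_le_norm _).trans (norm_integral_le_integral_norm
      (μ := (volume : Measure ((R3 × R3) × (Fin n → R3)))) fun p =>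
      star (hat ξ (Fin.cons p.1.1 p.2)) * hat ξ (Fin.cons p.1.2 p.2) * (od p : ℂ))
    refine (mul_le_mul_of_nonneg_left h3 (by positivity)).trans
      ((ENNReal.ofReal_le_ofReal_iff (by positivity)).1 ?_)
    rw [ENNReal.ofReal_mul (by positivity), ENNReal.ofReal_mul (by positivity), Tdiag,
      ofReal_integral_eq_lintegral_ofReal hodI.norm (.of_forall fun p => norm_nonneg _),
      ofReal_integral_eq_lintegral_ofReal hd (.of_forall hd0)]
    refine le_trans (le_of_eq ?_) (lintegral_oddKernel_le hm hμ hξ)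
    congr 1
    refine lintegral_congr fun p => ?_
    rw [norm_mul, norm_mul, norm_star, Complex.norm_real, Real.norm_eq_abs, hodabs]
  rw [Toff, integral_congr_ae (.of_forall hsplit), integral_sub hevI hodI, Complex.sub_re, mul_sub]
  have h4 : 0 ≤ ((n : ℝ) + 1) * (∫ p : (R3 × R3) × (Fin n → R3),
      star (hat ξ (Fin.cons p.1.1 p.2)) * hat ξ (Fin.cons p.1.2 p.2) * (ev p : ℂ)).re := by
    positivity
  have h5 := le_abs_self (∫ p : (R3 × R3) × (Fin n → R3),
      star (hat ξ (Fin.cons p.1.1 p.2)) * hat ξ (Fin.cons p.1.2 p.2) * (od p : ℂ)).re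
  have h6 := mul_le_mul_of_nonneg_left h5 (by positivity : (0 : ℝ) ≤ (n : ℝ) + 1)
  linarith

/-! ### The antisymmetrized charge -/

/-- The `i`-th term of the sum defining the Fourier transform of `Gξ`. -/
def chargeTerm {k : ℕ} (ξ : L2 k) (i : Fin (k + 1)) (q : Fin (k + 1) → R3) : ℂ :=
  (-1) ^ (i : ℕ) * hat ξ (i.removeNth q)

/-- The antisymmetrized charge, so that `potentialHat = G * chargeSum`. -/
def chargeSum {k : ℕ} (ξ : L2 k) (q : Fin (k + 1) → R3) : ℂ := ∑ i, chargeTerm ξ i q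

theorem potentialHat_eq (m μ : ℝ) {k : ℕ} (ξ : L2 k) (q : Fin (k + 1) → R3) :
    potentialHat m μ ξ q = (G m μ q : ℂ) * chargeSum ξ q := rfl

theorem quasiMeasurePreserving_removeNth {k : ℕ} (i : Fin (k + 1)) :
    Measure.QuasiMeasurePreserving (fun q : Fin (k + 1) → R3 => i.removeNth q) volume volume :=
  Measure.quasiMeasurePreserving_snd.comp
    (volume_preserving_piFinSuccAbove (fun _ : Fin (k + 1) => R3) i).quasiMeasurePreserving

theorem measurable_chargeTerm {k : ℕ} (ξ : L2 k) (i : Fin (k + 1)) :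
    Measurable (chargeTerm ξ i) :=
  measurable_const.mul ((measurable_hat ξ).comp (quasiMeasurePreserving_removeNth i).measurable)

theorem measurable_chargeSum {k : ℕ} (ξ : L2 k) : Measurable (chargeSum ξ) :=
  Finset.measurable_fun_sum _ fun i _ => measurable_chargeTerm ξ i

theorem chargeTerm_sub {k : ℕ} (ξ η : L2 k) (i : Fin (k + 1)) :
    chargeTerm (ξ - η) i =ᵐ[volume] fun q => chargeTerm ξ i q - chargeTerm η i q := by
  filter_upwards [(quasiMeasurePreserving_removeNth i).ae (hat_sub ξ η)] with q hq
  simp only [chargeTerm]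
  rw [hq, mul_sub]

theorem chargeSum_sub {k : ℕ} (ξ η : L2 k) :
    chargeSum (ξ - η) =ᵐ[volume] fun q => chargeSum ξ q - chargeSum η q := by
  filter_upwards [ae_all_iff.2 (chargeTerm_sub ξ η)] with q hq
  simp only [chargeSum]
  rw [← Finset.sum_sub_distrib]
  exact Finset.sum_congr rfl fun i _ => hq i

/-- Deleting i and its image σ i from σ leaves a permutation of the remaining indices. Moving both
deleted indices to position 0 by cycles of signs (-1)^i and (-1)^{σ i} determines its sign. This
makes the alternating sum defining Gξ antisymmetric. -/
theorem exists_perm_succAbove {k : ℕ} (σ : Equiv.Perm (Fin (k + 1))) (i : Fin (k + 1)) :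
    ∃ τ : Equiv.Perm (Fin k), (∀ j, σ (i.succAbove j) = (σ i).succAbove (τ j)) ∧
      ((-1) ^ (i : ℕ) * ((Equiv.Perm.sign τ : ℤ) : ℂ)) =
        ((Equiv.Perm.sign σ : ℤ) : ℂ) * (-1) ^ ((σ i : Fin (k + 1)) : ℕ) := by
  -- This conjugate-like product fixes 0, so it comes from a permutation of the successors, which is
  -- the required τ.
  let ρ : Equiv.Perm (Fin (k + 1)) := (σ i).cycleRange * σ * i.cycleRange.symm
  have hρ0 : ρ 0 = 0 := by simp [ρ, Equiv.Perm.mul_apply, Fin.cycleRange_symm_zero]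
  obtain ⟨⟨p, τ⟩, hpτ⟩ := Equiv.Perm.decomposeFin.symm.surjective ρ
  have hp : p = 0 := by
    rw [← hρ0, ← hpτ, Equiv.Perm.decomposeFin_symm_apply_zero]
  subst hp
  have hsucc : ∀ j, ρ j.succ = (τ j).succ := by
    intro j
    rw [← hpτ, Equiv.Perm.decomposeFin_symm_apply_succ]
    simp
  have hsign : Equiv.Perm.sign ρ = Equiv.Perm.sign τ := by
    rw [← hpτ, Equiv.Perm.decomposeFin.symm_sign]
    simp
  refine ⟨τ, fun j => ?_, ?_⟩
  · have h := hsucc j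
    simp only [ρ, Equiv.Perm.mul_apply, Fin.cycleRange_symm_succ] at h
    rw [← Fin.cycleRange_symm_succ (σ i), ← h, Equiv.symm_apply_apply]
  · have h1 : Equiv.Perm.sign τ = (-1) ^ ((σ i : Fin (k + 1)) : ℕ) * Equiv.Perm.sign σ *
        (-1) ^ (i : ℕ) := by
      rw [← hsign]
      simp only [ρ, Equiv.Perm.sign_mul, Fin.sign_cycleRange, Equiv.Perm.sign_symm]
    rw [h1]
    push_cast
    have h2 : ((-1 : ℂ) ^ (i : ℕ)) * (-1) ^ (i : ℕ) = 1 := by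
      rw [← mul_pow]
      simp
    linear_combination ((Equiv.Perm.sign σ : ℤ) : ℂ) * (-1) ^ ((σ i : Fin (k + 1)) : ℕ) * h2

theorem chargeTerm_perm {k : ℕ} {ξ : L2 k} (hξ : IsAntisymm ξ) (σ : Equiv.Perm (Fin (k + 1)))
    (i : Fin (k + 1)) : ∀ᵐ q, chargeTerm ξ i (q ∘ σ) =
      ((Equiv.Perm.sign σ : ℤ) : ℂ) * chargeTerm ξ (σ i) q := by
  obtain ⟨τ, hτ, hs⟩ := exists_perm_succAbove σ i
  filter_upwards [(quasiMeasurePreserving_removeNth (σ i)).ae ((isAntisymm_iff_hat ξ).1 hξ τ)]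
    with q hq
  have h1 : i.removeNth (q ∘ σ) = (σ i).removeNth q ∘ τ := by
    ext1 j
    simp only [Fin.removeNth, Function.comp_apply, hτ]
  simp only [chargeTerm]
  rw [h1, hq, ← mul_assoc, hs, mul_assoc]

theorem chargeSum_perm {k : ℕ} {ξ : L2 k} (hξ : IsAntisymm ξ) (σ : Equiv.Perm (Fin (k + 1))) :
    ∀ᵐ q, chargeSum ξ (q ∘ σ) = ((Equiv.Perm.sign σ : ℤ) : ℂ) * chargeSum ξ q := by
  filter_upwards [ae_all_iff.2 (chargeTerm_perm hξ σ)] with q hq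
  simp only [chargeSum]
  rw [Finset.sum_congr rfl (fun i _ => hq i), ← Finset.mul_sum,
    Equiv.sum_comp σ (fun i => chargeTerm ξ i q)]

/-- The sesquilinear density of two terms. -/
def crossTerm {k : ℕ} (V : (Fin (k + 1) → R3) → ℝ) (ξ : L2 k) (i j : Fin (k + 1))
    (q : Fin (k + 1) → R3) : ℂ :=
  star (chargeTerm ξ i q) * chargeTerm ξ j q * (V q : ℂ)

theorem crossTerm_perm {k : ℕ} {V : (Fin (k + 1) → R3) → ℝ}
    (hV : ∀ (σ : Equiv.Perm (Fin (k + 1))) q, V (q ∘ σ) = V q) {ξ : L2 k} (hξ : IsAntisymm ξ)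
    (σ : Equiv.Perm (Fin (k + 1))) (i j : Fin (k + 1)) :
    ∀ᵐ q, crossTerm V ξ i j (q ∘ σ) = crossTerm V ξ (σ i) (σ j) q := by
  filter_upwards [chargeTerm_perm hξ σ i, chargeTerm_perm hξ σ j] with q h1 h2
  simp only [crossTerm]
  rw [h1, h2, hV]
  have h3 : star ((Equiv.Perm.sign σ : ℤ) : ℂ) * ((Equiv.Perm.sign σ : ℤ) : ℂ) = 1 := by
    rcases Int.units_eq_one_or (Equiv.Perm.sign σ) with h | h <;> simp [h]
  rw [star_mul']
  linear_combination star (chargeTerm ξ (σ i) q) * chargeTerm ξ (σ j) q * (V q : ℂ) * h3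

theorem integrable_crossTerm_perm {k : ℕ} {V : (Fin (k + 1) → R3) → ℝ}
    (hV : ∀ (σ : Equiv.Perm (Fin (k + 1))) q, V (q ∘ σ) = V q) {ξ : L2 k} (hξ : IsAntisymm ξ)
    (σ : Equiv.Perm (Fin (k + 1))) {i j : Fin (k + 1)} (h : Integrable (crossTerm V ξ i j)) :
    Integrable (crossTerm V ξ (σ i) (σ j)) ∧
      ∫ q, crossTerm V ξ (σ i) (σ j) q = ∫ q, crossTerm V ξ i j q := by
  have h1 := crossTerm_perm hV hξ σ i j
  constructor
  · exact ((measurePreserving_perm σ).integrable_comp_of_integrable h).congr h1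
  · rw [← (measurePreserving_perm σ).integral_comp (measurableEmbedding_perm σ)
      (crossTerm V ξ i j)]
    exact (integral_congr_ae h1).symm

/-- Permutations act transitively on ordered pairs, so all off-diagonal cross terms reduce to the
pair (1, 0). -/
theorem exists_perm_pair {n : ℕ} {i j : Fin (n + 2)} (h : i ≠ j) :
    ∃ σ : Equiv.Perm (Fin (n + 2)), σ 1 = i ∧ σ 0 = j := by
  refine ⟨Equiv.swap (Equiv.swap 0 j 1) i * Equiv.swap 0 j, ?_, ?_⟩
  · simp [Equiv.Perm.mul_apply]
  · rw [Equiv.Perm.mul_apply, Equiv.swap_apply_left, Equiv.swap_apply_of_ne_of_ne _ h.symm]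
    intro h1
    have h2 : Equiv.swap 0 j 0 = Equiv.swap 0 j (1 : Fin (n + 2)) := by
      rw [Equiv.swap_apply_left]
      exact h1
    exact absurd ((Equiv.swap 0 j).injective h2) (by simp)

theorem measurePreserving_cons_cons (n : ℕ) :
    MeasurePreserving (fun p : (R3 × R3) × (Fin n → R3) =>
      (Fin.cons p.1.1 (Fin.cons p.1.2 p.2 : Fin (n + 1) → R3) : Fin (n + 2) → R3)) :=
  (measurePreserving_cons (n + 1)).comp
    (((MeasurePreserving.id (volume : Measure R3)).prod (measurePreserving_cons n)).comp
      (measurePreserving_prodAssoc (volume : Measure R3) (volume : Measure R3)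
        (volume : Measure (Fin n → R3))))

theorem measurableEmbedding_cons_cons (n : ℕ) :
    MeasurableEmbedding (fun p : (R3 × R3) × (Fin n → R3) =>
      (Fin.cons p.1.1 (Fin.cons p.1.2 p.2 : Fin (n + 1) → R3) : Fin (n + 2) → R3)) :=
  (measurableEmbedding_cons (n + 1)).comp
    ((MeasurableEmbedding.id.prodMap (measurableEmbedding_cons n)).comp
      MeasurableEquiv.prodAssoc.measurableEmbedding)

/-- Deleting index 1 from (s, t, q) leaves (s, q), and deleting index 0 leaves (t, q); the signs
(-1)¹ and (-1)⁰ give the minus. -/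
theorem crossTerm_one_zero_cons {n : ℕ} (V : (Fin (n + 2) → R3) → ℝ) (ξ : L2 (n + 1))
    (p : (R3 × R3) × (Fin n → R3)) :
    crossTerm V ξ 1 0 (Fin.cons p.1.1 (Fin.cons p.1.2 p.2 : Fin (n + 1) → R3)) =
      -(star (hat ξ (Fin.cons p.1.1 p.2)) * hat ξ (Fin.cons p.1.2 p.2) *
        (V (Fin.cons p.1.1 (Fin.cons p.1.2 p.2 : Fin (n + 1) → R3)) : ℂ)) := by
  have h0 : (0 : Fin (n + 2)).removeNth
      (Fin.cons p.1.1 (Fin.cons p.1.2 p.2 : Fin (n + 1) → R3) : Fin (n + 2) → R3) =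
      (Fin.cons p.1.2 p.2 : Fin (n + 1) → R3) := by
    ext1 j
    simp [Fin.removeNth]
  have h1 : (1 : Fin (n + 2)).removeNth
      (Fin.cons p.1.1 (Fin.cons p.1.2 p.2 : Fin (n + 1) → R3) : Fin (n + 2) → R3) =
      (Fin.cons p.1.1 p.2 : Fin (n + 1) → R3) := by
    ext1 j
    refine Fin.cases ?_ (fun j => ?_) j
    · simp [Fin.removeNth]
    · simp [Fin.removeNth, Fin.one_succAbove_succ]
  simp only [crossTerm, chargeTerm]
  rw [h0, h1]
  simp

theorem integrable_crossTerm_of_ne {n : ℕ} {V : (Fin (n + 2) → R3) → ℝ}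
    (hV : ∀ (σ : Equiv.Perm (Fin (n + 2))) q, V (q ∘ σ) = V q) {ξ : L2 (n + 1)}
    (hξ : IsAntisymm ξ)
    (h : Integrable fun p : (R3 × R3) × (Fin n → R3) =>
      star (hat ξ (Fin.cons p.1.1 p.2)) * hat ξ (Fin.cons p.1.2 p.2) *
        (V (Fin.cons p.1.1 (Fin.cons p.1.2 p.2 : Fin (n + 1) → R3)) : ℂ))
    {i j : Fin (n + 2)} (hij : i ≠ j) :
    Integrable (crossTerm V ξ i j) ∧
      ∫ q, crossTerm V ξ i j q = -∫ p : (R3 × R3) × (Fin n → R3),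
        star (hat ξ (Fin.cons p.1.1 p.2)) * hat ξ (Fin.cons p.1.2 p.2) *
          (V (Fin.cons p.1.1 (Fin.cons p.1.2 p.2 : Fin (n + 1) → R3)) : ℂ) := by
  obtain ⟨σ, rfl, rfl⟩ := exists_perm_pair hij
  have hI : Integrable (crossTerm V ξ 1 0) := by
    rw [← (measurePreserving_cons_cons n).integrable_comp_emb (measurableEmbedding_cons_cons n)]
    exact h.neg.congr (.of_forall fun p => (crossTerm_one_zero_cons V ξ p).symm)
  obtain ⟨h1, h2⟩ := integrable_crossTerm_perm hV hξ σ hI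
  refine ⟨h1, ?_⟩
  rw [h2, ← (measurePreserving_cons_cons n).integral_comp (measurableEmbedding_cons_cons n),
    ← integral_neg]
  exact integral_congr_ae (.of_forall fun p => crossTerm_one_zero_cons V ξ p)

theorem crossTerm_self {k : ℕ} (V : (Fin (k + 1) → R3) → ℝ) (ξ : L2 k) (i : Fin (k + 1))
    (q : Fin (k + 1) → R3) :
    crossTerm V ξ i i q = ((‖chargeTerm ξ i q‖ ^ 2 * V q : ℝ) : ℂ) := by
  simp only [crossTerm]
  rw [Complex.star_def, mul_comm ((starRingEnd ℂ) _), Complex.mul_conj, Complex.normSq_eq_norm_sq]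
  push_cast
  ring

theorem sum_crossTerm {k : ℕ} (V : (Fin (k + 1) → R3) → ℝ) (ξ : L2 k)
    (q : Fin (k + 1) → R3) :
    ∑ i, ∑ j, crossTerm V ξ i j q = ((‖chargeSum ξ q‖ ^ 2 * V q : ℝ) : ℂ) := by
  have h : ((‖chargeSum ξ q‖ ^ 2 * V q : ℝ) : ℂ) =
      star (chargeSum ξ q) * chargeSum ξ q * (V q : ℂ) := by
    rw [Complex.star_def, mul_comm ((starRingEnd ℂ) _), Complex.mul_conj,
      Complex.normSq_eq_norm_sq]
    push_cast
    ring
  rw [h]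
  simp only [chargeSum, crossTerm, star_sum, Finset.sum_mul, Finset.mul_sum]
  exact Finset.sum_comm

/-- Expansion of the weighted norm of the antisymmetrized charge. -/
theorem integral_norm_chargeSum_sq {n : ℕ} {V : (Fin (n + 2) → R3) → ℝ}
    (hV : ∀ (σ : Equiv.Perm (Fin (n + 2))) q, V (q ∘ σ) = V q) {ξ : L2 (n + 1)}
    (hξ : IsAntisymm ξ)
    (h : Integrable fun p : (R3 × R3) × (Fin n → R3) =>
      star (hat ξ (Fin.cons p.1.1 p.2)) * hat ξ (Fin.cons p.1.2 p.2) *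
        (V (Fin.cons p.1.1 (Fin.cons p.1.2 p.2 : Fin (n + 1) → R3)) : ℂ))
    (h0 : Integrable fun q => ‖chargeTerm ξ 0 q‖ ^ 2 * V q) :
    Integrable (fun q => ‖chargeSum ξ q‖ ^ 2 * V q) ∧
      ∫ q, ‖chargeSum ξ q‖ ^ 2 * V q =
        ((n : ℝ) + 2) * (∫ q, ‖chargeTerm ξ 0 q‖ ^ 2 * V q) -
          ((n : ℝ) + 2) * (((n : ℝ) + 1) * (∫ p : (R3 × R3) × (Fin n → R3),
            star (hat ξ (Fin.cons p.1.1 p.2)) * hat ξ (Fin.cons p.1.2 p.2) *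
              (V (Fin.cons p.1.1 (Fin.cons p.1.2 p.2 : Fin (n + 1) → R3)) : ℂ)).re) := by
  set I := ∫ p : (R3 × R3) × (Fin n → R3),
            star (hat ξ (Fin.cons p.1.1 p.2)) * hat ξ (Fin.cons p.1.2 p.2) *
              (V (Fin.cons p.1.1 (Fin.cons p.1.2 p.2 : Fin (n + 1) → R3)) : ℂ) with hI
  set D := ∫ q, ‖chargeTerm ξ 0 q‖ ^ 2 * V q with hD
  have h00 : Integrable (crossTerm V ξ 0 0) :=
    h0.ofReal.congr (.of_forall fun q => (crossTerm_self V ξ 0 q).symm)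
  have h00i : ∫ q, crossTerm V ξ 0 0 q = (D : ℂ) := by
    simp_rw [crossTerm_self]
    rw [integral_complex_ofReal]
  have hdiag : ∀ i, Integrable (crossTerm V ξ i i) ∧ ∫ q, crossTerm V ξ i i q = (D : ℂ) := by
    intro i
    have := integrable_crossTerm_perm hV hξ (Equiv.swap 0 i) h00
    rwa [Equiv.swap_apply_left, h00i] at this
  have hall : ∀ i j, Integrable (crossTerm V ξ i j) ∧
      ∫ q, crossTerm V ξ i j q = if i = j then (D : ℂ) else -I := by
    intro i j
    split_ifs with hij
    · subst hij
      exact hdiag i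
    · exact integrable_crossTerm_of_ne hV hξ h hij
  have hsumI : Integrable fun q => ∑ i, ∑ j, crossTerm V ξ i j q :=
    integrable_finsetSum _ fun i _ => integrable_finsetSum _ fun j _ => (hall i j).1
  have hsum : ∫ q, ∑ i, ∑ j, crossTerm V ξ i j q =
      ((n : ℂ) + 2) * (D : ℂ) - ((n : ℂ) + 2) * (((n : ℂ) + 1) * I) := by
    rw [integral_finsetSum _ fun i _ => integrable_finsetSum _ fun j _ => (hall i j).1]
    have h1 : ∀ i : Fin (n + 2), ∫ q, ∑ j, crossTerm V ξ i j q = D - ((n : ℂ) + 1) * I := by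
      intro i
      rw [integral_finsetSum _ fun j _ => (hall i j).1, Finset.sum_congr rfl fun j _ => (hall i j).2,
        Finset.sum_ite]
      rw [Finset.sum_const, Finset.sum_const, Finset.filter_ne, Finset.card_erase_of_mem
        (Finset.mem_univ _)]
      simp [Finset.filter_eq]
      ring
    rw [Finset.sum_congr rfl fun i _ => h1 i]
    simp only [Finset.sum_const, Finset.card_univ, Fintype.card_fin, nsmul_eq_mul]
    push_cast
    ring
  simp_rw [sum_crossTerm] at hsumI hsum
  rw [integral_complex_ofReal] at hsum
  refine ⟨?_, ?_⟩
  · exact hsumI.re.congr (.of_forall fun q => Complex.ofReal_re _)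
  · have := congrArg Complex.re hsum
    simp only [Complex.ofReal_re, Complex.sub_re, Complex.mul_re, Complex.add_re,
      Complex.natCast_re, Complex.re_ofNat, Complex.add_im, Complex.natCast_im, Complex.im_ofNat,
      Complex.one_re, Complex.one_im, Complex.ofReal_im, Complex.mul_im] at this
    linarith

/-! ### Uniqueness of the decomposition and independence of `μ` -/

theorem G_perm {m : ℝ} (hm : 0 < m) (μ : ℝ) {k : ℕ} (σ : Equiv.Perm (Fin k))
    (q : Fin k → R3) : G m μ (q ∘ σ) = G m μ q := by
  rw [G, G, symbol_perm hm]

theorem G_pos {m μ : ℝ} (hm : 0 < m) (hμ : 0 < μ) {k : ℕ} (q : Fin k → R3) : 0 < G m μ q :=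
  inv_pos.2 (symbol_pos hm hμ q)

theorem symbol_sub (m μ μ' : ℝ) {k : ℕ} (q : Fin k → R3) :
    symbol m μ' q = symbol m μ q + (μ' - μ) := by
  simp only [symbol]
  ring

theorem chargeTerm_zero_cons {k : ℕ} (ξ : L2 k) (x : R3) (q : Fin k → R3) :
    chargeTerm ξ 0 (Fin.cons x q) = hat ξ q := by
  have h0 : (0 : Fin (k + 1)).removeNth (Fin.cons x q : Fin (k + 1) → R3) = q := by
    ext1 j
    simp [Fin.removeNth]
  simp only [chargeTerm]
  rw [h0]
  simp

theorem G_cons {m μ : ℝ} (hm : 0 < m) (hμ : 0 < μ) {k : ℕ} (x : R3) (q : Fin k → R3) :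
    G m μ (Fin.cons x q : Fin (k + 1) → R3) =
      (‖x + (m + 1)⁻¹ • ∑ i, q i‖ ^ 2 + (L m μ q / (2 * Real.pi ^ 2)) ^ 2)⁻¹ := by
  rw [G, symbol_cons hm hμ]

/-- After completing the square in x this is the radial integral of a difference of resolvents, with
parameters L_μ/(2π²) and L_μ'/(2π²). -/
theorem integral_G_sub_G {m : ℝ} (hm : 0 < m) {μ μ' : ℝ} (hμ : 0 < μ) (hμ' : 0 < μ')
    {k : ℕ} (q : Fin k → R3) :
    Integrable (fun x : R3 => G m μ (Fin.cons x q : Fin (k + 1) → R3) -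
        G m μ' (Fin.cons x q : Fin (k + 1) → R3)) ∧
      ∫ x : R3, (G m μ (Fin.cons x q : Fin (k + 1) → R3) -
        G m μ' (Fin.cons x q : Fin (k + 1) → R3)) = L m μ' q - L m μ q := by
  have h1 := L_pos hm hμ q
  have h2 := L_pos hm hμ' q
  have h := integral_inv_sub_inv (a := L m μ q / (2 * Real.pi ^ 2))
    (b := L m μ' q / (2 * Real.pi ^ 2)) (by positivity) (by positivity) ((m + 1)⁻¹ • ∑ i, q i)
  simp only [G_cons hm hμ, G_cons hm hμ']
  refine ⟨h.1, h.2.trans ?_⟩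
  field_simp

theorem G_le_G {m : ℝ} (hm : 0 < m) {μ μ' : ℝ} (hμ : 0 < μ) (h : μ ≤ μ') {k : ℕ}
    (q : Fin k → R3) : G m μ' q ≤ G m μ q := by
  have := symbol_pos hm hμ q
  rw [G, G]
  gcongr
  rw [symbol_sub m μ μ']
  linarith

/-- The term with index 0 does not depend on the momentum x in position 0, so G_μ - G_μ' can be
integrated over x first. The assumption μ ≤ μ' makes all integrands non-negative. -/
theorem integral_chargeTerm_zero_sq {m : ℝ} (hm : 0 < m) {μ μ' : ℝ} (hμ : 0 < μ) (h : μ ≤ μ')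
    {k : ℕ} {ξ : L2 k} (hξ : Integrable (diagIntegrand m μ ξ))
    (hξ' : Integrable (diagIntegrand m μ' ξ)) :
    Integrable (fun q => ‖chargeTerm ξ 0 q‖ ^ 2 * (G m μ q - G m μ' q)) ∧
      ∫ q, ‖chargeTerm ξ 0 q‖ ^ 2 * (G m μ q - G m μ' q) = Tdiag m μ' ξ - Tdiag m μ ξ := by
  have hμ' := hμ.trans_le h
  have hVm : Measurable fun q : Fin (k + 1) → R3 => G m μ q - G m μ' q :=
    (measurable_G μ).sub (measurable_G μ')
  have hm1 : Measurable fun q => ‖chargeTerm ξ 0 q‖ ^ 2 * (G m μ q - G m μ' q) :=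
    ((measurable_chargeTerm ξ 0).norm.pow_const 2).mul hVm
  have hV0 : ∀ q : Fin (k + 1) → R3, 0 ≤ G m μ q - G m μ' q := fun q =>
    sub_nonneg.2 (G_le_G hm hμ h q)
  have h0 : ∀ q, 0 ≤ ‖chargeTerm ξ 0 q‖ ^ 2 * (G m μ q - G m μ' q) := fun q =>
    mul_nonneg (by positivity) (hV0 q)
  have hL0 : ∀ q : Fin k → R3, 0 ≤ L m μ' q - L m μ q := fun q => by
    rw [← (integral_G_sub_G hm hμ hμ' q).2]
    exact integral_nonneg fun x => hV0 _
  have hdiff : Integrable fun q => diagIntegrand m μ' ξ q - diagIntegrand m μ ξ q := hξ'.sub hξ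
  have hd0 : ∀ q, 0 ≤ diagIntegrand m μ' ξ q - diagIntegrand m μ ξ q := fun q => by
    rw [diagIntegrand, diagIntegrand, ← mul_sub]
    exact mul_nonneg (by positivity) (hL0 q)
  have hlin : ∫⁻ q, ENNReal.ofReal (‖chargeTerm ξ 0 q‖ ^ 2 * (G m μ q - G m μ' q)) =
      ENNReal.ofReal (Tdiag m μ' ξ - Tdiag m μ ξ) := by
    rw [Tdiag, Tdiag, ← integral_sub hξ' hξ,
      ofReal_integral_eq_lintegral_ofReal hdiff (.of_forall hd0),
      lintegral_cons hm1.ennreal_ofReal]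
    refine lintegral_congr fun q => ?_
    obtain ⟨h1, h2⟩ := integral_G_sub_G hm hμ hμ' q
    simp only [chargeTerm_zero_cons, ENNReal.ofReal_mul (sq_nonneg ‖hat ξ q‖)]
    rw [lintegral_const_mul' _ _ ENNReal.ofReal_ne_top,
      ← ofReal_integral_eq_lintegral_ofReal h1 (.of_forall fun x => hV0 _), h2,
      ← ENNReal.ofReal_mul (by positivity), diagIntegrand, diagIntegrand, mul_sub]
  refine ⟨⟨hm1.aestronglyMeasurable, ?_⟩, ?_⟩
  · rw [hasFiniteIntegral_iff_ofReal (.of_forall h0), hlin]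
    exact ENNReal.ofReal_lt_top
  · rw [integral_eq_lintegral_of_nonneg_ae (.of_forall h0) hm1.aestronglyMeasurable, hlin,
      ENNReal.toReal_ofReal]
    rw [Tdiag, Tdiag, ← integral_sub hξ' hξ]
    exact integral_nonneg hd0

/-- Expanding the square, the diagonal terms yield the change of T_diag and the cross terms, with
their minus sign, that of T_off. -/
theorem integral_chargeSum_sq_of_le {m : ℝ} (hm : 0 < m) {μ μ' : ℝ} (hμ : 0 < μ) (h : μ ≤ μ')
    {n : ℕ} {ξ : L2 (n + 1)} (hξ : ξ ∈ sobolevAs (1 / 2) (n + 1)) :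
    Integrable (fun q => ‖chargeSum ξ q‖ ^ 2 * (G m μ q - G m μ' q)) ∧
      ∫ q, ‖chargeSum ξ q‖ ^ 2 * (G m μ q - G m μ' q) =
        ((n : ℝ) + 2) * (Tdiag m μ' ξ + Toff m μ' ξ - Tdiag m μ ξ - Toff m μ ξ) := by
  have hμ' := hμ.trans_le h
  have h1 := ((mem_sobolevAs_half_iff hm hμ ξ).1 hξ).2
  have h2 := ((mem_sobolevAs_half_iff hm hμ' ξ).1 hξ).2
  obtain ⟨h3, h4⟩ := integral_chargeTerm_zero_sq hm hμ h h1 h2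
  have h5 := integrable_offIntegrand hm hμ hξ.1 h1
  have h6 := integrable_offIntegrand hm hμ' hξ.1 h2
  have h7 : ∀ p : (R3 × R3) × (Fin n → R3), offIntegrand m μ ξ p - offIntegrand m μ' ξ p =
      star (hat ξ (Fin.cons p.1.1 p.2)) * hat ξ (Fin.cons p.1.2 p.2) *
        ((G m μ (Fin.cons p.1.1 (Fin.cons p.1.2 p.2 : Fin (n + 1) → R3) : Fin (n + 2) → R3) -
          G m μ' (Fin.cons p.1.1 (Fin.cons p.1.2 p.2 : Fin (n + 1) → R3) : Fin (n + 2) → R3) :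
          ℝ) : ℂ) := by
    intro p
    simp only [offIntegrand]
    push_cast
    ring
  have h8 := (h5.sub h6).congr (.of_forall h7)
  obtain ⟨h9, h10⟩ := integral_norm_chargeSum_sq
    (V := fun q : Fin (n + 2) → R3 => G m μ q - G m μ' q)
    (fun σ q => by simp only [G_perm hm]) hξ.1 h8 h3
  refine ⟨h9, h10.trans ?_⟩
  rw [h4, ← integral_congr_ae (.of_forall h7), integral_sub h5 h6, Complex.sub_re, Toff, Toff]
  ring

theorem integral_chargeSum_sq {m : ℝ} (hm : 0 < m) {μ μ' : ℝ} (hμ : 0 < μ) (hμ' : 0 < μ')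
    {n : ℕ} {ξ : L2 (n + 1)} (hξ : ξ ∈ sobolevAs (1 / 2) (n + 1)) :
    Integrable (fun q => ‖chargeSum ξ q‖ ^ 2 * (G m μ q - G m μ' q)) ∧
      ∫ q, ‖chargeSum ξ q‖ ^ 2 * (G m μ q - G m μ' q) =
        ((n : ℝ) + 2) * (Tdiag m μ' ξ + Toff m μ' ξ - Tdiag m μ ξ - Toff m μ ξ) := by
  rcases le_total μ μ' with h | h
  · exact integral_chargeSum_sq_of_le hm hμ h hξ
  · obtain ⟨h1, h2⟩ := integral_chargeSum_sq_of_le hm hμ' h hξ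
    have h3 : ∀ q, -(‖chargeSum ξ q‖ ^ 2 * (G m μ' q - G m μ q)) =
        ‖chargeSum ξ q‖ ^ 2 * (G m μ q - G m μ' q) := fun q => by ring
    refine ⟨h1.neg.congr (.of_forall h3), ?_⟩
    rw [← integral_congr_ae (.of_forall h3), integral_neg, h2]
    ring

theorem mem_sobolevAs_sub {r : ℝ} {k : ℕ} {f g : L2 k} (hf : f ∈ sobolevAs r k)
    (hg : g ∈ sobolevAs r k) : f - g ∈ sobolevAs r k := by
  refine ⟨hf.1.sub hg.1, ?_⟩
  have h := hf.2.sub hg.2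
  rw [← Lp.toTemperedDistributionCLM_apply, ← Lp.toTemperedDistributionCLM_apply, ← map_sub] at h
  exact h

theorem IsDecomp.sub {m μ : ℝ} {n : ℕ} {u w u' w' : L2 (n + 2)} {ξ ξ' : L2 (n + 1)}
    (h : IsDecomp m μ u w ξ) (h' : IsDecomp m μ u' w' ξ') :
    IsDecomp m μ (u - u') (w - w') (ξ - ξ') := by
  refine ⟨mem_sobolevAs_sub h.1 h'.1, mem_sobolevAs_sub h.2.1 h'.2.1, ?_⟩
  have h1 : u - u' - (w - w') = (u - w) - (u' - w') := by abel
  rw [h1]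
  filter_upwards [hat_sub (u - w) (u' - w'), h.2.2, h'.2.2, chargeSum_sub ξ ξ'] with q h2 h3 h4 h5
  rw [h2, h3, h4, potentialHat_eq, potentialHat_eq, potentialHat_eq, h5, mul_sub]

/-- For fixed q the integral over the momentum x in position 0 is |ξ̂(q)|² times a divergent
integral, hence infinite wherever ξ̂(q) ≠ 0. -/
theorem eq_zero_of_integrable_chargeTerm {m μ : ℝ} (hm : 0 < m) (hμ : 0 < μ) {k : ℕ} {ξ : L2 k}
    (h : Integrable fun q => ‖chargeTerm ξ 0 q‖ ^ 2 * G m μ q) : ξ = 0 := by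
  have hm1 : Measurable fun q => ‖chargeTerm ξ 0 q‖ ^ 2 * G m μ q :=
    ((measurable_chargeTerm ξ 0).norm.pow_const 2).mul (measurable_G μ)
  have h1 := h.2
  rw [hasFiniteIntegral_iff_ofReal (.of_forall fun q =>
    mul_nonneg (by positivity) (G_pos hm hμ q).le), lintegral_cons hm1.ennreal_ofReal] at h1
  have h2 : ∀ q : Fin k → R3, ∫⁻ x : R3, ENNReal.ofReal
      (‖chargeTerm ξ 0 (Fin.cons x q)‖ ^ 2 * G m μ (Fin.cons x q : Fin (k + 1) → R3)) =
      ENNReal.ofReal (‖hat ξ q‖ ^ 2) * ⊤ := by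
    intro q
    have h3 := L_pos hm hμ q
    simp only [chargeTerm_zero_cons, ENNReal.ofReal_mul (sq_nonneg ‖hat ξ q‖), G_cons hm hμ]
    rw [lintegral_const_mul' _ _ ENNReal.ofReal_ne_top,
      lintegral_inv_norm_add_sq_add (by positivity)]
  simp_rw [h2] at h1
  have h3 := ae_lt_top (by
    have := (measurable_hat ξ).norm
    fun_prop) h1.ne
  have h4 : ∫ q, ‖hat ξ q‖ ^ 2 = 0 := by
    refine integral_eq_zero_of_ae ?_
    filter_upwards [h3] with q hq
    by_contra hne
    rw [ENNReal.mul_top] at hq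
    · exact lt_irrefl _ hq
    · refine (ENNReal.ofReal_pos.2 (lt_of_le_of_ne (by positivity) (Ne.symm hne))).ne'
  rw [integral_norm_hat_sq] at h4
  exact norm_eq_zero.1 (by simpa using h4)

/-- If w = -Gξ lies in H¹, then G times the squared charge sum is integrable. The cross terms are
integrable for every ξ in H^{1/2}, so the diagonal terms must be too, which forces ξ = 0. -/
theorem IsDecomp.eq_zero {m μ : ℝ} (hm : 0 < m) (hμ : 0 < μ) {n : ℕ} {w : L2 (n + 2)}
    {ξ : L2 (n + 1)} (h : IsDecomp m μ 0 w ξ) : w = 0 ∧ ξ = 0 := by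
  obtain ⟨hw, hξ, he⟩ := h
  have hwI := ((mem_sobolevAs_one_iff hm hμ w).1 hw).2
  have hd := ((mem_sobolevAs_half_iff hm hμ ξ).1 hξ).2
  rw [zero_sub] at he
  have hae : ∀ᵐ q, hat w q = -((G m μ q : ℂ) * chargeSum ξ q) := by
    filter_upwards [he, hat_neg w] with q h1 h2
    rw [h2, potentialHat_eq] at h1
    rw [← h1, neg_neg]
  have hZ : Integrable fun q => ‖chargeSum ξ q‖ ^ 2 * G m μ q := by
    refine hwI.congr ?_
    filter_upwards [hae] with q hq
    have hs := symbol_pos hm hμ q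
    rw [hq, norm_neg, norm_mul, Complex.norm_real, Real.norm_of_nonneg (G_pos hm hμ q).le, G]
    field_simp
  have hoff := integrable_offIntegrand hm hμ hξ.1 hd
  have hcross : ∀ i j : Fin (n + 2), i ≠ j → Integrable (crossTerm (G m μ) ξ i j) :=
    fun i j hij => (integrable_crossTerm_of_ne (fun σ q => G_perm hm μ σ q) hξ.1 hoff hij).1
  have hdiag : Integrable fun q => ∑ i, ‖chargeTerm ξ i q‖ ^ 2 * G m μ q := by
    have h1 : Integrable fun q => ((‖chargeSum ξ q‖ ^ 2 * G m μ q : ℝ) : ℂ) -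
        ∑ i, ∑ j ∈ Finset.univ.erase i, crossTerm (G m μ) ξ i j q :=
      hZ.ofReal.sub (integrable_finsetSum _ fun i _ => integrable_finsetSum _ fun j hj =>
        hcross i j (Finset.ne_of_mem_erase hj).symm)
    have h2 : ∀ q, ((‖chargeSum ξ q‖ ^ 2 * G m μ q : ℝ) : ℂ) -
        ∑ i, ∑ j ∈ Finset.univ.erase i, crossTerm (G m μ) ξ i j q =
        ((∑ i, ‖chargeTerm ξ i q‖ ^ 2 * G m μ q : ℝ) : ℂ) := by
      intro q
      rw [← sum_crossTerm, ← Finset.sum_sub_distrib]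
      push_cast
      refine Finset.sum_congr rfl fun i _ => ?_
      rw [← Finset.add_sum_erase _ _ (Finset.mem_univ i), add_sub_cancel_right, crossTerm_self]
      push_cast
      ring
    exact (h1.congr (.of_forall h2)).re.congr (.of_forall fun q => Complex.ofReal_re _)
  have h0 : Integrable fun q => ‖chargeTerm ξ 0 q‖ ^ 2 * G m μ q := by
    refine hdiag.mono' (((measurable_chargeTerm ξ 0).norm.pow_const 2).mul
      (measurable_G μ)).aestronglyMeasurable (.of_forall fun q => ?_)
    have hG := G_pos hm hμ q
    rw [Real.norm_of_nonneg (by positivity)]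
    exact Finset.single_le_sum (f := fun i => ‖chargeTerm ξ i q‖ ^ 2 * G m μ q)
      (fun i _ => by positivity) (Finset.mem_univ 0)
  have hξ0 := eq_zero_of_integrable_chargeTerm hm hμ h0
  refine ⟨?_, hξ0⟩
  have hz := chargeSum_sub ξ ξ
  apply eq_of_hat_ae_eq
  filter_upwards [hae, hz, hat_sub w w] with q h1 h2 h3
  simp only [sub_self] at h2 h3
  rw [h1, hξ0, h2, h3]
  simp

theorem IsDecomp.unique {m μ : ℝ} (hm : 0 < m) (hμ : 0 < μ) {n : ℕ} {u w w' : L2 (n + 2)}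
    {ξ ξ' : L2 (n + 1)} (h : IsDecomp m μ u w ξ) (h' : IsDecomp m μ u w' ξ') :
    w = w' ∧ ξ = ξ' := by
  have h1 := h.sub h'
  rw [sub_self] at h1
  obtain ⟨h2, h3⟩ := h1.eq_zero hm hμ
  exact ⟨sub_eq_zero.1 h2, sub_eq_zero.1 h3⟩

theorem form_eq_formValue {m μ : ℝ} (hm : 0 < m) (hμ : 0 < μ) (α : ℝ) {n : ℕ}
    {u w : L2 (n + 2)} {ξ : L2 (n + 1)} (h : IsDecomp m μ u w ξ) :
    form m μ α u = formValue m μ α u w ξ := by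
  have hex : ∃ p : L2 (n + 2) × L2 (n + 1), IsDecomp m μ u p.1 p.2 := ⟨(w, ξ), h⟩
  rw [form, dif_pos hex]
  obtain ⟨h1, h2⟩ := hex.choose_spec.unique hm hμ h
  rw [h1, h2]

/-- A decomposition for one spectral parameter gives a decomposition, with the same charge and
the same value of the form, for any other one. -/
theorem IsDecomp.exists_change {m μ μ' : ℝ} (hm : 0 < m) (hμ : 0 < μ) (hμ' : 0 < μ') {n : ℕ}
    {u w : L2 (n + 2)} {ξ : L2 (n + 1)} (h : IsDecomp m μ u w ξ) :
    ∃ w', IsDecomp m μ' u w' ξ ∧ ∀ α, formValue m μ' α u w' ξ = formValue m μ α u w ξ := by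
  obtain ⟨hw, hξ, he⟩ := h
  obtain ⟨hVI, hVv⟩ := integral_chargeSum_sq hm hμ hμ' hξ
  -- The difference of the two singular parts has to be added to w; it remains to see that it lies
  -- in H¹.
  let δ : (Fin (n + 2) → R3) → ℂ := fun q => ((G m μ q - G m μ' q : ℝ) : ℂ) * chargeSum ξ q
  have hδm : Measurable δ := (Complex.measurable_ofReal.comp
    ((measurable_G μ).sub (measurable_G μ'))).mul (measurable_chargeSum ξ)
  have hGd : ∀ q : Fin (n + 2) → R3, (G m μ q - G m μ' q) * symbol m μ' q =
      (μ' - μ) * G m μ q := by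
    intro q
    have h1 := symbol_pos hm hμ q
    have h2 := symbol_pos hm hμ' q
    rw [G, G]
    field_simp
    rw [symbol_sub m μ μ']
    ring
  have hGle : ∀ q : Fin (n + 2) → R3, G m μ q ≤ μ⁻¹ := fun q => by
    rw [G]
    gcongr
    exact le_symbol hm μ q
  -- By the resolvent identity one factor G_μ - G_μ' times the symbol is (μ' - μ)G_μ, hence bounded;
  -- the other factor leaves the integrable density |chargeSum|²|G_μ - G_μ'|.
  have hδI : Integrable fun q => ‖δ q‖ ^ 2 * symbol m μ' q := by
    refine (hVI.norm.const_mul (|μ' - μ| * μ⁻¹)).mono' ((hδm.norm.pow_const 2).mul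
      (measurable_symbol μ')).aestronglyMeasurable (.of_forall fun q => ?_)
    have h2 := symbol_pos hm hμ' q
    rw [Real.norm_of_nonneg (by positivity)]
    simp only [δ]
    rw [norm_mul, Complex.norm_real, norm_mul, norm_pow, norm_norm]
    have h3 : ‖G m μ q - G m μ' q‖ * symbol m μ' q = |μ' - μ| * G m μ q := by
      have := congrArg (fun x => ‖x‖) (hGd q)
      simp only [norm_mul] at this
      rwa [Real.norm_of_nonneg h2.le, Real.norm_of_nonneg (G_pos hm hμ q).le,
        Real.norm_eq_abs (μ' - μ)] at this
    calc (‖G m μ q - G m μ' q‖ * ‖chargeSum ξ q‖) ^ 2 * symbol m μ' q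
        = (‖G m μ q - G m μ' q‖ * symbol m μ' q) *
          (‖chargeSum ξ q‖ ^ 2 * ‖G m μ q - G m μ' q‖) := by ring
      _ ≤ (|μ' - μ| * μ⁻¹) * (‖chargeSum ξ q‖ ^ 2 * ‖G m μ q - G m μ' q‖) := by
          rw [h3]
          gcongr
          exact hGle q
  have hδ2 : ∫⁻ q, ‖δ q‖ₑ ^ 2 < ⊤ := by
    have := lintegral_norm_sq_mul_lt_top (W := fun _ => 1) (fun q => (symbol_pos hm hμ' q).le)
      (C := μ'⁻¹) (by positivity) (fun q => by
        rw [inv_mul_eq_div, le_div_iff₀ hμ', one_mul]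
        exact le_symbol hm μ' q) hδI
    simpa using this
  obtain ⟨d, hd⟩ := exists_hat_ae_eq hδm hδ2
  have hdI : Integrable fun q => ‖hat d q‖ ^ 2 * symbol m μ' q := by
    refine hδI.congr ?_
    filter_upwards [hd] with q hq
    rw [hq]
  have hdas : IsAntisymm d := by
    rw [isAntisymm_iff_hat]
    intro σ
    filter_upwards [hd, (measurePreserving_perm σ).quasiMeasurePreserving.ae hd,
      chargeSum_perm hξ.1 σ] with q h1 h2 h3
    rw [h1, h2]
    simp only [δ]
    rw [h3, G_perm hm, G_perm hm]
    ring
  have hdS : d ∈ sobolevAs 1 (n + 2) := (mem_sobolevAs_one_iff hm hμ' d).2 ⟨hdas, hdI⟩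
  have hd0 : (0 : L2 (n + 2)) ∈ sobolevAs 1 (n + 2) := by
    have := mem_sobolevAs_sub hw hw
    rwa [sub_self] at this
  let w' := w - (0 - d)
  have hw' : w' ∈ sobolevAs 1 (n + 2) := mem_sobolevAs_sub hw (mem_sobolevAs_sub hd0 hdS)
  have hw'e : w' = w + d := by simp [w']
  have hdec : IsDecomp m μ' u w' ξ := by
    refine ⟨hw', hξ, ?_⟩
    have h1 : u - w' = (u - w) - d := by rw [hw'e]; abel
    rw [h1]
    filter_upwards [hat_sub (u - w) d, he, hd] with q h2 h3 h4
    rw [h2, h3, h4, potentialHat_eq, potentialHat_eq]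
    simp only [δ]
    push_cast
    ring
  refine ⟨w', hdec, fun α => ?_⟩
  have hwI := ((mem_sobolevAs_one_iff hm hμ w).1 hw).2
  have hwI' := ((mem_sobolevAs_one_iff hm hμ' w').1 hw').2
  have huI := integrable_norm_hat_sq u
  -- Substituting ŵ = û - G_μ·chargeSum, the terms in |û|² and the mixed terms are the same for μ
  -- and μ', and only G|chargeSum|² differs.
  have hpt : ∀ᵐ q, (‖hat w q‖ ^ 2 * symbol m μ q - μ * ‖hat u q‖ ^ 2) -
      (‖hat w' q‖ ^ 2 * symbol m μ' q - μ' * ‖hat u q‖ ^ 2) =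
      ‖chargeSum ξ q‖ ^ 2 * (G m μ q - G m μ' q) := by
    filter_upwards [hat_sub u w, hat_sub u w', he, hdec.2.2] with q h1 h2 h3 h4
    rw [h3, potentialHat_eq] at h1
    rw [h4, potentialHat_eq] at h2
    have e1 : hat w q = hat u q - (G m μ q : ℂ) * chargeSum ξ q := by rw [h1]; ring
    have e2 : hat w' q = hat u q - (G m μ' q : ℂ) * chargeSum ξ q := by rw [h2]; ring
    have hs := symbol_pos hm hμ q
    have hs' := symbol_pos hm hμ' q
    have key : ∀ g : ℝ, ‖hat u q - (g : ℂ) * chargeSum ξ q‖ ^ 2 = ‖hat u q‖ ^ 2 -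
        2 * g * (hat u q * (starRingEnd ℂ) (chargeSum ξ q)).re + g ^ 2 * ‖chargeSum ξ q‖ ^ 2 := by
      intro g
      rw [← Complex.normSq_eq_norm_sq, ← Complex.normSq_eq_norm_sq, ← Complex.normSq_eq_norm_sq,
        Complex.normSq_sub, Complex.normSq_mul, map_mul, Complex.conj_ofReal,
        Complex.normSq_ofReal, mul_left_comm, Complex.re_ofReal_mul]
      ring
    rw [e1, e2, key, key, G, G]
    have hss : symbol m μ' q = symbol m μ q + (μ' - μ) := symbol_sub m μ μ' q
    have i1 : (symbol m μ q)⁻¹ * symbol m μ q = 1 := inv_mul_cancel₀ hs.ne'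
    have i2 : (symbol m μ' q)⁻¹ * symbol m μ' q = 1 := inv_mul_cancel₀ hs'.ne'
    set a := (symbol m μ q)⁻¹
    set b := (symbol m μ' q)⁻¹
    set R := (hat u q * (starRingEnd ℂ) (chargeSum ξ q)).re
    set z := ‖chargeSum ξ q‖ ^ 2
    linear_combination (-‖hat u q‖ ^ 2) * hss + (-2 * R + a * z) * i1 - (-2 * R + b * z) * i2
  have hInt : (∫ q, ‖hat w q‖ ^ 2 * symbol m μ q) - μ * ‖u‖ ^ 2 -
      ((∫ q, ‖hat w' q‖ ^ 2 * symbol m μ' q) - μ' * ‖u‖ ^ 2) =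
      ((n : ℝ) + 2) * (Tdiag m μ' ξ + Toff m μ' ξ - Tdiag m μ ξ - Toff m μ ξ) := by
    have hA : Integrable fun q => ‖hat w q‖ ^ 2 * symbol m μ q - μ * ‖hat u q‖ ^ 2 :=
      hwI.sub (huI.const_mul μ)
    have hB : Integrable fun q => ‖hat w' q‖ ^ 2 * symbol m μ' q - μ' * ‖hat u q‖ ^ 2 :=
      hwI'.sub (huI.const_mul μ')
    rw [← hVv, ← integral_congr_ae hpt, integral_sub hA hB, integral_sub hwI (huI.const_mul μ),
      integral_sub hwI' (huI.const_mul μ'), integral_const_mul, integral_const_mul,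
      integral_norm_hat_sq]
  simp only [formValue]
  linarith

/-! ### Coercivity, lower bounds and closedness of the form -/

theorem mul_norm_sq_le_integral {k : ℕ} {W : (Fin k → R3) → ℝ} {c : ℝ} (hc : ∀ q, c ≤ W q)
    {f : L2 k} (hf : Integrable fun q => ‖hat f q‖ ^ 2 * W q) :
    c * ‖f‖ ^ 2 ≤ ∫ q, ‖hat f q‖ ^ 2 * W q := by
  rw [← integral_norm_hat_sq, ← integral_const_mul]
  refine integral_mono ((integrable_norm_hat_sq f).const_mul c) hf fun q => ?_
  dsimp only
  rw [mul_comm]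
  gcongr
  exact hc q

theorem sqrt_mul_norm_sq_le_Tdiag {m μ : ℝ} (hm : 0 < m) {k : ℕ} {ξ : L2 k}
    (hd : Integrable (diagIntegrand m μ ξ)) :
    2 * Real.pi ^ 2 * Real.sqrt μ * ‖ξ‖ ^ 2 ≤ Tdiag m μ ξ :=
  mul_norm_sq_le_integral (fun q => sqrt_le_L hm μ q) hd

/-- Completeness of the weighted `L²` spaces in momentum space. -/
theorem exists_tendsto_weighted {k : ℕ} {W : (Fin k → R3) → ℝ} (hW : Measurable W) {c : ℝ}
    (hc0 : 0 < c) (hc : ∀ q, c ≤ W q) {f : ℕ → L2 k}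
    (hf : ∀ i j, Integrable fun q => ‖hat (f i - f j) q‖ ^ 2 * W q)
    (hlim : Tendsto (fun p : ℕ × ℕ => ∫ q, ‖hat (f p.1 - f p.2) q‖ ^ 2 * W q) atTop (𝓝 0)) :
    ∃ g, Tendsto f atTop (𝓝 g) ∧
      (∀ᶠ i in atTop, Integrable fun q => ‖hat (f i - g) q‖ ^ 2 * W q) ∧
      Tendsto (fun i => ∫ q, ‖hat (f i - g) q‖ ^ 2 * W q) atTop (𝓝 0) := by
  have hpos : ∀ (h : L2 k) q, 0 ≤ ‖hat h q‖ ^ 2 * W q := fun h q =>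
    mul_nonneg (by positivity) (hc0.le.trans (hc q))
  have hmeas : ∀ h : L2 k, Measurable fun q => ‖hat h q‖ ^ 2 * W q := fun h =>
    ((measurable_hat h).norm.pow_const 2).mul hW
  have hcau : CauchySeq f := by
    rw [cauchySeq_iff_tendsto_dist_atTop_0]
    have h1 : Tendsto (fun p : ℕ × ℕ =>
        Real.sqrt (c⁻¹ * ∫ q, ‖hat (f p.1 - f p.2) q‖ ^ 2 * W q)) atTop (𝓝 0) := by
      have := (Real.continuous_sqrt.tendsto _).comp (hlim.const_mul c⁻¹)
      simpa [Function.comp_def] using this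
    refine squeeze_zero (fun _ => dist_nonneg) (fun p => ?_) h1
    rw [dist_eq_norm]
    refine Real.le_sqrt_of_sq_le ?_
    rw [le_inv_mul_iff₀ hc0]
    exact mul_norm_sq_le_integral hc (hf _ _)
  obtain ⟨g, hg⟩ := cauchySeq_tendsto_of_complete hcau
  -- Fatou's lemma along a subsequence for which the transforms of f i - f (ns j) converge almost
  -- everywhere to that of f i - g.
  have key : ∀ ε : ℝ, 0 < ε → ∀ᶠ i in atTop,
      ∫⁻ q, ENNReal.ofReal (‖hat (f i - g) q‖ ^ 2 * W q) ≤ ENNReal.ofReal ε := by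
    intro ε hε
    have h1 := hlim.eventually (eventually_le_nhds hε)
    rw [← prod_atTop_atTop_eq] at h1
    filter_upwards [h1.curry] with i hi
    obtain ⟨ns, hns, hae⟩ := exists_subseq_tendsto_hat (tendsto_const_nhds.sub hg :
      Tendsto (fun j => f i - f j) atTop (𝓝 (f i - g)))
    calc ∫⁻ q, ENNReal.ofReal (‖hat (f i - g) q‖ ^ 2 * W q)
        = ∫⁻ q, liminf (fun j => ENNReal.ofReal (‖hat (f i - f (ns j)) q‖ ^ 2 * W q)) atTop := by
          refine lintegral_congr_ae ?_
          filter_upwards [hae] with q hq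
          refine (Tendsto.liminf_eq ?_).symm
          exact (ENNReal.continuous_ofReal.tendsto _).comp ((hq.norm.pow 2).mul_const _)
      _ ≤ liminf (fun j => ∫⁻ q, ENNReal.ofReal (‖hat (f i - f (ns j)) q‖ ^ 2 * W q)) atTop :=
          lintegral_liminf_le fun j => (hmeas _).ennreal_ofReal
      _ ≤ ENNReal.ofReal ε := by
          refine liminf_le_of_frequently_le' (Eventually.frequently ?_)
          filter_upwards [hns.tendsto_atTop.eventually hi] with j hj
          rw [← ofReal_integral_eq_lintegral_ofReal (hf _ _) (.of_forall (hpos _))]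
          exact ENNReal.ofReal_le_ofReal hj
  refine ⟨g, hg, ?_, ?_⟩
  · filter_upwards [key 1 one_pos] with i hi
    refine ⟨(hmeas _).aestronglyMeasurable, ?_⟩
    rw [hasFiniteIntegral_iff_ofReal (.of_forall (hpos _))]
    exact hi.trans_lt ENNReal.ofReal_lt_top
  · rw [Metric.tendsto_nhds]
    intro ε hε
    filter_upwards [key (ε / 2) (by positivity)] with i hi
    rw [Real.dist_eq, sub_zero, abs_of_nonneg (integral_nonneg (hpos _)),
      integral_eq_lintegral_of_nonneg_ae (.of_forall (hpos _)) (hmeas _).aestronglyMeasurable]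
    calc _ ≤ ε / 2 := ENNReal.toReal_le_of_le_ofReal (by positivity) hi
      _ < ε := by linarith

theorem IsDecomp.form_eq {m μ μ' : ℝ} (hm : 0 < m) (hμ : 0 < μ) (hμ' : 0 < μ') (α : ℝ) {n : ℕ}
    {u w : L2 (n + 2)} {ξ : L2 (n + 1)} (h : IsDecomp m μ' u w ξ) :
    form m μ α u = formValue m μ' α u w ξ := by
  obtain ⟨w', h1, h2⟩ := h.exists_change hm hμ' hμ
  rw [form_eq_formValue hm hμ α h1, h2]

theorem IsDecomp.le_formValue {m μ : ℝ} (hm : 0 < m) (hμ : 0 < μ) (α : ℝ) {n : ℕ}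
    {u w : L2 (n + 2)} {ξ : L2 (n + 1)} (h : IsDecomp m μ u w ξ) :
    (∫ q, ‖hat w q‖ ^ 2 * symbol m μ q) - μ * ‖u‖ ^ 2
      + ((n : ℝ) + 2) * (α * ‖ξ‖ ^ 2 + (1 - (Lam m).toReal) * Tdiag m μ ξ)
      ≤ formValue m μ α u w ξ := by
  obtain ⟨hξ, hd⟩ := (mem_sobolevAs_half_iff hm hμ ξ).1 h.2.1
  have := neg_Lam_mul_Tdiag_le_Toff hm hμ hξ hd
  have h1 : α * ‖ξ‖ ^ 2 + (1 - (Lam m).toReal) * Tdiag m μ ξ ≤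
      α * ‖ξ‖ ^ 2 + Tdiag m μ ξ + Toff m μ ξ := by linarith
  rw [formValue]
  gcongr

theorem integral_symbol_nonneg {m μ : ℝ} (hm : 0 < m) (hμ : 0 < μ) {k : ℕ} (w : L2 k) :
    0 ≤ ∫ q, ‖hat w q‖ ^ 2 * symbol m μ q :=
  integral_nonneg fun q => mul_nonneg (by positivity) (symbol_pos hm hμ q).le

theorem toReal_Lam_lt_one {m : ℝ} (hΛ : Lam m < 1) : (Lam m).toReal < 1 := by
  have := (ENNReal.toReal_lt_toReal hΛ.ne_top ENNReal.one_ne_top).2 hΛ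
  simpa using this

/-- The form is evaluated with μ' in place of μ. Since T_diag ≥ 2π²√μ' ‖ξ‖², the condition `hα`
makes the charge part non-negative, and only -μ'‖u‖² remains. -/
theorem neg_mul_norm_sq_le_form {m μ μ' : ℝ} (hm : 0 < m) (hμ : 0 < μ) (hμ' : 0 < μ') {α : ℝ}
    (hΛ : Lam m < 1) (hα : 0 ≤ α + 2 * Real.pi ^ 2 * (1 - (Lam m).toReal) * Real.sqrt μ') {n : ℕ}
    {u : L2 (n + 2)} (hu : u ∈ formDomain m μ n) : -μ' * ‖u‖ ^ 2 ≤ form m μ α u := by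
  obtain ⟨-, w, ξ, h⟩ := hu
  obtain ⟨w', h', -⟩ := h.exists_change hm hμ hμ'
  rw [h'.form_eq hm hμ hμ' α]
  refine le_trans ?_ (h'.le_formValue hm hμ' α)
  have hδ := sub_pos.2 (toReal_Lam_lt_one hΛ)
  have h1 := mul_le_mul_of_nonneg_left
    (sqrt_mul_norm_sq_le_Tdiag hm ((mem_sobolevAs_half_iff hm hμ' ξ).1 h'.2.1).2) hδ.le
  have h2 := mul_nonneg hα (sq_nonneg ‖ξ‖)
  have h3 : 0 ≤ ((n : ℝ) + 2) * (α * ‖ξ‖ ^ 2 + (1 - (Lam m).toReal) * Tdiag m μ' ξ) :=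
    mul_nonneg (by positivity) (by linarith)
  have h4 := integral_symbol_nonneg hm hμ' w'
  linarith

/-- For α ≥ 0 every positive spectral parameter is admissible; let it tend to zero. -/
theorem form_nonneg {m μ : ℝ} (hm : 0 < m) (hμ : 0 < μ) {α : ℝ} (hΛ : Lam m < 1) (hα : 0 ≤ α)
    {n : ℕ} {u : L2 (n + 2)} (hu : u ∈ formDomain m μ n) : 0 ≤ form m μ α u := by
  have hδ := sub_pos.2 (toReal_Lam_lt_one hΛ)
  have hle : ∀ μ' : ℝ, 0 < μ' → -μ' * ‖u‖ ^ 2 ≤ form m μ α u := fun μ' hμ' =>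
    neg_mul_norm_sq_le_form hm hμ hμ' hΛ (by positivity) hu
  have hlim : Tendsto (fun μ' : ℝ => -μ' * ‖u‖ ^ 2) (𝓝[>] 0) (𝓝 0) := by
    have : Continuous fun μ' : ℝ => -μ' * ‖u‖ ^ 2 := by fun_prop
    simpa using (this.tendsto 0).mono_left nhdsWithin_le_nhds
  exact le_of_tendsto hlim (eventually_mem_nhdsWithin.mono fun μ' h => hle μ' h)

/-- The spectral parameter is chosen so that 2π²(1 - Λ)√μ' = -α, the smallest admissible value. -/
theorem neg_sq_mul_norm_sq_le_form {m μ : ℝ} (hm : 0 < m) (hμ : 0 < μ) {α : ℝ} (hΛ : Lam m < 1)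
    (hα : α < 0) {n : ℕ} {u : L2 (n + 2)} (hu : u ∈ formDomain m μ n) :
    -(α / (2 * Real.pi ^ 2 * (1 - (Lam m).toReal))) ^ 2 * ‖u‖ ^ 2 ≤ form m μ α u := by
  have hδ := sub_pos.2 (toReal_Lam_lt_one hΛ)
  have hD : 0 < 2 * Real.pi ^ 2 * (1 - (Lam m).toReal) := by positivity
  refine neg_mul_norm_sq_le_form hm hμ (sq_pos_of_neg (div_neg_of_neg_of_pos hα hD)) hΛ ?_ hu
  rw [Real.sqrt_sq_eq_abs, abs_of_neg (div_neg_of_neg_of_pos hα hD), mul_neg,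
    mul_div_cancel₀ _ hD.ne', add_neg_cancel]

/-- At a fixed q only finitely many values of ξ̂ enter Gξ, so almost everywhere convergence along a
common subsequence passes the relation to the limit. -/
theorem IsDecomp.of_tendsto {m μ : ℝ} {n : ℕ} {u w : ℕ → L2 (n + 2)}
    {ξ : ℕ → L2 (n + 1)} {v x : L2 (n + 2)} {ζ : L2 (n + 1)}
    (h : ∀ i, IsDecomp m μ (u i) (w i) (ξ i)) (hu : Tendsto u atTop (𝓝 v))
    (hw : Tendsto w atTop (𝓝 x)) (hξ : Tendsto ξ atTop (𝓝 ζ))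
    (hx : x ∈ sobolevAs 1 (n + 2)) (hζ : ζ ∈ sobolevAs (1 / 2) (n + 1)) :
    IsDecomp m μ v x ζ := by
  refine ⟨hx, hζ, ?_⟩
  obtain ⟨a, ha, hae⟩ := exists_subseq_tendsto_hat (hu.sub hw)
  obtain ⟨b, hb, hbe⟩ := exists_subseq_tendsto_hat (hξ.comp ha.tendsto_atTop)
  have h1 : ∀ᵐ q, ∀ i, hat (u i - w i) q = potentialHat m μ (ξ i) q :=
    ae_all_iff.2 fun i => (h i).2.2
  have h2 : ∀ᵐ q : Fin (n + 2) → R3, ∀ j : Fin (n + 2),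
      Tendsto (fun i => hat (ξ (a (b i))) (j.removeNth q)) atTop (𝓝 (hat ζ (j.removeNth q))) :=
    ae_all_iff.2 fun j => (quasiMeasurePreserving_removeNth j).ae hbe
  filter_upwards [hae, h1, h2] with q h3 h4 h5
  refine tendsto_nhds_unique (h3.comp hb.tendsto_atTop) ?_
  have : Tendsto (fun i => potentialHat m μ (ξ (a (b i))) q) atTop (𝓝 (potentialHat m μ ζ q)) :=
    tendsto_const_nhds.mul (tendsto_finsetSum _ fun j _ => tendsto_const_nhds.mul (h5 j))
  exact this.congr fun i => (h4 _).symm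

/-- For a large spectral parameter ν, F_α + ν‖·‖² controls the weighted norms of w and ξ. These
converge by completeness, the decomposition survives the limit, and the form tends to zero along u i
- v because T_off is bounded by T_diag. -/
theorem isClosedForm_form {m μ : ℝ} (hm : 0 < m) (hμ : 0 < μ) (α : ℝ) (hΛ : Lam m < 1) (n : ℕ) :
    IsClosedForm (formDomain m μ n) (form m μ α) := by
  intro u hu hcau hF
  have hδ := sub_pos.2 (toReal_Lam_lt_one hΛ)
  set δ := 1 - (Lam m).toReal with hδdef
  -- With √ν = r half of δ T_diag is at least (|α| + π²δ)‖ξ‖², which absorbs α‖ξ‖² and leaves the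
  -- other half for coercivity.
  set r := |α| / (Real.pi ^ 2 * δ) + 1 with hr
  have hr0 : 0 < r := by positivity
  set ν := r ^ 2 with hν
  have hν0 : 0 < ν := by positivity
  have hdec : ∀ i, ∃ w ξ, IsDecomp m ν (u i) w ξ := fun i => by
    obtain ⟨-, w, ξ, h⟩ := hu i
    obtain ⟨w', h', -⟩ := h.exists_change hm hμ hν0
    exact ⟨w', ξ, h'⟩
  choose w ξ hd using hdec
  have hαT : ∀ ζ ∈ sobolevAs (1 / 2) (n + 1),
      -(δ / 2 * Tdiag m ν ζ) ≤ α * ‖ζ‖ ^ 2 ∧ 0 ≤ Tdiag m ν ζ := fun ζ hζ => by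
    have h1 := sqrt_mul_norm_sq_le_Tdiag hm ((mem_sobolevAs_half_iff hm hν0 ζ).1 hζ).2
    rw [hν, Real.sqrt_sq hr0.le, ← hν] at h1
    have h2 : |α| ≤ δ / 2 * (2 * Real.pi ^ 2 * r) := by
      have : δ / 2 * (2 * Real.pi ^ 2 * r) = |α| + Real.pi ^ 2 * δ := by
        rw [hr]; field_simp
      rw [this]
      have : 0 < Real.pi ^ 2 * δ := by positivity
      linarith
    have h3 := mul_le_mul_of_nonneg_left h1 (half_pos hδ).le
    have h4 := mul_le_mul_of_nonneg_right h2 (sq_nonneg ‖ζ‖)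
    have h5 := mul_le_mul_of_nonneg_right (neg_abs_le α) (sq_nonneg ‖ζ‖)
    exact ⟨by linarith, le_trans (by positivity) h1⟩
  have hcoer : ∀ p : ℕ × ℕ, (∫ q, ‖hat (w p.1 - w p.2) q‖ ^ 2 * symbol m ν q) +
      ((n : ℝ) + 2) * (δ / 2 * Tdiag m ν (ξ p.1 - ξ p.2)) ≤
      form m μ α (u p.1 - u p.2) + ν * dist (u p.1) (u p.2) ^ 2 := fun p => by
    have h := (hd p.1).sub (hd p.2)
    rw [h.form_eq hm hμ hν0 α, dist_eq_norm]
    have h1 := h.le_formValue hm hν0 α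
    have h2 := (hαT _ h.2.1).1
    have h3 : ((n : ℝ) + 2) * (δ / 2 * Tdiag m ν (ξ p.1 - ξ p.2)) ≤ ((n : ℝ) + 2) *
      (α * ‖ξ p.1 - ξ p.2‖ ^ 2 + δ * Tdiag m ν (ξ p.1 - ξ p.2)) := by
      gcongr
      linarith
    linarith
  have hrhs : Tendsto (fun p : ℕ × ℕ => form m μ α (u p.1 - u p.2) +
      ν * dist (u p.1) (u p.2) ^ 2) atTop (𝓝 0) := by
    have := hF.add (((cauchySeq_iff_tendsto_dist_atTop_0.1 hcau).pow 2).const_mul ν)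
    simpa using this
  have hwlim : Tendsto (fun p : ℕ × ℕ => ∫ q, ‖hat (w p.1 - w p.2) q‖ ^ 2 * symbol m ν q)
      atTop (𝓝 0) := by
    refine squeeze_zero (fun p => integral_symbol_nonneg hm hν0 _) (fun p => ?_) hrhs
    have h1 := (hαT _ (mem_sobolevAs_sub (hd p.1).2.1 (hd p.2).2.1)).2
    have : 0 ≤ ((n : ℝ) + 2) * (δ / 2 * Tdiag m ν (ξ p.1 - ξ p.2)) := by positivity
    linarith [hcoer p]
  have hξlim : Tendsto (fun p : ℕ × ℕ => Tdiag m ν (ξ p.1 - ξ p.2)) atTop (𝓝 0) := by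
    have h0 : Tendsto (fun p : ℕ × ℕ => (((n : ℝ) + 2) * (δ / 2))⁻¹ *
        (form m μ α (u p.1 - u p.2) + ν * dist (u p.1) (u p.2) ^ 2)) atTop (𝓝 0) := by
      simpa using hrhs.const_mul ((((n : ℝ) + 2) * (δ / 2))⁻¹)
    refine squeeze_zero
      (fun p => (hαT _ (mem_sobolevAs_sub (hd p.1).2.1 (hd p.2).2.1)).2) (fun p => ?_) h0
    rw [le_inv_mul_iff₀ (by positivity)]
    linarith [hcoer p, integral_symbol_nonneg hm hν0 (w p.1 - w p.2)]
  obtain ⟨v, hv⟩ := cauchySeq_tendsto_of_complete hcau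
  obtain ⟨x, hx, hxI, hx0⟩ := exists_tendsto_weighted (measurable_symbol ν) hν0 (le_symbol hm ν)
    (fun i j => ((mem_sobolevAs_one_iff hm hν0 _).1 (mem_sobolevAs_sub (hd i).1 (hd j).1)).2) hwlim
  obtain ⟨ζ, hζ, hζI, hζ0⟩ := exists_tendsto_weighted (measurable_L ν)
    (by positivity : 0 < 2 * Real.pi ^ 2 * Real.sqrt ν) (sqrt_le_L hm ν)
    (fun i j => ((mem_sobolevAs_half_iff hm hν0 _).1
      (mem_sobolevAs_sub (hd i).2.1 (hd j).2.1)).2) hξlim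
  have hxas : IsAntisymm x :=
    (isClosed_isAntisymm _).mem_of_tendsto hx (.of_forall fun i => (hd i).1.1)
  have hζas : IsAntisymm ζ :=
    (isClosed_isAntisymm _).mem_of_tendsto hζ (.of_forall fun i => (hd i).2.1.1)
  have hvas : IsAntisymm v :=
    (isClosed_isAntisymm _).mem_of_tendsto hv (.of_forall fun i => (hu i).1)
  -- A single index with w i - x in H¹ suffices, since w i already lies there.
  have hxS : x ∈ sobolevAs 1 (n + 2) := by
    obtain ⟨i, hi⟩ := hxI.exists
    have := mem_sobolevAs_sub (hd i).1
      ((mem_sobolevAs_one_iff hm hν0 (w i - x)).2 ⟨(hd i).1.1.sub hxas, hi⟩)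
    rwa [sub_sub_cancel] at this
  have hζS : ζ ∈ sobolevAs (1 / 2) (n + 1) := by
    obtain ⟨i, hi⟩ := hζI.exists
    have := mem_sobolevAs_sub (hd i).2.1
      ((mem_sobolevAs_half_iff hm hν0 (ξ i - ζ)).2 ⟨(hd i).2.1.1.sub hζas, hi⟩)
    rwa [sub_sub_cancel] at this
  have hvd : IsDecomp m ν v x ζ := .of_tendsto hd hv hx hζ hxS hζS
  obtain ⟨x', hx', -⟩ := hvd.exists_change hm hν0 hμ
  refine ⟨v, ⟨hvas, x', ζ, hx'⟩, hv, ?_⟩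
  obtain ⟨C, -, hC⟩ := exists_abs_Toff_le hm
  have hT0 : Tendsto (fun i => Tdiag m ν (ξ i - ζ)) atTop (𝓝 0) := hζ0
  have hO0 : Tendsto (fun i => Toff m ν (ξ i - ζ)) atTop (𝓝 0) := by
    refine squeeze_zero_norm (fun i => ?_) (by simpa using hT0.const_mul C)
    obtain ⟨h1, h2⟩ := (mem_sobolevAs_half_iff hm hν0 _).1 (mem_sobolevAs_sub (hd i).2.1 hζS)
    exact hC n ν hν0 _ h1 h2
  have hu0 : Tendsto (fun i => ‖u i - v‖) atTop (𝓝 0) := tendsto_iff_norm_sub_tendsto_zero.1 hv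
  have hξ0 : Tendsto (fun i => ‖ξ i - ζ‖) atTop (𝓝 0) := tendsto_iff_norm_sub_tendsto_zero.1 hζ
  have hfin : Tendsto (fun i => formValue m ν α (u i - v) (w i - x) (ξ i - ζ)) atTop (𝓝 0) := by
    have := (hx0.sub ((hu0.pow 2).const_mul ν)).add
      (((((hξ0.pow 2).const_mul α).add hT0).add hO0).const_mul ((n : ℝ) + 2))
    simpa [formValue] using this
  exact hfin.congr fun i => (((hd i).sub hvd).form_eq hm hμ hν0 α).symm

end PointInteraction

end

theorem theorem1 (m : ℝ) (hm : 0 < m) :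
    Lam m < ⊤ ∧
    (∀ (n : ℕ) (μ : ℝ), 0 < μ → ∀ ξ ∈ sobolevAs (1 / 2) (n + 1),
      Integrable (diagIntegrand m μ ξ) ∧ Integrable (offIntegrand m μ ξ) ∧
      -(Lam m).toReal * Tdiag m μ ξ ≤ Toff m μ ξ) ∧
    (Lam m < 1 → ∀ (n : ℕ) (μ : ℝ), 0 < μ → ∀ α : ℝ,
      IsClosedForm (formDomain m μ n) (form m μ α) ∧
      ∀ u ∈ formDomain m μ n,
        (0 ≤ α → 0 ≤ form m μ α u) ∧
        (α < 0 →
          -(α / (2 * Real.pi ^ 2 * (1 - (Lam m).toReal))) ^ 2 * ‖u‖ ^ 2 ≤ form m μ α u)) := by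
  refine ⟨Lam_lt_top hm, fun n μ hμ ξ hξ => ?_, fun hΛ n μ hμ α => ?_⟩
  · obtain ⟨hξas, hd⟩ := (mem_sobolevAs_half_iff hm hμ ξ).1 hξ
    exact ⟨hd, integrable_offIntegrand hm hμ hξas hd, neg_Lam_mul_Tdiag_le_Toff hm hμ hξas hd⟩
  · exact ⟨isClosedForm_form hm hμ α hΛ n, fun u hu =>
      ⟨fun hα => form_nonneg hm hμ hΛ hα hu, fun hα => neg_sq_mul_norm_sq_le_form hm hμ hΛ hα hu⟩⟩
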